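/- **Setting.** Let $l>0$, $I=(-\frac l2,\frac l2)$, $S_\varepsilon=I\times(-\frac\varepsilon2,\frac\varepsilon2)$ for $\varepsilon>0$, and $S=S_1=I\times(-\frac12,\frac12)$. Functions on $I$ are regarded as functions on $S$ that do not depend on $x_2$. Let $Q_W^2$ be a quadratic form on $\mathbb R^{2\times2}$ that depends only on the symmetric part of its argument and is positive definite on $\mathbb R^{2\times 2}_{\rm sym}$. Writing $Q^2_W(q_{11},q_{12},q_{22})$ for its value at the symmetric matrix with these entries, put $$Q_W^1(q_{11},q_{12})=\min_{\alpha\in\mathbb R}Q_W^2(q_{11},q_{12},\alpha),\qquad Q_W^0(q_{11})=\min_{z\in\mathbb R}Q_W^1(q_{11},z).$$ Let $\hat u_1\in W^{1,2}(I)$ and $\hat u_2,\hat v\in W^{2,2}(I)$. **Admissible functions.** $\mathscr S^{2D}_\varepsilon$ is the set of all $(u,v)\in W^{1,2}(S_\varepsilon;\mathbb R^2)\times W^{2,2}(S_\varepsilon)$ such that, in the sense of traces on $\partial I\times(-\frac\varepsilon2,\frac\varepsilon2)$, $$u(x)=\big(\hat u_1(x_1)-\tfrac{x_2}{\varepsilon}\hat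 u_2'(x_1),\ \tfrac1\varepsilon\hat u_2(x_1)\big),\qquad v(x)=\hat v(x_1),\qquad \partial_1v(x)=\hat v'(x_1).$$ $\mathscr S^{1D}$ is the set of all $(y,w,\theta)$ where $w\in W^{2,2}(I)$ with $w=\hat v$, $w'=\hat v'$ on $\partial I$; $\theta\in W^{1,2}_0(I)$; and $y\in W^{1,2}(S;\mathbb R^2)$ satisfies $e(y)_{12}=e(y)_{22}=0$ a.e. in $S$ and, in the sense of traces, $y_1=\hat u_1-x_2\hat u_2'$, $y_2=\hat u_2$ on $\partial I\times(-\frac12,\frac12)$. Here $e(u)=\frac12(\nabla u+\nabla u^T)$. **Energies.** For $f_\varepsilon\in L^2(S_\varepsilon)$, $g_\varepsilon\in L^2(S_\varepsilon;\mathbb R^2)$, $f\in L^2(I)$, $g\in L^2(I;\mathbb R^2)$ let $$\phi_\varepsilon(u,v)=\frac1\varepsilon\int_{S_\varepsilon}\tfrac12Q_W^2\big(e(u)+\tfrac12\nabla v\otimes\nabla v\big)+\frac1\varepsilon\int_{S_\varepsilon}\tfrac1{24}Q_W^2(\nabla^2v)-\frac1\varepsilon\int_{S_\varepsilon}(f_\varepsilon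 v+g_\varepsilon\cdot u),$$ $$\phi_0(y,w,\theta)=\frac12\int_SQ_W^0\big(\partial_1y_1+\tfrac12|w'|^2\big)+\frac1{24}\int_IQ_W^1(w'',\theta')-\int_S(f w+g\cdot y).$$ **Convergence.** For $(u,v)\in\mathscr S^{2D}_\varepsilon$ let $y_1(x)=u_1(x_1,\varepsilon x_2)$, $y_2(x)=\varepsilon u_2(x_1,\varepsilon x_2)$, $w(x)=v(x_1,\varepsilon x_2)$ on $S$ be the scaled displacements, and $$E^\varepsilon y=\begin{pmatrix}\partial_1y_1&\frac1{2\varepsilon}(\partial_1y_2+\partial_2y_1)\\ \frac1{2\varepsilon}(\partial_2y_1+\partial_1y_2)&\frac1{\varepsilon^2}\partial_2y_2\end{pmatrix},\quad \nabla_\varepsilon w=\big(\partial_1w,\tfrac1\varepsilon\partial_2w\big),\quad \nabla^2_\varepsilon w=\begin{pmatrix}\partial^2_{11}w&\frac1\varepsilon\partial^2_{12}w\\ \frac1\varepsilon\partial^2_{21}w&\frac1{\varepsilon^2}\partial^2_{22}w\end{pmatrix}.$$ Let $\varepsilon_n>0$, $\varepsilon_n\to0$, $(u_n,v_n)\in\mathscr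 S^{2D}_{\varepsilon_n}$ with scaled displacements $(y_n,w_n)$, and $(y,w,\theta)\in\mathscr S^{1D}$. We write $(u_n,v_n)\stackrel{\pi\sigma}{\to}(y,w,\theta)$ if there are $\gamma\in L^2(S)$ and $E\in L^2(S;\mathbb R^{2\times2}_{\rm sym})$ with $E_{11}=\partial_1y_1$ such that $$w_n\rightharpoonup w\ \text{in }W^{2,2}(S),\qquad \nabla_{\varepsilon_n}w_n\rightharpoonup(w',\theta)\ \text{in }W^{1,2}(S;\mathbb R^2),\qquad \nabla^2_{\varepsilon_n}w_n\rightharpoonup\begin{pmatrix}w''&\theta'\\ \theta'&\gamma\end{pmatrix}\ \text{in }L^2(S;\mathbb R^{2\times2}),$$ $$y_n\rightharpoonup y\ \text{in }W^{1,2}(S;\mathbb R^2),\qquad E^{\varepsilon_n}y_n\rightharpoonup E\ \text{in }L^2(S;\mathbb R^{2\times2}).$$ We write $(u_n,v_n)\stackrel{\pi\rho}{\to}(y,w,\theta)$ if the same holds with strong convergence in place of weak convergence everywhere. **Lemma.** In this setting, let the forces satisfy $f_{\varepsilon_n}(x_1,\varepsilon_nx_2)\rightharpoonup f$, $(g_{\varepsilon_n})_1(x_1,\varepsilon_nx_2)\rightharpoonup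 g_1$ and $\frac1{\varepsilon_n}(g_{\varepsilon_n})_2(x_1,\varepsilon_nx_2)\rightharpoonup g_2$ weakly in $L^2(S)$ (for instance, let all forces be zero). Let $(u_n,v_n)\in\mathscr S^{2D}_{\varepsilon_n}$ and $(y,w,\theta)\in\mathscr S^{1D}$ be such that $$(u_n,v_n)\stackrel{\pi\sigma}{\to}(y,w,\theta)\qquad\text{and}\qquad\phi_{\varepsilon_n}(u_n,v_n)\to\phi_0(y,w,\theta).$$ Then $(u_n,v_n)\stackrel{\pi\rho}{\to}(y,w,\theta)$. -/

import Mathlib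

open Filter Topology MeasureTheory Set
open scoped ContDiff ENNReal

noncomputable section

namespace Ribbon

/-! ### Weak derivatives, Sobolev spaces, traces and modes of convergence

All function spaces are spaces of real-valued functions on an open subset `Ω` of `E`; below
`E` is `ℝ` or `ℝ × ℝ` with Lebesgue measure. Functions are only relevant almost everywhere in `Ω`. -/

section General

variable {E : Type*} [NormedAddCommGroup E] [NormedSpace ℝ E] [MeasureSpace E]

/-- `g` is a weak derivative of `f` in `Ω` in the direction `e`. -/
def HasWeakDeriv (Ω : Set E) (e : E) (f g : E → ℝ) : Prop :=
  LocallyIntegrableOn f Ω ∧ LocallyIntegrableOn g Ω ∧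
    ∀ φ : E → ℝ, ContDiff ℝ ∞ φ → HasCompactSupport φ → tsupport φ ⊆ Ω →
      ∫ x in Ω, f x * fderiv ℝ φ x e = -∫ x in Ω, g x * φ x

open Classical in
/-- The weak derivative of `f` in `Ω` in the direction `e` (unique almost everywhere in an open set
`Ω`; the value is `0` if there is no weak derivative). -/
def weakDeriv (Ω : Set E) (e : E) (f : E → ℝ) : E → ℝ :=
  if h : ∃ g, HasWeakDeriv Ω e f g then h.choose else 0

/-- `f ∈ L²(Ω)`. -/
def MemL2 (Ω : Set E) (f : E → ℝ) : Prop :=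
  MemLp f 2 (volume.restrict Ω)

/-- `f ∈ W^{1,2}(Ω)`. -/
def MemW12 (Ω : Set E) (f : E → ℝ) : Prop :=
  MemL2 Ω f ∧ ∀ e : E, ∃ g, MemL2 Ω g ∧ HasWeakDeriv Ω e f g

/-- `f ∈ W^{2,2}(Ω)`. -/
def MemW22 (Ω : Set E) (f : E → ℝ) : Prop :=
  MemW12 Ω f ∧ ∀ e : E, MemW12 Ω (weakDeriv Ω e f)

/-- The trace of `f ∈ W^{1,2}(Ω)` vanishes on the part of the boundary that carries the surface
measure `σ`: the pair `(f, 0)` is a limit, in `W^{1,2}(Ω) × L²(σ)`, of pairs `(φ, φ|_Γ)` with `φ`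
smooth up to the boundary. (The trace operator is the continuous extension of the restriction of
smooth functions.) -/
def ZeroTrace (Ω : Set E) (σ : Measure E) (f : E → ℝ) : Prop :=
  ∃ φ : ℕ → E → ℝ, (∀ k, ContDiff ℝ ∞ (φ k)) ∧
    Tendsto (fun k => eLpNorm (fun x => φ k x - f x) 2 (volume.restrict Ω)) atTop (𝓝 0) ∧
    (∀ e : E, Tendsto
      (fun k => eLpNorm (fun x => fderiv ℝ (φ k) x e - weakDeriv Ω e f x) 2 (volume.restrict Ω))
      atTop (𝓝 0)) ∧
    Tendsto (fun k => eLpNorm (φ k) 2 σ) atTop (𝓝 0)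

/-- Weak convergence in `L²(Ω)`. -/
def WeakL2 (Ω : Set E) (F : ℕ → E → ℝ) (G : E → ℝ) : Prop :=
  (∀ n, MemL2 Ω (F n)) ∧ MemL2 Ω G ∧
    ∀ ψ : E → ℝ, MemL2 Ω ψ →
      Tendsto (fun n => ∫ x in Ω, F n x * ψ x) atTop (𝓝 (∫ x in Ω, G x * ψ x))

/-- Strong convergence in `L²(Ω)`. -/
def StrongL2 (Ω : Set E) (F : ℕ → E → ℝ) (G : E → ℝ) : Prop :=
  (∀ n, MemL2 Ω (F n)) ∧ MemL2 Ω G ∧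
    Tendsto (fun n => eLpNorm (fun x => F n x - G x) 2 (volume.restrict Ω)) atTop (𝓝 0)

/-- Convergence in `W^{1,2}(Ω)`, weak or strong according to whether `conv` is weak or strong
convergence in `L²`: the functions and their first weak derivatives converge. -/
def ConvW12 (conv : Set E → (ℕ → E → ℝ) → (E → ℝ) → Prop)
    (Ω : Set E) (F : ℕ → E → ℝ) (G : E → ℝ) : Prop :=
  (∀ n, MemW12 Ω (F n)) ∧ MemW12 Ω G ∧ conv Ω F G ∧
    ∀ e : E, conv Ω (fun n => weakDeriv Ω e (F n)) (weakDeriv Ω e G)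

/-- Convergence in `W^{2,2}(Ω)`, weak or strong as for `ConvW12`. -/
def ConvW22 (conv : Set E → (ℕ → E → ℝ) → (E → ℝ) → Prop)
    (Ω : Set E) (F : ℕ → E → ℝ) (G : E → ℝ) : Prop :=
  ConvW12 conv Ω F G ∧
    ∀ e : E, ConvW12 conv Ω (fun n => weakDeriv Ω e (F n)) (weakDeriv Ω e G)

end General

/-! ### Geometry and differential operators -/

/-- The interval `I = (-l/2, l/2)`. -/
def interval (l : ℝ) : Set ℝ := Ioo (-l / 2) (l / 2)

/-- The rectangle `I × (-h/2, h/2)`; it is `S_ε` for `h = ε` and `S` for `h = 1`. -/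
def rect (l h : ℝ) : Set (ℝ × ℝ) := interval l ×ˢ interval h

/-- The counting measure of `∂I = {-l/2, l/2}`. -/
def endpoints (l : ℝ) : Measure ℝ := Measure.dirac (-l / 2) + Measure.dirac (l / 2)

/-- The length measure of the lateral boundary `∂I × (-h/2, h/2)`. -/
def lateral (l h : ℝ) : Measure (ℝ × ℝ) := (endpoints l).prod (volume.restrict (interval h))

/-- The weak derivative `f'` of a function on the interval `I`. -/
def D (l : ℝ) (f : ℝ → ℝ) : ℝ → ℝ := weakDeriv (interval l) 1 f

/-- The weak partial derivatives in `Ω ⊆ ℝ²`; the coordinates `x₁, x₂` carry the indices `0, 1`. -/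
def pd (Ω : Set (ℝ × ℝ)) (i : Fin 2) (f : ℝ × ℝ → ℝ) : ℝ × ℝ → ℝ :=
  weakDeriv Ω (![((1 : ℝ), (0 : ℝ)), (0, 1)] i) f

/-- The linear strain `e(u) = (∇u + ∇uᵀ)/2` of `u = (u₁, u₂)`. -/
def strain (Ω : Set (ℝ × ℝ)) (u : Fin 2 → ℝ × ℝ → ℝ) (x : ℝ × ℝ) : Matrix (Fin 2) (Fin 2) ℝ :=
  Matrix.of fun i j => (1 / 2) * (pd Ω j (u i) x + pd Ω i (u j) x)

/-- The tensor product `∇v ⊗ ∇v`. -/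
def gradTensor (Ω : Set (ℝ × ℝ)) (v : ℝ × ℝ → ℝ) (x : ℝ × ℝ) : Matrix (Fin 2) (Fin 2) ℝ :=
  Matrix.of fun i j => pd Ω i v x * pd Ω j v x

/-- The Hessian `∇²v`. -/
def hessian (Ω : Set (ℝ × ℝ)) (v : ℝ × ℝ → ℝ) (x : ℝ × ℝ) : Matrix (Fin 2) (Fin 2) ℝ :=
  Matrix.of fun i j => pd Ω i (pd Ω j v) x

/-- The scaled in-plane displacement `y = (u₁(x₁, ε x₂), ε u₂(x₁, ε x₂))`. -/
def scaledU (ε : ℝ) (u : Fin 2 → ℝ × ℝ → ℝ) : Fin 2 → ℝ × ℝ → ℝ :=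
  ![fun x => u 0 (x.1, ε * x.2), fun x => ε * u 1 (x.1, ε * x.2)]

/-- The scaled out-of-plane displacement `w = v(x₁, ε x₂)`. -/
def scaledV (ε : ℝ) (v : ℝ × ℝ → ℝ) : ℝ × ℝ → ℝ := fun x => v (x.1, ε * x.2)

/-- The scaled strain `E^ε y` on `S`. -/
def scaledStrain (l ε : ℝ) (y : Fin 2 → ℝ × ℝ → ℝ) (x : ℝ × ℝ) : Matrix (Fin 2) (Fin 2) ℝ :=
  let S := rect l 1
  !![pd S 0 (y 0) x, 1 / (2 * ε) * (pd S 0 (y 1) x + pd S 1 (y 0) x);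
     1 / (2 * ε) * (pd S 1 (y 0) x + pd S 0 (y 1) x), 1 / ε ^ 2 * pd S 1 (y 1) x]

/-- The scaled gradient `∇_ε w = (∂₁w, ∂₂w / ε)` on `S`. -/
def scaledGrad (l ε : ℝ) (w : ℝ × ℝ → ℝ) : Fin 2 → ℝ × ℝ → ℝ :=
  ![pd (rect l 1) 0 w, fun x => 1 / ε * pd (rect l 1) 1 w x]

/-- The scaled Hessian `∇²_ε w` on `S`. -/
def scaledHessian (l ε : ℝ) (w : ℝ × ℝ → ℝ) (x : ℝ × ℝ) : Matrix (Fin 2) (Fin 2) ℝ :=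
  let H := hessian (rect l 1) w x
  !![H 0 0, 1 / ε * H 0 1; 1 / ε * H 1 0, 1 / ε ^ 2 * H 1 1]

/-! ### Admissible functions -/

/-- `f ∈ W^{1,2}_g(I)`: `f ∈ W^{1,2}(I)` with the boundary values of `g`. -/
def MemW12Bdry (l : ℝ) (g f : ℝ → ℝ) : Prop :=
  MemW12 (interval l) f ∧ ZeroTrace (interval l) (endpoints l) (fun t => f t - g t)

/-- `f ∈ W^{2,2}_g(I)`: `f ∈ W^{2,2}(I)` with the boundary values of `g`, up to first order. -/
def MemW22Bdry (l : ℝ) (g f : ℝ → ℝ) : Prop :=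
  MemW22 (interval l) f ∧ ZeroTrace (interval l) (endpoints l) (fun t => f t - g t) ∧
    ZeroTrace (interval l) (endpoints l) (fun t => D l f t - D l g t)

/-- The two-dimensional admissible set: `u ∈ W^{1,2}(S_ε; ℝ²)`, `v ∈ W^{2,2}(S_ε)` and, on
`∂I × (-ε/2, ε/2)`, `u = (û₁ - (x₂/ε) û₂', û₂/ε)`, `v = v̂`, `∂₁v = v̂'`. -/
def Admissible2D (l ε : ℝ) (uhat₁ uhat₂ vhat : ℝ → ℝ)
    (u : Fin 2 → ℝ × ℝ → ℝ) (v : ℝ × ℝ → ℝ) : Prop :=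
  (∀ i, MemW12 (rect l ε) (u i)) ∧ MemW22 (rect l ε) v ∧
    ZeroTrace (rect l ε) (lateral l ε)
      (fun x => u 0 x - (uhat₁ x.1 - x.2 / ε * D l uhat₂ x.1)) ∧
    ZeroTrace (rect l ε) (lateral l ε) (fun x => u 1 x - 1 / ε * uhat₂ x.1) ∧
    ZeroTrace (rect l ε) (lateral l ε) (fun x => v x - vhat x.1) ∧
    ZeroTrace (rect l ε) (lateral l ε) (fun x => pd (rect l ε) 0 v x - D l vhat x.1)

/-- The Bernoulli–Navier space `BN_{(û₁,û₂)}(S; ℝ²)`. -/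
def BernoulliNavier (l : ℝ) (uhat₁ uhat₂ : ℝ → ℝ) (y : Fin 2 → ℝ × ℝ → ℝ) : Prop :=
  (∀ i, MemW12 (rect l 1) (y i)) ∧
    (∀ᵐ x ∂(volume.restrict (rect l 1)),
      strain (rect l 1) y x 0 1 = 0 ∧ strain (rect l 1) y x 1 1 = 0) ∧
    ZeroTrace (rect l 1) (lateral l 1)
      (fun x => y 0 x - (uhat₁ x.1 - x.2 * D l uhat₂ x.1)) ∧
    ZeroTrace (rect l 1) (lateral l 1) (fun x => y 1 x - uhat₂ x.1)

/-- The one-dimensional admissible set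
`BN_{(û₁,û₂)}(S; ℝ²) × W^{2,2}_{v̂}(I) × W^{1,2}_0(I)`. -/
def Admissible1D (l : ℝ) (uhat₁ uhat₂ vhat : ℝ → ℝ)
    (y : Fin 2 → ℝ × ℝ → ℝ) (w θ : ℝ → ℝ) : Prop :=
  BernoulliNavier l uhat₁ uhat₂ y ∧ MemW22Bdry l vhat w ∧ MemW12Bdry l 0 θ

/-! ### Energies -/

/-- The von Kármán energy `φ_ε(u, v)` with force densities `f` (vertical) and `g` (horizontal). -/
def energy2D (Q : QuadraticForm ℝ (Matrix (Fin 2) (Fin 2) ℝ)) (l ε : ℝ)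
    (f : ℝ × ℝ → ℝ) (g : Fin 2 → ℝ × ℝ → ℝ)
    (u : Fin 2 → ℝ × ℝ → ℝ) (v : ℝ × ℝ → ℝ) : ℝ :=
  let S := rect l ε
  1 / ε * (∫ x in S, 1 / 2 * Q (strain S u x + (1 / 2 : ℝ) • gradTensor S v x))
    + 1 / ε * (∫ x in S, 1 / 24 * Q (hessian S v x))
    - 1 / ε * (∫ x in S, (f x * v x + ∑ i, g i x * u i x))

/-- `Q¹(q₁₁, q₁₂) = min_α Q²(q₁₁, q₁₂, α)`. -/
def reducedQ₁ (Q : QuadraticForm ℝ (Matrix (Fin 2) (Fin 2) ℝ)) (q₁₁ q₁₂ : ℝ) : ℝ :=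
  ⨅ α : ℝ, Q !![q₁₁, q₁₂; q₁₂, α]

/-- `Q⁰(q₁₁) = min_z Q¹(q₁₁, z)`. -/
def reducedQ₀ (Q : QuadraticForm ℝ (Matrix (Fin 2) (Fin 2) ℝ)) (q₁₁ : ℝ) : ℝ :=
  ⨅ z : ℝ, reducedQ₁ Q q₁₁ z

/-- The limiting energy `φ₀(y, w, θ)` with force densities `f`, `g` on `I`; functions on `I` are
regarded as functions on `S` that do not depend on `x₂`. -/
def energy1D (Q : QuadraticForm ℝ (Matrix (Fin 2) (Fin 2) ℝ)) (l : ℝ)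
    (f : ℝ → ℝ) (g : Fin 2 → ℝ → ℝ)
    (y : Fin 2 → ℝ × ℝ → ℝ) (w θ : ℝ → ℝ) : ℝ :=
  1 / 2 * (∫ x in rect l 1, reducedQ₀ Q (pd (rect l 1) 0 (y 0) x + (D l w x.1) ^ 2 / 2))
    + 1 / 24 * (∫ t in interval l, reducedQ₁ Q (D l (D l w) t) (D l θ t))
    - ∫ x in rect l 1, (f x.1 * w x.1 + ∑ i, g i x.1 * y i x)

/-! ### Convergence of displacements to limiting variables -/

/-- Convergence of `(u_ε, v_ε)` along a sequence `ε n → 0` to `(y, w, θ)`, where `conv` is the mode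
of convergence in `L²` (weak or strong). -/
def RibbonConv
    (conv : Set (ℝ × ℝ) → (ℕ → ℝ × ℝ → ℝ) → (ℝ × ℝ → ℝ) → Prop)
    (l : ℝ) (ε : ℕ → ℝ) (u : ℕ → Fin 2 → ℝ × ℝ → ℝ) (v : ℕ → ℝ × ℝ → ℝ)
    (y : Fin 2 → ℝ × ℝ → ℝ) (w θ : ℝ → ℝ) : Prop :=
  let S := rect l 1
  let yε : ℕ → Fin 2 → ℝ × ℝ → ℝ := fun n => scaledU (ε n) (u n)
  let wε : ℕ → ℝ × ℝ → ℝ := fun n => scaledV (ε n) (v n)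
  ConvW22 conv S wε (fun x => w x.1) ∧
  ConvW12 conv S (fun n => scaledGrad l (ε n) (wε n) 0) (fun x => D l w x.1) ∧
  ConvW12 conv S (fun n => scaledGrad l (ε n) (wε n) 1) (fun x => θ x.1) ∧
  (∃ γ : ℝ × ℝ → ℝ, MemL2 S γ ∧ ∀ i j : Fin 2,
    conv S (fun n x => scaledHessian l (ε n) (wε n) x i j)
      (fun x => !![D l (D l w) x.1, D l θ x.1; D l θ x.1, γ x] i j)) ∧
  (∀ i, ConvW12 conv S (fun n => yε n i) (y i)) ∧
  (∃ E : ℝ × ℝ → Matrix (Fin 2) (Fin 2) ℝ,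
    (∀ i j, MemL2 S (fun x => E x i j)) ∧ (∀ x, (E x).IsSymm) ∧
    (∀ᵐ x ∂(volume.restrict S), E x 0 0 = pd S 0 (y 0) x) ∧
    ∀ i j : Fin 2,
      conv S (fun n x => scaledStrain l (ε n) (yε n) x i j) (fun x => E x i j))

/-- Weak convergence `(u_ε, v_ε) → (y, w, θ)` (the convergence `πσ`). -/
def ConvPiSigma (l : ℝ) (ε : ℕ → ℝ) (u : ℕ → Fin 2 → ℝ × ℝ → ℝ) (v : ℕ → ℝ × ℝ → ℝ)
    (y : Fin 2 → ℝ × ℝ → ℝ) (w θ : ℝ → ℝ) : Prop :=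
  RibbonConv WeakL2 l ε u v y w θ

/-- Strong convergence `(u_ε, v_ε) → (y, w, θ)` (the convergence `πρ`). -/
def ConvPiRho (l : ℝ) (ε : ℕ → ℝ) (u : ℕ → Fin 2 → ℝ × ℝ → ℝ) (v : ℕ → ℝ × ℝ → ℝ)
    (y : Fin 2 → ℝ × ℝ → ℝ) (w θ : ℝ → ℝ) : Prop :=
  RibbonConv StrongL2 l ε u v y w θ

end Ribbon

end

open Ribbon

open Filter Topology MeasureTheory Set
open scoped ContDiff ENNReal

set_option linter.unusedSectionVars false

noncomputable section

namespace Ribbon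

/-! ### Weak and strong convergence in L² -/

section L2

variable {E : Type*} [MeasureSpace E] {Ω : Set E}

/-! Convergence of the energy to its lower bound leaves the sequence no energy to spend on
oscillation or concentration. After rescaling to S, the elastic energy is ½∫Q(Aₙ) + (1/24)∫Q(Hₙ),
where Aₙ = E^ε y + ½ ∇_ε w ⊗ ∇_ε w and Hₙ is the scaled Hessian (`energy2D_eq`). Both converge
weakly in L², say to A₀ and H₀. For Hₙ this is assumed. For Aₙ the quadratic term has to pass to the
limit: the scaled gradients converge weakly in W^{1,2}(S), hence strongly in L² (Rellich) and in L⁴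
(Ladyzhenskaya), so their products converge strongly in L².

By Rellich the displacements also converge strongly in L². The force terms are therefore weak-strong
pairings and converge, and the elastic energies tend to the elastic part c of φ₀. Since Q⁰ and Q¹
are infima of Q over the missing entries, and the known entries of A₀ and H₀ are those appearing in
φ₀, c ≤ ½∫Q(A₀) + (1/24)∫Q(H₀).

Expanding the square, ∫Q(Aₙ) − ∫Q(Aₙ − A₀) → ∫Q(A₀), because the cross term is linear in the weakly
null sequence Aₙ − A₀; likewise for Hₙ. Hence ½∫Q(Aₙ − A₀) + (1/24)∫Q(Hₙ − H₀) has a limit that is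
at most 0. The integrands are nonnegative, as the differences are symmetric, so both integrals tend
to 0, and coercivity of Q on symmetric matrices gives Aₙ → A₀ and Hₙ → H₀ strongly
(`strongL2_of_energy`). Subtracting the strongly convergent products makes the scaled strains
strongly convergent too.

It remains to recover all derivatives. Those of w and of ∇_ε w are entries of Hₙ times nonnegative
powers of ε. For y the strains give ∂₁y₁, ∂₂y₂ and the sum ∂₂y₁ + ∂₁y₂, but not the two mixed
derivatives separately; Korn's second inequality on the rectangle, applied to yₙ − y, supplies ∂₂y₁
(`strongL2_pd_scaledU`).

The analytic tools are proved from scratch: mollification adapted to convex domains, Rellich's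
theorem, Ladyzhenskaya's inequality, and Korn's inequality by Nitsche's reflection at a corner. -/

theorem MemL2.integrable_mul {f g : E → ℝ} (hf : MemL2 Ω f) (hg : MemL2 Ω g) :
    IntegrableOn (fun x => f x * g x) Ω :=
  MemLp.integrable_mul hf hg

theorem MemL2.integrable_sq {f : E → ℝ} (hf : MemL2 Ω f) :
    IntegrableOn (fun x => f x ^ 2) Ω :=
  MemLp.integrable_sq hf

theorem MemL2.add {f g : E → ℝ} (hf : MemL2 Ω f) (hg : MemL2 Ω g) :
    MemL2 Ω (fun x => f x + g x) := MemLp.add hf hg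

theorem MemL2.sub {f g : E → ℝ} (hf : MemL2 Ω f) (hg : MemL2 Ω g) :
    MemL2 Ω (fun x => f x - g x) := MemLp.sub hf hg

theorem MemL2.const_mul {f : E → ℝ} (hf : MemL2 Ω f) (c : ℝ) :
    MemL2 Ω (fun x => c * f x) := MemLp.const_mul hf c

theorem MemL2.congr {f g : E → ℝ} (hf : MemL2 Ω f) (h : f =ᵐ[volume.restrict Ω] g) :
    MemL2 Ω g := (memLp_congr_ae h).1 hf

theorem MemL2.eLpNorm_eq {f : E → ℝ} (hf : MemL2 Ω f) :
    eLpNorm f 2 (volume.restrict Ω) = ENNReal.ofReal (√(∫ x in Ω, f x ^ 2)) := by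
  have := MemLp.eLpNorm_eq_integral_rpow_norm (μ := volume.restrict Ω) (p := 2) (f := f)
    (by norm_num) (by norm_num) hf
  rw [this, Real.sqrt_eq_rpow]
  norm_num

theorem integral_sq_nonneg (f : E → ℝ) : 0 ≤ ∫ x in Ω, f x ^ 2 :=
  integral_nonneg fun _ => sq_nonneg _

/-- Replaces extended-valued norms by real integrals of squares, the form in which all later
estimates are carried out. -/
theorem tendsto_eLpNorm_iff {F : ℕ → E → ℝ} (hF : ∀ n, MemL2 Ω (F n)) :
    Tendsto (fun n => eLpNorm (F n) 2 (volume.restrict Ω)) atTop (𝓝 0) ↔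
      Tendsto (fun n => ∫ x in Ω, F n x ^ 2) atTop (𝓝 0) := by
  simp_rw [fun n => (hF n).eLpNorm_eq]
  constructor
  · intro h
    have h1 : Tendsto (fun n => √(∫ x in Ω, F n x ^ 2)) atTop (𝓝 0) := by
      have := (ENNReal.tendsto_toReal ENNReal.zero_ne_top).comp h
      simpa [Function.comp_def, ENNReal.toReal_ofReal (Real.sqrt_nonneg _)] using this
    have h2 := h1.pow 2
    simpa [Real.sq_sqrt (integral_sq_nonneg _)] using h2
  · intro h
    have h1 := (Real.continuous_sqrt.tendsto 0).comp h
    have h2 := (ENNReal.continuous_ofReal.tendsto (√0)).comp h1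
    simpa [Function.comp_def] using h2

theorem strongL2_iff {F : ℕ → E → ℝ} {G : E → ℝ} :
    StrongL2 Ω F G ↔ (∀ n, MemL2 Ω (F n)) ∧ MemL2 Ω G ∧
      Tendsto (fun n => ∫ x in Ω, (F n x - G x) ^ 2) atTop (𝓝 0) := by
  unfold StrongL2
  constructor
  · rintro ⟨h1, h2, h3⟩
    exact ⟨h1, h2, (tendsto_eLpNorm_iff fun n => (h1 n).sub h2).1 h3⟩
  · rintro ⟨h1, h2, h3⟩
    exact ⟨h1, h2, (tendsto_eLpNorm_iff fun n => (h1 n).sub h2).2 h3⟩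

/-- Cauchy–Schwarz: the quadratic polynomial t ↦ ∫(t f + g)² is nonnegative, so its discriminant is
not positive. -/
theorem sq_integral_mul_le {f g : E → ℝ} (hf : MemL2 Ω f) (hg : MemL2 Ω g) :
    (∫ x in Ω, f x * g x) ^ 2 ≤ (∫ x in Ω, f x ^ 2) * ∫ x in Ω, g x ^ 2 := by
  have key : ∀ t : ℝ, 0 ≤ (∫ x in Ω, f x ^ 2) * (t * t) + (2 * ∫ x in Ω, f x * g x) * t
      + ∫ x in Ω, g x ^ 2 := by
    intro t
    have h : ∫ x in Ω, (t * f x + g x) ^ 2 = (∫ x in Ω, f x ^ 2) * (t * t)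
        + (2 * ∫ x in Ω, f x * g x) * t + ∫ x in Ω, g x ^ 2 := by
      have e : (fun x => (t * f x + g x) ^ 2)
          = fun x => (t * t) * f x ^ 2 + (2 * t) * (f x * g x) + g x ^ 2 := by
        funext x; ring
      rw [e, integral_add, integral_add, integral_const_mul, integral_const_mul]
      · ring
      · exact hf.integrable_sq.const_mul _
      · exact (hf.integrable_mul hg).const_mul _
      · exact (hf.integrable_sq.const_mul _).add ((hf.integrable_mul hg).const_mul _)
      · exact hg.integrable_sq
    rw [← h]
    exact integral_nonneg fun x => sq_nonneg _
  have := discrim_le_zero key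
  unfold discrim at this
  nlinarith

theorem abs_integral_mul_le {f g : E → ℝ} (hf : MemL2 Ω f) (hg : MemL2 Ω g) :
    |∫ x in Ω, f x * g x| ≤ √(∫ x in Ω, f x ^ 2) * √(∫ x in Ω, g x ^ 2) := by
  rw [← Real.sqrt_mul (integral_sq_nonneg _)]
  exact Real.abs_le_sqrt (sq_integral_mul_le hf hg)

theorem integral_add_sq_le {f g : E → ℝ} (hf : MemL2 Ω f) (hg : MemL2 Ω g) :
    ∫ x in Ω, (f x + g x) ^ 2 ≤ 2 * (∫ x in Ω, f x ^ 2) + 2 * ∫ x in Ω, g x ^ 2 := by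
  rw [← integral_const_mul, ← integral_const_mul, ← integral_add
    (hf.integrable_sq.const_mul _) (hg.integrable_sq.const_mul _)]
  refine integral_mono (hf.add hg).integrable_sq
    ((hf.integrable_sq.const_mul _).add (hg.integrable_sq.const_mul _)) fun x => ?_
  show (f x + g x) ^ 2 ≤ 2 * f x ^ 2 + 2 * g x ^ 2
  nlinarith [sq_nonneg (f x - g x)]

theorem integral_sub_sq_le {f g h : E → ℝ} (hf : MemL2 Ω f) (hg : MemL2 Ω g) (hh : MemL2 Ω h) :
    ∫ x in Ω, (f x - h x) ^ 2
      ≤ 2 * (∫ x in Ω, (f x - g x) ^ 2) + 2 * ∫ x in Ω, (g x - h x) ^ 2 := by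
  simpa using integral_add_sq_le (hf.sub hg) (hg.sub hh)

theorem tendsto_of_nonneg_le {a b : ℕ → ℝ} (h0 : ∀ n, 0 ≤ a n) (hab : ∀ n, a n ≤ b n)
    (hb : Tendsto b atTop (𝓝 0)) : Tendsto a atTop (𝓝 0) :=
  squeeze_zero h0 hab hb

theorem StrongL2.congr {F F' : ℕ → E → ℝ} {G G' : E → ℝ} (h : StrongL2 Ω F G)
    (hF : ∀ n, F n =ᵐ[volume.restrict Ω] F' n) (hG : G =ᵐ[volume.restrict Ω] G') :
    StrongL2 Ω F' G' := by
  refine ⟨fun n => (h.1 n).congr (hF n), h.2.1.congr hG, ?_⟩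
  refine h.2.2.congr fun n => eLpNorm_congr_ae ?_
  filter_upwards [hF n, hG] with x h1 h2
  rw [h1, h2]

theorem WeakL2.congr {F F' : ℕ → E → ℝ} {G G' : E → ℝ} (h : WeakL2 Ω F G)
    (hF : ∀ n, F n =ᵐ[volume.restrict Ω] F' n) (hG : G =ᵐ[volume.restrict Ω] G') :
    WeakL2 Ω F' G' := by
  refine ⟨fun n => (h.1 n).congr (hF n), h.2.1.congr hG, fun ψ hψ => ?_⟩
  have e : ∫ x in Ω, G x * ψ x = ∫ x in Ω, G' x * ψ x :=
    integral_congr_ae (by filter_upwards [hG] with x h1; rw [h1])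
  rw [← e]
  refine (h.2.2 ψ hψ).congr fun n => integral_congr_ae ?_
  filter_upwards [hF n] with x h1
  rw [h1]

theorem StrongL2.add {F F' : ℕ → E → ℝ} {G G' : E → ℝ} (h : StrongL2 Ω F G)
    (h' : StrongL2 Ω F' G') :
    StrongL2 Ω (fun n x => F n x + F' n x) (fun x => G x + G' x) := by
  rw [strongL2_iff] at *
  refine ⟨fun n => (h.1 n).add (h'.1 n), h.2.1.add h'.2.1, ?_⟩
  have := (h.2.2.const_mul 2).add (h'.2.2.const_mul 2)
  simp only [mul_zero, add_zero] at this
  refine tendsto_of_nonneg_le (fun n => integral_sq_nonneg _) (fun n => ?_) this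
  have := integral_add_sq_le ((h.1 n).sub h.2.1) ((h'.1 n).sub h'.2.1)
  refine le_trans (le_of_eq ?_) this
  congr 1; funext x; ring

theorem StrongL2.const_mul {F : ℕ → E → ℝ} {G : E → ℝ} (h : StrongL2 Ω F G) {c : ℕ → ℝ} {c₀ : ℝ}
    (hc : Tendsto c atTop (𝓝 c₀)) :
    StrongL2 Ω (fun n x => c n * F n x) (fun x => c₀ * G x) := by
  rw [strongL2_iff] at *
  refine ⟨fun n => (h.1 n).const_mul _, h.2.1.const_mul _, ?_⟩
  have hc2 : Tendsto (fun n => (c n - c₀) ^ 2) atTop (𝓝 0) := by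
    simpa using (hc.sub_const c₀).pow 2
  have := (((hc.pow 2).mul h.2.2).const_mul 2).add
    ((hc2.mul_const (∫ x in Ω, G x ^ 2)).const_mul 2)
  simp only [mul_zero, add_zero, zero_mul] at this
  refine tendsto_of_nonneg_le (fun n => integral_sq_nonneg _) (fun n => ?_) this
  have := integral_add_sq_le (((h.1 n).sub h.2.1).const_mul (c n)) (h.2.1.const_mul (c n - c₀))
  simp only [mul_pow, integral_const_mul] at this
  refine le_trans (le_of_eq ?_) this
  congr 1; funext x; ring

theorem StrongL2.sub {F F' : ℕ → E → ℝ} {G G' : E → ℝ} (h : StrongL2 Ω F G)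
    (h' : StrongL2 Ω F' G') :
    StrongL2 Ω (fun n x => F n x - F' n x) (fun x => G x - G' x) := by
  have := h.add (h'.const_mul (tendsto_const_nhds (x := (-1 : ℝ))))
  simpa [sub_eq_add_neg] using this

theorem StrongL2.const {G : E → ℝ} (h : MemL2 Ω G) : StrongL2 Ω (fun _ => G) G := by
  rw [strongL2_iff]
  exact ⟨fun _ => h, h, by simp⟩

/-- Uniform boundedness principle: the functionals represented by the `F n` are bounded at each ψ
because their values there converge. -/
theorem WeakL2.bounded {F : ℕ → E → ℝ} {G : E → ℝ} (h : WeakL2 Ω F G) :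
    ∃ C, 0 ≤ C ∧ ∀ n, ∫ x in Ω, F n x ^ 2 ≤ C := by
  have hm : ∀ n, MemLp (F n) 2 (volume.restrict Ω) := h.1
  have hin : ∀ (n : ℕ) (ψ : Lp ℝ 2 (volume.restrict Ω)),
      inner ℝ (MemLp.toLp (F n) (hm n)) ψ = ∫ x in Ω, F n x * ψ x := by
    intro n ψ
    rw [L2.inner_def]
    refine integral_congr_ae ?_
    filter_upwards [MemLp.coeFn_toLp (hm n)] with x hx
    rw [hx]
    simp [mul_comm]
  obtain ⟨C, hC⟩ := banach_steinhaus
    (g := fun n => innerSL ℝ (MemLp.toLp (F n) (hm n))) (fun ψ => by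
      have ht := h.2.2 ψ (Lp.memLp ψ)
      obtain ⟨C, hC⟩ := ht.norm.bddAbove_range
      refine ⟨C, fun n => ?_⟩
      rw [innerSL_apply_apply, hin]
      exact hC ⟨n, rfl⟩)
  refine ⟨C ^ 2, sq_nonneg _, fun n => ?_⟩
  have h1 := hC n
  rw [innerSL_apply_norm, Lp.norm_toLp, (h.1 n).eLpNorm_eq,
    ENNReal.toReal_ofReal (Real.sqrt_nonneg _)] at h1
  rw [← Real.sq_sqrt (integral_sq_nonneg (F n))]
  exact pow_le_pow_left₀ (Real.sqrt_nonneg _) h1 2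

/-- The error ∫ Fₙ(Hₙ − K) is at most ‖Fₙ‖ ‖Hₙ − K‖, and the first factor stays bounded. -/
theorem WeakL2.tendsto_integral_mul {F H : ℕ → E → ℝ} {G K : E → ℝ} (h : WeakL2 Ω F G)
    (h' : StrongL2 Ω H K) :
    Tendsto (fun n => ∫ x in Ω, F n x * H n x) atTop (𝓝 (∫ x in Ω, G x * K x)) := by
  obtain ⟨C, -, hC⟩ := h.bounded
  rw [strongL2_iff] at h'
  have h1 := h.2.2 K h'.2.1
  have h2 : Tendsto (fun n => ∫ x in Ω, F n x * (H n x - K x)) atTop (𝓝 0) := by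
    have h3 : Tendsto (fun n => √C * √(∫ x in Ω, (H n x - K x) ^ 2)) atTop (𝓝 0) := by
      simpa using ((Real.continuous_sqrt.tendsto 0).comp h'.2.2).const_mul (√C)
    refine squeeze_zero_norm (fun n => ?_) h3
    refine (abs_integral_mul_le (h.1 n) ((h'.1 n).sub h'.2.1)).trans ?_
    exact mul_le_mul_of_nonneg_right (Real.sqrt_le_sqrt (hC n)) (Real.sqrt_nonneg _)
  have h3 := h1.add h2
  rw [add_zero] at h3
  refine h3.congr fun n => ?_
  rw [← integral_add ((h.1 n).integrable_mul h'.2.1)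
    ((h.1 n).integrable_mul ((h'.1 n).sub h'.2.1))]
  congr 1; funext x; ring

theorem StrongL2.weak {F : ℕ → E → ℝ} {G : E → ℝ} (h : StrongL2 Ω F G) : WeakL2 Ω F G := by
  refine ⟨h.1, h.2.1, fun ψ hψ => ?_⟩
  have hc : WeakL2 Ω (fun _ => ψ) ψ := ⟨fun _ => hψ, hψ, fun _ _ => tendsto_const_nhds⟩
  simpa [mul_comm] using hc.tendsto_integral_mul h

theorem WeakL2.add {F F' : ℕ → E → ℝ} {G G' : E → ℝ} (h : WeakL2 Ω F G)
    (h' : WeakL2 Ω F' G') :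
    WeakL2 Ω (fun n x => F n x + F' n x) (fun x => G x + G' x) := by
  refine ⟨fun n => (h.1 n).add (h'.1 n), h.2.1.add h'.2.1, fun ψ hψ => ?_⟩
  have := (h.2.2 ψ hψ).add (h'.2.2 ψ hψ)
  simp only [add_mul]
  rw [integral_add (h.2.1.integrable_mul hψ) (h'.2.1.integrable_mul hψ)]
  refine this.congr fun n => ?_
  rw [integral_add ((h.1 n).integrable_mul hψ) ((h'.1 n).integrable_mul hψ)]

theorem WeakL2.const_mul {F : ℕ → E → ℝ} {G : E → ℝ} (h : WeakL2 Ω F G) (c : ℝ) :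
    WeakL2 Ω (fun n x => c * F n x) (fun x => c * G x) := by
  refine ⟨fun n => (h.1 n).const_mul c, h.2.1.const_mul c, fun ψ hψ => ?_⟩
  simp only [mul_assoc, integral_const_mul]
  exact (h.2.2 ψ hψ).const_mul c

theorem WeakL2.sub_self {F : ℕ → E → ℝ} {G : E → ℝ} (h : WeakL2 Ω F G) :
    WeakL2 Ω (fun n x => F n x - G x) (fun _ => 0) := by
  have := h.add ((StrongL2.const h.2.1).weak.const_mul (-1))
  simpa [sub_eq_add_neg] using this

/-- The difference of the two limits is itself an admissible test function. -/
theorem WeakL2.ae_unique {F : ℕ → E → ℝ} {G G' : E → ℝ} (h : WeakL2 Ω F G)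
    (h' : WeakL2 Ω F G') : G =ᵐ[volume.restrict Ω] G' := by
  have hd := h.2.1.sub h'.2.1
  have e := tendsto_nhds_unique (h.2.2 _ hd) (h'.2.2 _ hd)
  have e2 : ∫ x in Ω, (G x - G' x) ^ 2 = 0 := by
    rw [← sub_eq_zero, ← integral_sub (h.2.1.integrable_mul hd) (h'.2.1.integrable_mul hd)] at e
    rw [← e]
    congr 1; funext x; ring
  rw [integral_eq_zero_iff_of_nonneg (fun x => sq_nonneg _) hd.integrable_sq] at e2
  filter_upwards [e2] with x hx
  exact sub_eq_zero.1 (pow_eq_zero_iff two_ne_zero |>.1 hx)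

/-- A weakly convergent sequence with a strong limit converges strongly to its weak limit. -/
theorem WeakL2.strong_of {F F' : ℕ → E → ℝ} {G G' : E → ℝ} (h : WeakL2 Ω F G)
    (hs : StrongL2 Ω F' G') (hF : ∀ n, F' n =ᵐ[volume.restrict Ω] F n) : StrongL2 Ω F G :=
  hs.congr hF ((hs.congr hF (ae_eq_refl _)).weak.ae_unique h)

theorem StrongL2.of_tendsto {F : ℕ → E → ℝ} {G : E → ℝ} (hF : ∀ n, MemL2 Ω (F n))
    (hG : MemL2 Ω G) (h : Tendsto (fun n => ∫ x in Ω, (F n x - G x) ^ 2) atTop (𝓝 0)) :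
    StrongL2 Ω F G := strongL2_iff.2 ⟨hF, hG, h⟩

end L2

/-! ### Calculus of weak derivatives -/

section WeakDerivative

variable {E : Type*} [NormedAddCommGroup E] [NormedSpace ℝ E] [MeasureSpace E] {Ω : Set E}

theorem weakDeriv_spec {e : E} {f g : E → ℝ} (h : HasWeakDeriv Ω e f g) :
    HasWeakDeriv Ω e f (weakDeriv Ω e f) := by
  have hex : ∃ g, HasWeakDeriv Ω e f g := ⟨g, h⟩
  unfold weakDeriv
  rw [dif_pos hex]
  exact hex.choose_spec

variable [FiniteDimensional ℝ E] [BorelSpace E]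

theorem _root_.MeasureTheory.LocallyIntegrableOn.integrableOn_mul {k φ : E → ℝ}
    (hk : LocallyIntegrableOn k Ω) (hφ : Continuous φ) (hc : HasCompactSupport φ)
    (ht : tsupport φ ⊆ Ω) : IntegrableOn (fun x => k x * φ x) Ω := by
  have h1 : IntegrableOn (fun x => φ x * k x) (tsupport φ) :=
    (hk.integrableOn_compact_subset ht hc).continuousOn_mul hφ.continuousOn hc
  have h2 : IntegrableOn (fun x => φ x * k x) Ω :=
    ((integrableOn_iff_integrable_of_support_subset (fun x hx => by
      by_contra hn
      exact hx (by simp [image_eq_zero_of_notMem_tsupport hn]))).1 h1).integrableOn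
  simpa [mul_comm] using h2

theorem tsupport_fderiv_apply_subset' {φ : E → ℝ} (e : E) (ht : tsupport φ ⊆ Ω) :
    tsupport (fun x => fderiv ℝ φ x e) ⊆ Ω :=
  (tsupport_fderiv_apply_subset ℝ e).trans ht

theorem _root_.MeasureTheory.LocallyIntegrableOn.integrableOn_mul_fderiv {k φ : E → ℝ}
    (hk : LocallyIntegrableOn k Ω) (hφ : ContDiff ℝ ∞ φ) (hc : HasCompactSupport φ)
    (ht : tsupport φ ⊆ Ω) (e : E) : IntegrableOn (fun x => k x * fderiv ℝ φ x e) Ω :=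
  hk.integrableOn_mul ((hφ.continuous_fderiv (by simp)).clm_apply continuous_const)
    (hc.fderiv_apply ℝ e) (tsupport_fderiv_apply_subset' e ht)

/-- Fundamental lemma of the calculus of variations, applied to g − g'. -/
theorem HasWeakDeriv.ae_unique (hΩ : IsOpen Ω) {e : E} {f g g' : E → ℝ}
    (h : HasWeakDeriv Ω e f g) (h' : HasWeakDeriv Ω e f g') :
    g =ᵐ[volume.restrict Ω] g' := by
  have key := hΩ.ae_eq_zero_of_integral_contDiff_smul_eq_zero (μ := volume)
    (f := fun x => g x - g' x) (h.2.1.sub h'.2.1) (fun φ hφ hc ht => by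
      have hz : ∀ x, x ∉ Ω → φ x = 0 := fun x hx => image_eq_zero_of_notMem_tsupport (fun h => hx (ht h))
      have e1 := h.2.2 φ hφ hc ht
      have e2 := h'.2.2 φ hφ hc ht
      have e3 : ∫ x in Ω, (g x * φ x - g' x * φ x) = 0 := by
        rw [integral_sub (h.2.1.integrableOn_mul hφ.continuous hc ht)
          (h'.2.1.integrableOn_mul hφ.continuous hc ht)]
        linarith
      rw [← setIntegral_eq_integral_of_forall_compl_eq_zero (s := Ω)
        (fun x hx => by simp [hz x hx]), ← e3]
      congr 1; funext x; simp only [smul_eq_mul]; ring)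
  rw [Filter.EventuallyEq, ae_restrict_iff' hΩ.measurableSet]
  filter_upwards [key] with x hx hm
  exact sub_eq_zero.1 (hx hm)

theorem HasWeakDeriv.add {e : E} {f f' g g' : E → ℝ}
    (h : HasWeakDeriv Ω e f g) (h' : HasWeakDeriv Ω e f' g') :
    HasWeakDeriv Ω e (fun x => f x + f' x) (fun x => g x + g' x) := by
  refine ⟨h.1.add h'.1, h.2.1.add h'.2.1, fun φ hφ hc ht => ?_⟩
  simp only [add_mul]
  rw [integral_add (h.1.integrableOn_mul_fderiv hφ hc ht e)
    (h'.1.integrableOn_mul_fderiv hφ hc ht e),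
    integral_add (h.2.1.integrableOn_mul hφ.continuous hc ht)
      (h'.2.1.integrableOn_mul hφ.continuous hc ht), h.2.2 φ hφ hc ht, h'.2.2 φ hφ hc ht]
  ring

theorem HasWeakDeriv.const_mul {e : E} {f g : E → ℝ} (h : HasWeakDeriv Ω e f g) (c : ℝ) :
    HasWeakDeriv Ω e (fun x => c * f x) (fun x => c * g x) := by
  refine ⟨h.1.smul c, h.2.1.smul c, fun φ hφ hc ht => ?_⟩
  simp only [mul_assoc, integral_const_mul]
  rw [h.2.2 φ hφ hc ht]
  ring

theorem HasWeakDeriv.smul_dir {e : E} {f g : E → ℝ} (h : HasWeakDeriv Ω e f g) (c : ℝ) :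
    HasWeakDeriv Ω (c • e) f (fun x => c * g x) := by
  refine ⟨h.1, h.2.1.smul c, fun φ hφ hc ht => ?_⟩
  simp only [map_smul, smul_eq_mul, mul_left_comm _ c, mul_assoc, integral_const_mul]
  rw [h.2.2 φ hφ hc ht]
  ring

theorem HasWeakDeriv.add_dir {e e' : E} {f g g' : E → ℝ}
    (h : HasWeakDeriv Ω e f g) (h' : HasWeakDeriv Ω e' f g') :
    HasWeakDeriv Ω (e + e') f (fun x => g x + g' x) := by
  refine ⟨h.1, h.2.1.add h'.2.1, fun φ hφ hc ht => ?_⟩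
  simp only [map_add, mul_add, add_mul]
  rw [integral_add (h.1.integrableOn_mul_fderiv hφ hc ht e)
    (h.1.integrableOn_mul_fderiv hφ hc ht e'),
    integral_add (h.2.1.integrableOn_mul hφ.continuous hc ht)
      (h'.2.1.integrableOn_mul hφ.continuous hc ht), h.2.2 φ hφ hc ht, h'.2.2 φ hφ hc ht]
  ring

theorem HasWeakDeriv.congr {e : E} {f f' g g' : E → ℝ}
    (h : HasWeakDeriv Ω e f g) (hf : f =ᵐ[volume.restrict Ω] f')
    (hg : g =ᵐ[volume.restrict Ω] g') (hf' : LocallyIntegrableOn f' Ω)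
    (hg' : LocallyIntegrableOn g' Ω) :
    HasWeakDeriv Ω e f' g' := by
  refine ⟨hf', hg', fun φ hφ hc ht => ?_⟩
  have e1 : ∫ x in Ω, f x * fderiv ℝ φ x e = ∫ x in Ω, f' x * fderiv ℝ φ x e :=
    integral_congr_ae (by filter_upwards [hf] with x hx; rw [hx])
  have e2 : ∫ x in Ω, g x * φ x = ∫ x in Ω, g' x * φ x :=
    integral_congr_ae (by filter_upwards [hg] with x hx; rw [hx])
  rw [← e1, ← e2]
  exact h.2.2 φ hφ hc ht

theorem MemW12.hasWeakDeriv {f : E → ℝ} (h : MemW12 Ω f) (e : E) :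
    HasWeakDeriv Ω e f (weakDeriv Ω e f) := by
  obtain ⟨g, -, hg⟩ := h.2 e
  exact weakDeriv_spec hg

/-- `weakDeriv` is an arbitrary choice, so square integrability has to be carried over from the
given witness by uniqueness. -/
theorem MemW12.memL2_weakDeriv (hΩ : IsOpen Ω) {f : E → ℝ} (h : MemW12 Ω f) (e : E) :
    MemL2 Ω (weakDeriv Ω e f) := by
  obtain ⟨g, hg, hg'⟩ := h.2 e
  exact hg.congr (hg'.ae_unique hΩ (weakDeriv_spec hg'))

theorem HasWeakDeriv.ae_eq_weakDeriv (hΩ : IsOpen Ω) {e : E} {f g : E → ℝ}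
    (h : HasWeakDeriv Ω e f g) : g =ᵐ[volume.restrict Ω] weakDeriv Ω e f :=
  h.ae_unique hΩ (weakDeriv_spec h)

theorem MemL2.locallyIntegrableOn (hΩ : volume Ω ≠ ⊤) {f : E → ℝ} (h : MemL2 Ω f) :
    LocallyIntegrableOn f Ω := by
  have : IsFiniteMeasure (volume.restrict Ω) := ⟨by simpa using hΩ.lt_top⟩
  have : IntegrableOn f Ω := MemLp.integrable (by norm_num) h
  exact this.locallyIntegrableOn

theorem weakDeriv_sub_ae (hΩ : IsOpen Ω) {e : E} {f f' : E → ℝ}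
    (h : MemW12 Ω f) (h' : MemW12 Ω f') :
    weakDeriv Ω e (fun x => f x - f' x)
      =ᵐ[volume.restrict Ω] fun x => weakDeriv Ω e f x - weakDeriv Ω e f' x := by
  have := (h.hasWeakDeriv e).add ((h'.hasWeakDeriv e).const_mul (-1))
  simp only [neg_mul, one_mul, ← sub_eq_add_neg] at this
  exact (this.ae_eq_weakDeriv hΩ).symm

theorem MemW12.sub (hΩ : IsOpen Ω) {f f' : E → ℝ} (h : MemW12 Ω f) (h' : MemW12 Ω f') :
    MemW12 Ω (fun x => f x - f' x) := by
  refine ⟨h.1.sub h'.1, fun e => ⟨fun x => weakDeriv Ω e f x - weakDeriv Ω e f' x,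
    (h.memL2_weakDeriv hΩ e).sub (h'.memL2_weakDeriv hΩ e), ?_⟩⟩
  have := (h.hasWeakDeriv e).add ((h'.hasWeakDeriv e).const_mul (-1))
  simpa only [neg_mul, one_mul, ← sub_eq_add_neg] using this

/-- Weak derivatives commute. -/
theorem HasWeakDeriv.comm (hΩ : IsOpen Ω) {e e' : E} {f g g' h h' : E → ℝ}
    (hg : HasWeakDeriv Ω e f g) (hg' : HasWeakDeriv Ω e' f g')
    (hh : HasWeakDeriv Ω e' g h) (hh' : HasWeakDeriv Ω e g' h') :
    h =ᵐ[volume.restrict Ω] h' := by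
  refine HasWeakDeriv.ae_unique hΩ hh ⟨hg.2.1, hh'.2.1, fun φ hφ hc ht => ?_⟩
  have hd : ∀ a : E, ContDiff ℝ ∞ fun x => fderiv ℝ φ x a := fun a =>
    (hφ.fderiv_right (m := ∞) (by simp)).clm_apply contDiff_const
  have hsymm : ∀ x, fderiv ℝ (fun x => fderiv ℝ φ x e') x e
      = fderiv ℝ (fun x => fderiv ℝ φ x e) x e' := by
    intro x
    have hdiff : DifferentiableAt ℝ (fderiv ℝ φ) x :=
      ((hφ.fderiv_right (m := ∞) (by simp)).differentiable (by simp)) x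
    have hs : IsSymmSndFDerivAt ℝ φ x :=
      (hφ.contDiffAt).isSymmSndFDerivAt (by
        rw [minSmoothness_of_isRCLikeNormedField]
        exact WithTop.coe_le_coe.2 (le_top (a := (2 : ℕ∞))))
    rw [fderiv_clm_apply hdiff (differentiableAt_const _),
      fderiv_clm_apply hdiff (differentiableAt_const _)]
    simpa using hs.eq e e'
  have e1 := hg.2.2 _ (hd e') (hc.fderiv_apply ℝ e') (tsupport_fderiv_apply_subset' e' ht)
  have e2 := hg'.2.2 _ (hd e) (hc.fderiv_apply ℝ e) (tsupport_fderiv_apply_subset' e ht)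
  have e3 := hh'.2.2 φ hφ hc ht
  have e4 : ∫ x in Ω, f x * fderiv ℝ (fun x => fderiv ℝ φ x e') x e
      = ∫ x in Ω, f x * fderiv ℝ (fun x => fderiv ℝ φ x e) x e' := by simp_rw [hsymm]
  linarith

end WeakDerivative

/-! ### Mollification on convex domains containing the origin -/

section Mollification

variable {E : Type*} [NormedAddCommGroup E] [NormedSpace ℝ E] [FiniteDimensional ℝ E]
  [MeasureSpace E] [BorelSpace E] [(volume : Measure E).IsAddHaarMeasure]

/-- Mollification adapted to a star-shaped set `Ω`: the argument is first contracted by `1 - δ`. -/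
def mollify (ρ : ContDiffBump (0 : E)) (δ : ℝ) (Ω : Set E) (f : E → ℝ) (x : E) : ℝ :=
  ∫ z in Ω, ρ.normed volume ((1 - δ) • x - z) * f z

variable {ρ : ContDiffBump (0 : E)} {δ r : ℝ} {Ω : Set E}

/-- A point z of the ball is the convex combination (1 − δ)x + δz' with z' = δ⁻¹(z − (1 − δ)x) of
norm at most r. The contraction therefore makes room for a kernel of radius δr, even for x near the
boundary. -/
theorem closedBall_subset_of_convex (hΩ : Convex ℝ Ω) (hr : Metric.closedBall 0 r ⊆ Ω)
    (hδ : 0 < δ) (hδ1 : δ < 1) {x : E} (hx : x ∈ Ω) :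
    Metric.closedBall ((1 - δ) • x) (δ * r) ⊆ Ω := by
  intro z hz
  have h1 : δ⁻¹ • (z - (1 - δ) • x) ∈ Ω := by
    apply hr
    rw [mem_closedBall_zero_iff, norm_smul, norm_inv, Real.norm_of_nonneg hδ.le,
      inv_mul_le_iff₀ hδ]
    simpa [dist_eq_norm] using hz
  have := hΩ hx h1 (by linarith : 0 ≤ 1 - δ) hδ.le (by ring)
  rwa [smul_smul, mul_inv_cancel₀ hδ.ne', one_smul, add_sub_cancel] at this

theorem mollify_eq_convolution (hΩ : MeasurableSet Ω) (f : E → ℝ) (x : E) :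
    mollify ρ δ Ω f x = convolution (Ω.indicator f) (ρ.normed volume)
      (ContinuousLinearMap.mul ℝ ℝ) volume ((1 - δ) • x) := by
  rw [convolution_def, mollify, ← integral_indicator hΩ]
  congr 1; funext z
  by_cases h : z ∈ Ω <;> simp [h, mul_comm]

theorem contDiff_normed_infty : ContDiff ℝ ∞ (ρ.normed (volume : Measure E)) :=
  ρ.contDiff_normed (n := ⊤)

theorem contDiff_mollify (hΩ : MeasurableSet Ω) {f : E → ℝ} (hf : IntegrableOn f Ω) :
    ContDiff ℝ ∞ (mollify ρ δ Ω f) := by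
  have h := ρ.hasCompactSupport_normed.contDiff_convolution_right (n := ⊤) (μ := volume)
    (ContinuousLinearMap.mul ℝ ℝ)
    ((integrable_indicator_iff hΩ).2 hf).locallyIntegrable contDiff_normed_infty
  have h2 : mollify ρ δ Ω f = (convolution (Ω.indicator f) (ρ.normed volume)
      (ContinuousLinearMap.mul ℝ ℝ) volume) ∘ fun x => (1 - δ) • x := by
    funext x; exact mollify_eq_convolution hΩ f x
  rw [h2]
  exact h.comp (contDiff_const_smul _)

/-- For x in Ω the kernel z ↦ ρ((1 − δ)x − z) has compact support inside Ω, so it may be used as a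
test function for the weak derivative. The factor 1 − δ comes from the chain rule for the
contraction. -/
theorem fderiv_mollify (hΩm : MeasurableSet Ω) (hΩ : Convex ℝ Ω)
    (hr : Metric.closedBall 0 r ⊆ Ω) (hδ : 0 < δ) (hδ1 : δ < 1) (hρ : ρ.rOut ≤ δ * r)
    {f g : E → ℝ} (hf : IntegrableOn f Ω) {e : E} (h : HasWeakDeriv Ω e f g) {x : E}
    (hx : x ∈ Ω) :
    fderiv ℝ (mollify ρ δ Ω f) x e = (1 - δ) * mollify ρ δ Ω g x := by
  set w := (1 - δ) • x with hw
  have h1 := ρ.hasCompactSupport_normed.hasFDerivAt_convolution_right (μ := volume)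
    (ContinuousLinearMap.mul ℝ ℝ)
    ((integrable_indicator_iff hΩm).2 hf).locallyIntegrable
    (ρ.contDiff_normed (μ := volume) (n := 1)) w
  have h2 : mollify ρ δ Ω f = (convolution (Ω.indicator f) (ρ.normed volume)
      (ContinuousLinearMap.mul ℝ ℝ) volume) ∘ fun x => (1 - δ) • x := by
    funext x; exact mollify_eq_convolution hΩm f x
  have hs : HasFDerivAt (fun x : E => (1 - δ) • x)
      ((1 - δ) • ContinuousLinearMap.id ℝ E) x := (hasFDerivAt_id x).const_smul (1 - δ)
  have h3 := h1.comp x hs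
  rw [h2]
  refine (DFunLike.congr_fun h3.fderiv e).trans ?_
  simp only [ContinuousLinearMap.comp_apply, smul_apply,
    ContinuousLinearMap.id_apply, map_smul, smul_eq_mul]
  congr 1
  rw [convolution_precompR_apply _ ((integrable_indicator_iff hΩm).2 hf).locallyIntegrable
    (ρ.hasCompactSupport_normed.fderiv ℝ)
    ((ρ.contDiff_normed (n := 1)).continuous_fderiv (by simp))]
  rw [convolution_def]
  have hφ : ContDiff ℝ ∞ fun z => ρ.normed volume (w - z) :=
    contDiff_normed_infty.comp (contDiff_const.sub contDiff_id)
  have hsupp : tsupport (fun z => ρ.normed volume (w - z)) ⊆ Metric.closedBall w ρ.rOut := by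
    refine closure_minimal (fun z hz => ?_) Metric.isClosed_closedBall
    have : w - z ∈ Function.support (ρ.normed volume) := hz
    rw [ρ.support_normed_eq, mem_ball_zero_iff] at this
    rw [Metric.mem_closedBall, dist_comm, dist_eq_norm]
    exact this.le
  have h4 := h.2.2 _ hφ
    (HasCompactSupport.of_support_subset_isCompact (isCompact_closedBall w ρ.rOut)
      (subset_closure.trans hsupp))
    (hsupp.trans ((Metric.closedBall_subset_closedBall hρ).trans
      (closedBall_subset_of_convex hΩ hr hδ hδ1 hx)))
  have h5 : ∀ z, fderiv ℝ (fun z => ρ.normed volume (w - z)) z e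
      = - fderiv ℝ (ρ.normed volume) (w - z) e := by
    intro z
    have := (((contDiff_normed_infty (ρ := ρ)).differentiable (by simp)) (w - z)).hasFDerivAt.comp z
      ((hasFDerivAt_id z).const_sub w)
    have h6 := this.fderiv
    simp only [Function.comp_def] at h6
    rw [h6]
    simp
  simp only [h5, mul_neg, integral_neg, neg_inj] at h4
  rw [mollify]
  simp only [mul_comm (ρ.normed volume _)]
  rw [← hw, ← h4, ← integral_indicator hΩm]
  congr 1; funext z
  by_cases h : z ∈ Ω <;> simp [h]

theorem integrable_normed_sub (w : E) : Integrable fun z => ρ.normed volume (w - z) :=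
  ρ.integrable_normed.comp_sub_left w

theorem integral_normed_sub (w : E) : ∫ z, ρ.normed volume (w - z) = 1 := by
  rw [integral_sub_left_eq_self (fun z => ρ.normed volume z) volume w]
  exact ρ.integral_normed

theorem setIntegral_normed_sub_le (w : E) : ∫ z in Ω, ρ.normed volume (w - z) ≤ 1 := by
  rw [← integral_normed_sub (ρ := ρ) w]
  exact setIntegral_le_integral (integrable_normed_sub w)
    (Eventually.of_forall fun z => ρ.nonneg_normed _)

theorem setIntegral_normed_sub_eq {w : E} (h : Metric.closedBall w ρ.rOut ⊆ Ω) :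
    ∫ z in Ω, ρ.normed volume (w - z) = 1 := by
  rw [setIntegral_eq_integral_of_forall_compl_eq_zero, integral_normed_sub]
  intro z hz
  by_contra hne
  have : w - z ∈ Function.support (ρ.normed volume) := hne
  rw [ρ.support_normed_eq, mem_ball_zero_iff] at this
  refine hz (h ?_)
  rw [Metric.mem_closedBall, dist_comm, dist_eq_norm]
  exact this.le

theorem exists_bound_normed (ρ : ContDiffBump (0 : E)) : ∃ C, ∀ z : E, ‖ρ.normed volume z‖ ≤ C :=
  ρ.continuous_normed.bounded_above_of_compact_support ρ.hasCompactSupport_normed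

theorem integrableOn_normed_mul {f : E → ℝ} (hf : IntegrableOn f Ω) (w : E) :
    IntegrableOn (fun z => ρ.normed volume (w - z) * f z) Ω := by
  obtain ⟨C, hC⟩ := exists_bound_normed ρ
  exact Integrable.bdd_mul hf
    (ρ.continuous_normed.comp (continuous_const.sub continuous_id)).aestronglyMeasurable
    (Eventually.of_forall fun z => hC _)

/-- Jensen's inequality for the averaging kernel. -/
theorem sq_setIntegral_normed_mul_le {f : E → ℝ} (hf : MemL2 Ω f) (w : E) :
    (∫ z in Ω, ρ.normed volume (w - z) * f z) ^ 2
      ≤ ∫ z in Ω, ρ.normed volume (w - z) * f z ^ 2 := by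
  have hc : Continuous fun z => √(ρ.normed volume (w - z)) :=
    Real.continuous_sqrt.comp (ρ.continuous_normed.comp (continuous_const.sub continuous_id))
  have hs : ∀ z, √(ρ.normed volume (w - z)) ^ 2 = ρ.normed volume (w - z) :=
    fun z => Real.sq_sqrt (ρ.nonneg_normed _)
  have h1 : MemL2 Ω fun z => √(ρ.normed volume (w - z)) := by
    refine (memLp_two_iff_integrable_sq hc.aestronglyMeasurable).2 ?_
    exact ((integrable_normed_sub w).integrableOn).congr
      (Eventually.of_forall fun z => (hs z).symm)
  have h2 : MemL2 Ω fun z => √(ρ.normed volume (w - z)) * f z := by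
    have hi : IntegrableOn (fun z => (√(ρ.normed volume (w - z)) * f z) ^ 2) Ω := by
      simp only [mul_pow, hs]
      exact integrableOn_normed_mul hf.integrable_sq w
    exact (memLp_two_iff_integrable_sq (hc.aestronglyMeasurable.mul hf.1)).2 hi
  have h3 := sq_integral_mul_le h1 h2
  simp only [mul_pow, hs] at h3
  have e : ∀ z, √(ρ.normed volume (w - z)) * (√(ρ.normed volume (w - z)) * f z)
      = ρ.normed volume (w - z) * f z := fun z => by rw [← mul_assoc, ← sq, hs]
  simp only [e] at h3
  refine h3.trans (mul_le_of_le_one_left ?_ (setIntegral_normed_sub_le w))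
  exact integral_nonneg fun z => mul_nonneg (ρ.nonneg_normed _) (sq_nonneg _)

/-- Jensen's inequality followed by Fubini. Integrating the kernel in x instead of z costs the
Jacobian of the contraction, the inverse of (1 − δ)^d. -/
theorem mollify_bound (hv : volume Ω ≠ ⊤) (hδ1 : δ < 1) {f : E → ℝ}
    (hf : MemL2 Ω f) (hm : MeasurableSet Ω) :
    MemL2 Ω (mollify ρ δ Ω f) ∧ ∫ x in Ω, mollify ρ δ Ω f x ^ 2
      ≤ ((1 - δ) ^ Module.finrank ℝ E)⁻¹ * ∫ x in Ω, f x ^ 2 := by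
  have : IsFiniteMeasure (volume.restrict Ω) := ⟨by simpa using hv.lt_top⟩
  have hfi : IntegrableOn f Ω := MemLp.integrable (by norm_num) hf
  obtain ⟨C, hC⟩ := exists_bound_normed ρ
  have hkc : Continuous fun p : E × E => ρ.normed volume ((1 - δ) • p.1 - p.2) :=
    ρ.continuous_normed.comp ((continuous_fst.const_smul _).sub continuous_snd)
  have hprod : Integrable (fun p : E × E => ρ.normed volume ((1 - δ) • p.1 - p.2) * f p.2 ^ 2)
      ((volume.restrict Ω).prod (volume.restrict Ω)) :=
    Integrable.bdd_mul (hf.integrable_sq.comp_snd _) hkc.aestronglyMeasurable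
      (Eventually.of_forall fun p => hC _)
  have hint := hprod.integral_prod_left
  have hle : ∀ x, mollify ρ δ Ω f x ^ 2 ≤ ∫ z in Ω, ρ.normed volume ((1 - δ) • x - z) * f z ^ 2 :=
    fun x => sq_setIntegral_normed_mul_le hf _
  have hcm : Continuous (mollify ρ δ Ω f) := (contDiff_mollify hm hfi).continuous
  have hI : IntegrableOn (fun x => mollify ρ δ Ω f x ^ 2) Ω :=
    hint.mono' (hcm.pow 2).aestronglyMeasurable (Eventually.of_forall fun x => by
      rw [Real.norm_of_nonneg (sq_nonneg _)]; exact hle x)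
  refine ⟨(memLp_two_iff_integrable_sq hcm.aestronglyMeasurable).2 hI, ?_⟩
  refine (integral_mono hI hint hle).trans ?_
  rw [integral_integral_swap hprod, ← integral_const_mul]
  refine integral_mono hprod.integral_prod_right (hf.integrable_sq.const_mul _) fun z => ?_
  show ∫ x in Ω, ρ.normed volume ((1 - δ) • x - z) * f z ^ 2 ≤ _
  rw [integral_mul_const]
  refine mul_le_mul_of_nonneg_right ?_ (sq_nonneg _)
  have hpos : 0 < 1 - δ := by linarith
  have hi : Integrable fun x => ρ.normed volume ((1 - δ) • x - z) :=
    (ρ.integrable_normed.comp_sub_right z).comp_smul hpos.ne'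
  refine (setIntegral_le_integral hi (Eventually.of_forall fun x => ρ.nonneg_normed _)).trans
    (le_of_eq ?_)
  rw [Measure.integral_comp_smul volume (fun x => ρ.normed volume (x - z)),
    integral_sub_right_eq_self (fun x => ρ.normed volume x), ρ.integral_normed,
    abs_of_pos (by positivity)]
  simp

theorem mollify_sub {f g : E → ℝ} (hf : IntegrableOn f Ω) (hg : IntegrableOn g Ω) (x : E) :
    mollify ρ δ Ω (fun z => f z - g z) x = mollify ρ δ Ω f x - mollify ρ δ Ω g x := by
  simp only [mollify, mul_sub]
  exact integral_sub (integrableOn_normed_mul hf _) (integrableOn_normed_mul hg _)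

theorem inv_one_sub_pow_le (hδ2 : δ ≤ 1 / 2) (d : ℕ) : ((1 - δ) ^ d)⁻¹ ≤ 2 ^ d := by
  rw [← inv_pow]
  refine pow_le_pow_left₀ (inv_nonneg.2 (by linarith)) ?_ d
  rw [inv_le_comm₀ (by linarith) (by norm_num)]
  linarith

theorem mollify_bound' (hv : volume Ω ≠ ⊤) (hδ2 : δ ≤ 1 / 2) {f : E → ℝ}
    (hf : MemL2 Ω f) (hm : MeasurableSet Ω) :
    ∫ x in Ω, mollify ρ δ Ω f x ^ 2 ≤ 2 ^ Module.finrank ℝ E * ∫ x in Ω, f x ^ 2 :=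
  (mollify_bound hv (by linarith) hf hm).2.trans
    (mul_le_mul_of_nonneg_right (inv_one_sub_pow_le hδ2 _) (integral_sq_nonneg _))

theorem norm_sub_le_of_mem_closedBall {M : ℝ} (hM : ∀ x ∈ Ω, ‖x‖ ≤ M) (hδ : 0 < δ) {x z : E}
    (hx : x ∈ Ω) (hz : ‖(1 - δ) • x - z‖ ≤ δ * r) : ‖x - z‖ ≤ δ * (M + r) := by
  have : x - z = δ • x + ((1 - δ) • x - z) := by module
  rw [this]
  refine (norm_add_le _ _).trans ?_
  rw [norm_smul, Real.norm_of_nonneg hδ.le, mul_add]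
  gcongr
  exact hM x hx

theorem abs_mollify_sub_le (hΩ : Convex ℝ Ω)
    (hr : Metric.closedBall 0 r ⊆ Ω) (hδ : 0 < δ) (hδ1 : δ < 1) (hρ : ρ.rOut ≤ δ * r)
    {M : ℝ} (hM : ∀ x ∈ Ω, ‖x‖ ≤ M) {g : E → ℝ} (hg : IntegrableOn g Ω) {η : ℝ}
    (hη : ∀ x z : E, ‖x - z‖ ≤ δ * (M + r) → |g x - g z| ≤ η) {x : E} (hx : x ∈ Ω) :
    |mollify ρ δ Ω g x - g x| ≤ η := by
  set w := (1 - δ) • x with hw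
  have h1 : ∫ z in Ω, ρ.normed volume (w - z) = 1 := setIntegral_normed_sub_eq
    ((Metric.closedBall_subset_closedBall hρ).trans
      (closedBall_subset_of_convex hΩ hr hδ hδ1 hx))
  have hi : IntegrableOn (fun z => ρ.normed volume (w - z)) Ω :=
    (integrable_normed_sub w).integrableOn
  have h2 : mollify ρ δ Ω g x - g x = ∫ z in Ω, ρ.normed volume (w - z) * (g z - g x) := by
    simp only [mul_sub]
    rw [integral_sub (integrableOn_normed_mul hg w) (hi.mul_const _), integral_mul_const, h1,
      one_mul, mollify]
  rw [h2, ← Real.norm_eq_abs]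
  have h3 : ∫ z in Ω, ρ.normed volume (w - z) * η = η := by rw [integral_mul_const, h1, one_mul]
  rw [← h3]
  refine norm_integral_le_of_norm_le (hi.mul_const η) (Eventually.of_forall fun z => ?_)
  rw [norm_mul, Real.norm_of_nonneg (ρ.nonneg_normed _)]
  by_cases hz : ρ.normed volume (w - z) = 0
  · simp [hz]
  · have : w - z ∈ Function.support (ρ.normed volume) := hz
    rw [ρ.support_normed_eq, mem_ball_zero_iff] at this
    refine mul_le_mul_of_nonneg_left ?_ (ρ.nonneg_normed _)
    rw [norm_sub_rev]
    exact hη x z (norm_sub_le_of_mem_closedBall hM hδ hx (this.le.trans hρ))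

/-- Mollification is bounded on L² uniformly for δ ≤ 1/2, so it suffices to treat a continuous,
compactly supported approximation g of f. For g the error is uniformly small by uniform continuity.
-/
theorem strongL2_mollify (hΩ : Convex ℝ Ω) (hm : MeasurableSet Ω)
    (hr : Metric.closedBall 0 r ⊆ Ω) {M : ℝ} (hM : ∀ x ∈ Ω, ‖x‖ ≤ M)
    (hv : volume Ω ≠ ⊤) {δ : ℕ → ℝ} (hδ : ∀ n, 0 < δ n) (hδ2 : ∀ n, δ n ≤ 1 / 2)
    (hδ0 : Tendsto δ atTop (𝓝 0))
    {ρ : ℕ → ContDiffBump (0 : E)} (hρ : ∀ n, (ρ n).rOut ≤ δ n * r)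
    {f : E → ℝ} (hf : MemL2 Ω f) :
    StrongL2 Ω (fun n => mollify (ρ n) (δ n) Ω f) f := by
  have hfin : IsFiniteMeasure (volume.restrict Ω) := ⟨by simpa using hv.lt_top⟩
  have hmem : ∀ n {f : E → ℝ}, MemL2 Ω f → MemL2 Ω (mollify (ρ n) (δ n) Ω f) := fun n f hf =>
    (mollify_bound hv (by linarith [hδ2 n]) hf hm).1
  have hint : ∀ {f : E → ℝ}, MemL2 Ω f → IntegrableOn f Ω := fun {f} hf =>
    MemLp.integrable (by norm_num) hf
  refine StrongL2.of_tendsto (fun n => hmem n hf) hf ?_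
  set K : ℝ := 2 ^ Module.finrank ℝ E with hK
  have hKpos : 0 < K := by positivity
  rw [Metric.tendsto_atTop]
  intro a ha
  set V := (volume.restrict Ω).real univ with hV
  have hV0 : 0 ≤ V := measureReal_nonneg
  -- The two triangle inequalities below bound the error by 2Kb + 4η²V + 4b. The first and last
  -- terms add up to a/4, and the choice of η keeps the middle one at most a/2.
  set b := a / (8 * (K + 2)) with hb
  have hb0 : 0 < b := by positivity
  obtain ⟨g, hgc, hgf, hgcont, hgm⟩ := MemLp.exists_hasCompactSupport_eLpNorm_sub_le
    (μ := volume.restrict Ω) (p := 2) (by norm_num) hf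
    (ε := ENNReal.ofReal √b) (by simpa using Real.sqrt_pos.2 hb0)
  have hgm' : MemL2 Ω g := hgm
  have hfg : ∫ x in Ω, (f x - g x) ^ 2 ≤ b := by
    have := (hf.sub hgm').eLpNorm_eq
    change eLpNorm (fun x => f x - g x) 2 (volume.restrict Ω) ≤ _ at hgf
    rw [this, ENNReal.ofReal_le_ofReal_iff (Real.sqrt_nonneg _), Real.sqrt_le_sqrt_iff hb0.le]
      at hgf
    exact hgf
  have hgf' : ∫ x in Ω, (g x - f x) ^ 2 ≤ b := by
    refine le_trans (le_of_eq ?_) hfg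
    congr 1; funext x; ring
  set η := √(a / (8 * (V + 1))) with hη
  have hη0 : 0 < η := Real.sqrt_pos.2 (by positivity)
  have hη2 : η ^ 2 = a / (8 * (V + 1)) := Real.sq_sqrt (by positivity)
  obtain ⟨τ, hτ, hτ'⟩ := Metric.uniformContinuous_iff.1
    (hgc.uniformContinuous_of_continuous hgcont) η hη0
  have hlim : Tendsto (fun n => δ n * (M + r)) atTop (𝓝 0) := by simpa using hδ0.mul_const (M + r)
  obtain ⟨N, hN⟩ := eventually_atTop.1 (hlim.eventually (gt_mem_nhds hτ))
  refine ⟨N, fun n hn => ?_⟩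
  rw [Real.dist_eq, sub_zero, abs_of_nonneg (integral_sq_nonneg _)]
  have e1 : ∫ x in Ω, (mollify (ρ n) (δ n) Ω f x - mollify (ρ n) (δ n) Ω g x) ^ 2 ≤ K * b := by
    have h := mollify_bound' (ρ := ρ n) hv (hδ2 n) (hf.sub hgm') hm
    simp only [mollify_sub (hint hf) (hint hgm')] at h
    exact h.trans (mul_le_mul_of_nonneg_left hfg hKpos.le)
  have e2 : ∫ x in Ω, (mollify (ρ n) (δ n) Ω g x - g x) ^ 2 ≤ η ^ 2 * V := by
    have hc : ∫ _ in Ω, η ^ 2 = η ^ 2 * V := by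
      rw [integral_const, smul_eq_mul, mul_comm]
    rw [← hc]
    refine setIntegral_mono_on ((hmem n hgm').sub hgm').integrable_sq (integrable_const _) hm
      fun x hx => ?_
    refine sq_le_sq' ?_ ?_ <;>
    have := abs_mollify_sub_le hΩ hr (hδ n) (by linarith [hδ2 n]) (hρ n) hM (hint hgm') (η := η)
      (fun x z hxz => by
        have := hτ' (a := x) (b := z) (by rw [dist_eq_norm]; exact hxz.trans_lt (hN n hn))
        rw [Real.dist_eq] at this
        exact this.le) hx
    · exact (abs_le.1 this).1
    · exact (abs_le.1 this).2
  have e3 := integral_sub_sq_le (hmem n hf) (hmem n hgm') hf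
  have e4 := integral_sub_sq_le (hmem n hgm') hgm' hf
  have e5 : η ^ 2 * V ≤ a / 8 := by
    rw [hη2, div_mul_eq_mul_div, div_le_div_iff₀ (by positivity) (by norm_num)]
    nlinarith
  have e6 : b * (8 * (K + 2)) = a := by rw [hb]; field_simp
  nlinarith

end Mollification

/-! ### Mollification error controlled by the gradient -/

section Rellich

variable {E : Type*} [NormedAddCommGroup E] [NormedSpace ℝ E] [FiniteDimensional ℝ E]
  [MeasureSpace E] [BorelSpace E] [(volume : Measure E).IsAddHaarMeasure]

/-- Bounded open convex sets containing the origin. -/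
structure IsStarDomain (Ω : Set E) : Prop where
  convex : Convex ℝ Ω
  isOpen : IsOpen Ω
  zero_mem : (0 : E) ∈ Ω
  bounded : Bornology.IsBounded Ω

variable {Ω : Set E}

theorem IsStarDomain.volume_ne_top (h : IsStarDomain Ω) : volume Ω ≠ ⊤ :=
  h.bounded.measure_lt_top.ne

theorem IsStarDomain.exists_radius (h : IsStarDomain Ω) :
    ∃ r > 0, Metric.closedBall (0 : E) r ⊆ Ω :=
  Metric.nhds_basis_closedBall.mem_iff.1 (h.isOpen.mem_nhds h.zero_mem)

theorem IsStarDomain.exists_bound (h : IsStarDomain Ω) : ∃ M, ∀ x ∈ Ω, ‖x‖ ≤ M :=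
  h.bounded.exists_norm_le

theorem IsStarDomain.memL2_of_continuous (h : IsStarDomain Ω) {f : E → ℝ} (hf : Continuous f) :
    MemL2 Ω f := by
  have : IsFiniteMeasure (volume.restrict Ω) := ⟨by simpa using h.volume_ne_top.lt_top⟩
  obtain ⟨C, hC⟩ := (h.bounded.isCompact_closure.image hf).isBounded.exists_norm_le
  refine MemLp.of_bound hf.aestronglyMeasurable C ?_
  filter_upwards [ae_restrict_mem h.isOpen.measurableSet] with x hx
  exact hC _ ⟨x, subset_closure hx, rfl⟩

/-- The bump function with outer radius `s`. -/
def bumpOfRadius (s : ℝ) (hs : 0 < s) : ContDiffBump (0 : E) :=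
  ⟨s / 2, s, by linarith, by linarith⟩

/-- Functions in `W^{1,2}` are approximated by functions that are smooth up to the boundary. -/
theorem IsStarDomain.exists_smooth_approx (h : IsStarDomain Ω) {f : E → ℝ} (hf : MemW12 Ω f) :
    ∃ φ : ℕ → E → ℝ, (∀ k, ContDiff ℝ ∞ (φ k)) ∧ StrongL2 Ω φ f ∧
      ∀ e, StrongL2 Ω (fun k x => fderiv ℝ (φ k) x e) (weakDeriv Ω e f) := by
  have : IsFiniteMeasure (volume.restrict Ω) := ⟨by simpa using h.volume_ne_top.lt_top⟩
  obtain ⟨r, hr, hrΩ⟩ := h.exists_radius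
  obtain ⟨M, hM⟩ := h.exists_bound
  let δ : ℕ → ℝ := fun n => 1 / ((n : ℝ) + 2)
  have hδ : ∀ n, 0 < δ n := fun n => by positivity
  have hδ2 : ∀ n, δ n ≤ 1 / 2 := fun n =>
    one_div_le_one_div_of_le (by norm_num) (by linarith [(Nat.cast_nonneg n : (0 : ℝ) ≤ n)])
  have hδ0 : Tendsto δ atTop (𝓝 0) :=
    (tendsto_const_nhds).div_atTop (tendsto_atTop_add_const_right _ _ tendsto_natCast_atTop_atTop)
  let ρ : ℕ → ContDiffBump (0 : E) := fun n => bumpOfRadius (δ n * r) (mul_pos (hδ n) hr)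
  have hρ : ∀ n, (ρ n).rOut ≤ δ n * r := fun n => le_rfl
  have hfi : IntegrableOn f Ω := MemLp.integrable (by norm_num) hf.1
  have hS : ∀ {g : E → ℝ}, MemL2 Ω g → StrongL2 Ω (fun n => mollify (ρ n) (δ n) Ω g) g :=
    fun hg => strongL2_mollify h.convex h.isOpen.measurableSet hrΩ hM h.volume_ne_top hδ hδ2 hδ0
      hρ hg
  refine ⟨fun n => mollify (ρ n) (δ n) Ω f, fun n => contDiff_mollify h.isOpen.measurableSet hfi,
    hS hf.1, fun e => ?_⟩
  have h1 := (hS (hf.memL2_weakDeriv h.isOpen e)).const_mul (c := fun n => 1 - δ n) (c₀ := 1)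
    (by simpa using hδ0.const_sub 1)
  refine h1.congr (fun n => ?_) (by simp)
  filter_upwards [ae_restrict_mem h.isOpen.measurableSet] with x hx
  exact (fderiv_mollify h.isOpen.measurableSet h.convex hrΩ (hδ n) (by linarith [hδ2 n]) (hρ n)
    hfi (hf.hasWeakDeriv e) hx).symm

/-- Fundamental theorem of calculus along the segment from z to x, then Cauchy–Schwarz in the
parameter t. `G` stands for a pointwise bound of the squared operator norm of the derivative. -/
theorem sq_sub_le_lintegral {f G : E → ℝ} (hf : ContDiff ℝ ∞ f) (hG : Continuous G)
    (hG0 : ∀ x, 0 ≤ G x) (hfG : ∀ x v, (fderiv ℝ f x v) ^ 2 ≤ G x * ‖v‖ ^ 2) {D : ℝ} (x z : E) (hD : ‖x - z‖ ≤ D) :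
    ENNReal.ofReal ((f z - f x) ^ 2)
      ≤ ENNReal.ofReal (D ^ 2) * ∫⁻ t in Ioc (0 : ℝ) 1, ENNReal.ofReal (G (z + t • (x - z))) := by
  have hcl : Continuous fun t : ℝ => z + t • (x - z) := by fun_prop
  have hd : ∀ t : ℝ, HasDerivAt (fun t : ℝ => f (z + t • (x - z)))
      (fderiv ℝ f (z + t • (x - z)) (x - z)) t := by
    intro t
    have h1 : HasDerivAt (fun t : ℝ => z + t • (x - z)) ((1 : ℝ) • (x - z)) t :=
      ((hasDerivAt_id t).smul_const (x - z)).const_add z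
    rw [one_smul] at h1
    exact ((hf.differentiable (by simp)) _).hasFDerivAt.comp_hasDerivAt t h1
  have hdc : Continuous fun t : ℝ => fderiv ℝ f (z + t • (x - z)) (x - z) :=
    ((hf.continuous_fderiv (by simp)).comp hcl).clm_apply continuous_const
  have hftc := intervalIntegral.integral_eq_sub_of_hasDerivAt (a := 0) (b := 1)
    (fun t _ => hd t) (hdc.intervalIntegrable _ _)
  rw [intervalIntegral.integral_of_le zero_le_one] at hftc
  simp only [one_smul, zero_smul, add_zero, add_sub_cancel] at hftc
  have hmem : ∀ {k : ℝ → ℝ}, Continuous k → MemL2 (Ioc (0 : ℝ) 1) k := by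
    intro k hk
    refine (memLp_two_iff_integrable_sq hk.aestronglyMeasurable).2 ?_
    exact ((hk.pow 2).integrableOn_Icc).mono_set Ioc_subset_Icc_self
  have hcs := sq_integral_mul_le (hmem hdc) (hmem (continuous_const (y := (1 : ℝ))))
  simp only [mul_one, one_pow, integral_const, smul_eq_mul, hftc] at hcs
  have hvol : (volume.restrict (Ioc (0 : ℝ) 1)).real univ = 1 := by simp
  rw [hvol, mul_one] at hcs
  have hGc : Continuous fun t : ℝ => G (z + t • (x - z)) := hG.comp hcl
  have hle : (f z - f x) ^ 2 ≤ ∫ t in Ioc (0 : ℝ) 1, D ^ 2 * G (z + t • (x - z)) := by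
    rw [← neg_sub, neg_sq]
    refine hcs.trans (integral_mono (hmem hdc).integrable_sq
      (((hGc.const_mul _).integrableOn_Icc).mono_set Ioc_subset_Icc_self) fun t => ?_)
    refine (hfG _ _).trans ?_
    show G (z + t • (x - z)) * ‖x - z‖ ^ 2 ≤ D ^ 2 * G (z + t • (x - z))
    rw [mul_comm]
    exact mul_le_mul_of_nonneg_right (pow_le_pow_left₀ (norm_nonneg _) hD 2) (hG0 _)
  refine (ENNReal.ofReal_le_ofReal hle).trans (le_of_eq ?_)
  rw [integral_const_mul, ENNReal.ofReal_mul (sq_nonneg D), ofReal_integral_eq_lintegral_ofReal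
    (hGc.integrableOn_Icc.mono_set Ioc_subset_Icc_self) (Eventually.of_forall fun t => hG0 _)]

/-- Change of variables; the Jacobian c^(−d) is at most 2^d because c ≥ 1/2. -/
theorem lintegral_comp_affine_le {F : E → ℝ≥0∞} (hF : Measurable F) (hΩ : MeasurableSet Ω)
    {c : ℝ} (hc : 1 / 2 ≤ c) (b : E) (hmap : ∀ x ∈ Ω, c • x + b ∈ Ω) :
    ∫⁻ x in Ω, F (c • x + b) ≤ 2 ^ Module.finrank ℝ E * ∫⁻ x in Ω, F x := by
  have hc0 : 0 < c := by linarith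
  calc ∫⁻ x in Ω, F (c • x + b) = ∫⁻ x in Ω, Ω.indicator F (c • x + b) :=
        setLIntegral_congr_fun hΩ fun x hx => by rw [indicator_of_mem (hmap x hx)]
    _ ≤ ∫⁻ x, Ω.indicator F (c • x + b) := setLIntegral_le_lintegral _ _
    _ = ∫⁻ y, Ω.indicator F (y + b) ∂(Measure.map (c • ·) volume) := by
        exact (lintegral_map (f := fun y => Ω.indicator F (y + b))
          ((hF.indicator hΩ).comp (measurable_add_const b)) (measurable_const_smul c)).symm
    _ = ENNReal.ofReal |(c ^ Module.finrank ℝ E)⁻¹| * ∫⁻ y, Ω.indicator F (y + b) := by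
        rw [Measure.map_addHaar_smul volume hc0.ne', lintegral_smul_measure, smul_eq_mul]
    _ = ENNReal.ofReal |(c ^ Module.finrank ℝ E)⁻¹| * ∫⁻ x in Ω, F x := by
        rw [lintegral_add_right_eq_self (fun y => Ω.indicator F y) b, lintegral_indicator hΩ]
    _ ≤ 2 ^ Module.finrank ℝ E * ∫⁻ x in Ω, F x := by
        gcongr
        rw [abs_of_pos (by positivity)]
        have : (c ^ Module.finrank ℝ E)⁻¹ ≤ 2 ^ Module.finrank ℝ E := by
          rw [← inv_pow]
          refine pow_le_pow_left₀ (inv_nonneg.2 hc0.le) ?_ _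
          rw [inv_le_comm₀ hc0 (by norm_num)]
          linarith
        refine (ENNReal.ofReal_le_ofReal this).trans (le_of_eq ?_)
        rw [ENNReal.ofReal_pow (by norm_num)]
        norm_num

theorem sq_sub_mollify_le (h : IsStarDomain Ω) {ρ : ContDiffBump (0 : E)} {δ r : ℝ}
    (hr : Metric.closedBall 0 r ⊆ Ω)
    (hδ : 0 < δ) (hδ2 : δ ≤ 1 / 2) (hρ : ρ.rOut ≤ δ * r) {f : E → ℝ} (hf : Continuous f)
    {x : E} (hx : x ∈ Ω) :
    ENNReal.ofReal ((f x - mollify ρ δ Ω f x) ^ 2)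
      ≤ ∫⁻ z, ENNReal.ofReal (ρ.normed volume ((1 - δ) • x - z)) *
        ENNReal.ofReal ((f z - f x) ^ 2) := by
  have hfin : IsFiniteMeasure (volume.restrict Ω) := ⟨by simpa using h.volume_ne_top.lt_top⟩
  set w := (1 - δ) • x with hw
  have hfm := h.memL2_of_continuous hf
  have hfx := h.memL2_of_continuous (hf.sub (continuous_const (y := f x)))
  have h1 : ∫ z in Ω, ρ.normed volume (w - z) = 1 := setIntegral_normed_sub_eq
    ((Metric.closedBall_subset_closedBall hρ).trans
      (closedBall_subset_of_convex h.convex hr hδ (by linarith) hx))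
  have hi : IntegrableOn (fun z => ρ.normed volume (w - z)) Ω :=
    (integrable_normed_sub w).integrableOn
  have h2 : mollify ρ δ Ω f x - f x = ∫ z in Ω, ρ.normed volume (w - z) * (f z - f x) := by
    simp only [mul_sub]
    rw [integral_sub (integrableOn_normed_mul (MemLp.integrable (by norm_num) hfm) w)
      (hi.mul_const _), integral_mul_const, h1, one_mul, mollify]
  rw [← neg_sub, neg_sq, h2]
  refine (ENNReal.ofReal_le_ofReal (sq_setIntegral_normed_mul_le hfx w)).trans ?_
  rw [ofReal_integral_eq_lintegral_ofReal (integrableOn_normed_mul hfx.integrable_sq w)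
    (Eventually.of_forall fun z => mul_nonneg (ρ.nonneg_normed _) (sq_nonneg _))]
  refine (setLIntegral_le_lintegral _ _).trans (le_of_eq ?_)
  congr 1; funext z
  rw [ENNReal.ofReal_mul (ρ.nonneg_normed _)]
  rfl

/-- The difference f(x) − (mollified f)(x) averages f(x) − f(z) over points z at distance at most
δ(M + r). Bound each difference by the gradient along the segment, substitute s = (1 − δ)x − z, and
integrate in x first. For fixed s and t the point on the segment depends on x through an affine map
of Ω into itself with ratio at least 1/2. -/
theorem lintegral_sq_sub_mollify_le (h : IsStarDomain Ω) {ρ : ContDiffBump (0 : E)} {δ r : ℝ}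
    (hr : Metric.closedBall 0 r ⊆ Ω) {M : ℝ} (hM : ∀ x ∈ Ω, ‖x‖ ≤ M)
    (hδ : 0 < δ) (hδ2 : δ ≤ 1 / 2) (hρ : ρ.rOut ≤ δ * r) {f G : E → ℝ} (hf : ContDiff ℝ ∞ f)
    (hG : Continuous G) (hG0 : ∀ x, 0 ≤ G x)
    (hfG : ∀ x v, (fderiv ℝ f x v) ^ 2 ≤ G x * ‖v‖ ^ 2) :
    ∫⁻ x in Ω, ENNReal.ofReal ((f x - mollify ρ δ Ω f x) ^ 2)
      ≤ ENNReal.ofReal ((δ * (M + r)) ^ 2) * (2 ^ Module.finrank ℝ E *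
        ∫⁻ x in Ω, ENNReal.ofReal (G x)) := by
  have hm := h.isOpen.measurableSet
  set D := δ * (M + r) with hD
  have hG' : Measurable fun x => ENNReal.ofReal (G x) := hG.measurable.ennreal_ofReal
  have hsupp : ∀ s : E, ρ.normed volume s ≠ 0 → ‖s‖ ≤ δ * r := by
    intro s hs
    have : s ∈ Function.support (ρ.normed volume) := hs
    rw [ρ.support_normed_eq, mem_ball_zero_iff] at this
    exact this.le.trans hρ
  have hKm : Measurable fun s : E => ENNReal.ofReal (ρ.normed volume s) :=
    ρ.continuous_normed.measurable.ennreal_ofReal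
  -- The argument of `G` is z + t(x − z) rewritten with z = (1 − δ)x − s.
  let H : E → E → ℝ≥0∞ := fun x s =>
    ∫⁻ t in Ioc (0 : ℝ) 1, ENNReal.ofReal (G (((1 - δ) + t * δ) • x + -((1 - t) • s)))
  have hHc : Measurable fun p : (E × E) × ℝ =>
      ENNReal.ofReal (G (((1 - δ) + p.2 * δ) • p.1.1 + -((1 - p.2) • p.1.2))) := by
    refine (hG.comp ?_).measurable.ennreal_ofReal
    fun_prop
  have hHm : Measurable fun p : E × E => H p.1 p.2 := hHc.lintegral_prod_right'
  have step1 : ∀ x ∈ Ω, ENNReal.ofReal ((f x - mollify ρ δ Ω f x) ^ 2)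
      ≤ ∫⁻ s, ENNReal.ofReal (ρ.normed volume s) * (ENNReal.ofReal (D ^ 2) * H x s) := by
    intro x hx
    refine (sq_sub_mollify_le h hr hδ hδ2 hρ hf.continuous hx).trans ?_
    rw [← lintegral_sub_left_eq_self (fun s => ENNReal.ofReal (ρ.normed volume s) *
      (ENNReal.ofReal (D ^ 2) * H x s)) ((1 - δ) • x)]
    refine lintegral_mono fun z => ?_
    by_cases hz : ρ.normed volume ((1 - δ) • x - z) = 0
    · simp [hz]
    refine mul_le_mul_right ?_ _
    refine (sq_sub_le_lintegral hf hG hG0 hfG x z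
      (norm_sub_le_of_mem_closedBall hM hδ hx (hsupp _ hz))).trans (le_of_eq ?_)
    congr 1
    refine lintegral_congr fun t => ?_
    congr 2
    module
  have step2 : ∀ s : E, ENNReal.ofReal (ρ.normed volume s) * ∫⁻ x in Ω, H x s
      ≤ ENNReal.ofReal (ρ.normed volume s) *
        (2 ^ Module.finrank ℝ E * ∫⁻ x in Ω, ENNReal.ofReal (G x)) := by
    intro s
    by_cases hs : ρ.normed volume s = 0
    · simp [hs]
    refine mul_le_mul_right ?_ _
    have hsw : ∫⁻ x in Ω, H x s = ∫⁻ t in Ioc (0 : ℝ) 1, ∫⁻ x in Ω,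
        ENNReal.ofReal (G (((1 - δ) + t * δ) • x + -((1 - t) • s))) := by
      refine lintegral_lintegral_swap (f := fun x t =>
        ENNReal.ofReal (G (((1 - δ) + t * δ) • x + -((1 - t) • s)))) ?_
      exact (hHc.comp ((measurable_fst.prodMk measurable_const).prodMk
        measurable_snd)).aemeasurable
    rw [hsw]
    have hvol : ∫⁻ _ in Ioc (0 : ℝ) 1, (2 ^ Module.finrank ℝ E * ∫⁻ x in Ω, ENNReal.ofReal (G x))
        = 2 ^ Module.finrank ℝ E * ∫⁻ x in Ω, ENNReal.ofReal (G x) := by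
      simp
    rw [← hvol]
    refine setLIntegral_mono' measurableSet_Ioc fun t ht => ?_
    refine lintegral_comp_affine_le hG' hm (by nlinarith [ht.1, ht.2]) _ fun x hx => ?_
    have hz : (1 - δ) • x - s ∈ Ω := by
      apply closedBall_subset_of_convex h.convex hr hδ (by linarith) hx
      rw [Metric.mem_closedBall, dist_eq_norm]
      simpa using hsupp s hs
    -- The affine image of x is the convex combination, with weights 1 − t and t, of the points (1 −
    -- δ)x − s and x of Ω.
    have := h.convex hz hx (by linarith [ht.2] : 0 ≤ 1 - t) ht.1.le (by ring)
    convert this using 1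
    module
  calc ∫⁻ x in Ω, ENNReal.ofReal ((f x - mollify ρ δ Ω f x) ^ 2)
      ≤ ∫⁻ x in Ω, ∫⁻ s, ENNReal.ofReal (ρ.normed volume s) * (ENNReal.ofReal (D ^ 2) * H x s) :=
        setLIntegral_mono' hm step1
    _ = ∫⁻ s, ∫⁻ x in Ω, ENNReal.ofReal (ρ.normed volume s) * (ENNReal.ofReal (D ^ 2) * H x s) := by
        refine lintegral_lintegral_swap ?_
        exact ((hKm.comp measurable_snd).mul (hHm.const_mul _)).aemeasurable
    _ = ∫⁻ s, ENNReal.ofReal (D ^ 2) * (ENNReal.ofReal (ρ.normed volume s) * ∫⁻ x in Ω, H x s) := by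
        refine lintegral_congr fun s => ?_
        have hHs : Measurable fun x => H x s := hHm.comp (measurable_id.prodMk measurable_const)
        rw [lintegral_const_mul _ (hHs.const_mul _), lintegral_const_mul _ hHs]
        ring
    _ ≤ ∫⁻ s, ENNReal.ofReal (D ^ 2) * (ENNReal.ofReal (ρ.normed volume s) *
        (2 ^ Module.finrank ℝ E * ∫⁻ x in Ω, ENNReal.ofReal (G x))) :=
        lintegral_mono fun s => mul_le_mul_right (step2 s) _
    _ = ENNReal.ofReal (D ^ 2) * (2 ^ Module.finrank ℝ E * ∫⁻ x in Ω, ENNReal.ofReal (G x)) := by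
        rw [lintegral_const_mul _ (hKm.mul_const _), lintegral_mul_const _ hKm,
          ← ofReal_integral_eq_lintegral_ofReal ρ.integrable_normed
            (Eventually.of_forall fun s => ρ.nonneg_normed s), ρ.integral_normed]
        simp

theorem StrongL2.tendsto_sq {F : ℕ → E → ℝ} {G : E → ℝ} (h : StrongL2 Ω F G) :
    Tendsto (fun n => ∫ x in Ω, F n x ^ 2) atTop (𝓝 (∫ x in Ω, G x ^ 2)) := by
  simpa only [sq] using h.weak.tendsto_integral_mul h

end Rellich

/-! ### Rellich's theorem in the plane -/

section Plane

variable {Ω : Set (ℝ × ℝ)}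

/-- The factor 2 compares the supremum norm of ℝ × ℝ with the Euclidean one. -/
theorem sq_apply_le (L : ℝ × ℝ →L[ℝ] ℝ) (v : ℝ × ℝ) :
    (L v) ^ 2 ≤ 2 * (L (1, 0) ^ 2 + L (0, 1) ^ 2) * ‖v‖ ^ 2 := by
  have h : L v = v.1 * L (1, 0) + v.2 * L (0, 1) := by
    conv_lhs => rw [show v = v.1 • ((1 : ℝ), (0 : ℝ)) + v.2 • ((0 : ℝ), (1 : ℝ)) by
      ext <;> simp]
    simp only [map_add, map_smul, smul_eq_mul]
  have h1 : v.1 ^ 2 ≤ ‖v‖ ^ 2 := sq_le_sq' (by linarith [abs_le.1 (norm_fst_le v)])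
    (abs_le.1 (norm_fst_le v)).2
  have h2 : v.2 ^ 2 ≤ ‖v‖ ^ 2 := sq_le_sq' (by linarith [abs_le.1 (norm_snd_le v)])
    (abs_le.1 (norm_snd_le v)).2
  rw [h]
  nlinarith [sq_nonneg (v.1 * L (1, 0) - v.2 * L (0, 1)),
    mul_le_mul_of_nonneg_right h1 (sq_nonneg (L (1, 0))),
    mul_le_mul_of_nonneg_right h2 (sq_nonneg (L (0, 1)))]

theorem integral_sq_sub_mollify_le_of_contDiff (h : IsStarDomain Ω)
    {ρ : ContDiffBump (0 : ℝ × ℝ)} {δ r : ℝ}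
    (hr : Metric.closedBall 0 r ⊆ Ω) {M : ℝ} (hM : ∀ x ∈ Ω, ‖x‖ ≤ M)
    (hδ : 0 < δ) (hδ2 : δ ≤ 1 / 2) (hρ : ρ.rOut ≤ δ * r) {f : ℝ × ℝ → ℝ} (hf : ContDiff ℝ ∞ f) :
    ∫ x in Ω, (f x - mollify ρ δ Ω f x) ^ 2 ≤ (δ * (M + r)) ^ 2 * (4 * (2 *
      ((∫ x in Ω, fderiv ℝ f x (1, 0) ^ 2) + ∫ x in Ω, fderiv ℝ f x (0, 1) ^ 2))) := by
  have hfin : IsFiniteMeasure (volume.restrict Ω) := ⟨by simpa using h.volume_ne_top.lt_top⟩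
  have hm := h.isOpen.measurableSet
  have hd : ∀ e : ℝ × ℝ, Continuous fun x => fderiv ℝ f x e := fun e =>
    (hf.continuous_fderiv (by simp)).clm_apply continuous_const
  have hG : Continuous fun x => 2 * (fderiv ℝ f x (1, 0) ^ 2 + fderiv ℝ f x (0, 1) ^ 2) :=
    continuous_const.mul (((hd _).pow 2).add ((hd _).pow 2))
  have hmol : Continuous (mollify ρ δ Ω f) :=
    (contDiff_mollify hm (MemLp.integrable (by norm_num)
      (h.memL2_of_continuous hf.continuous))).continuous
  have h0 := lintegral_sq_sub_mollify_le h hr hM hδ hδ2 hρ hf hG (fun x => by positivity)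
    (fun x v => sq_apply_le _ v)
  have hI0 := (h.memL2_of_continuous (hd (1, 0))).integrable_sq
  have hI1 := (h.memL2_of_continuous (hd (0, 1))).integrable_sq
  have hI : IntegrableOn (fun x => 2 * (fderiv ℝ f x (1, 0) ^ 2 + fderiv ℝ f x (0, 1) ^ 2)) Ω :=
    (hI0.add hI1).const_mul 2
  rw [← ofReal_integral_eq_lintegral_ofReal
      ((h.memL2_of_continuous hf.continuous).sub (h.memL2_of_continuous hmol)).integrable_sq
      (Eventually.of_forall fun x => sq_nonneg _),
    ← ofReal_integral_eq_lintegral_ofReal hI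
      (Eventually.of_forall fun x => by positivity)] at h0
  have h4 : (2 : ℝ≥0∞) ^ Module.finrank ℝ (ℝ × ℝ) = ENNReal.ofReal 4 := by
    rw [Module.finrank_prod, Module.finrank_self]
    norm_num
  rw [h4, ← ENNReal.ofReal_mul (by norm_num), ← ENNReal.ofReal_mul (sq_nonneg _),
    ENNReal.ofReal_le_ofReal_iff (mul_nonneg (sq_nonneg _) (mul_nonneg (by norm_num)
      (integral_nonneg fun x => by positivity)))] at h0
  refine h0.trans (le_of_eq ?_)
  rw [integral_const_mul, ← integral_add hI0 hI1]

/-- Both sides are continuous under W^{1,2} convergence of functions smooth up to the boundary, so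
the smooth case passes to the limit. -/
theorem integral_sq_sub_mollify_le (h : IsStarDomain Ω)
    {ρ : ContDiffBump (0 : ℝ × ℝ)} {δ r : ℝ}
    (hr : Metric.closedBall 0 r ⊆ Ω) {M : ℝ} (hM : ∀ x ∈ Ω, ‖x‖ ≤ M)
    (hδ : 0 < δ) (hδ2 : δ ≤ 1 / 2) (hρ : ρ.rOut ≤ δ * r) {f : ℝ × ℝ → ℝ} (hf : MemW12 Ω f) :
    ∫ x in Ω, (f x - mollify ρ δ Ω f x) ^ 2 ≤ (δ * (M + r)) ^ 2 * (4 * (2 *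
      ((∫ x in Ω, weakDeriv Ω (1, 0) f x ^ 2) + ∫ x in Ω, weakDeriv Ω (0, 1) f x ^ 2))) := by
  have hfin : IsFiniteMeasure (volume.restrict Ω) := ⟨by simpa using h.volume_ne_top.lt_top⟩
  have hm := h.isOpen.measurableSet
  have hi : ∀ {g : ℝ × ℝ → ℝ}, MemL2 Ω g → IntegrableOn g Ω := fun hg =>
    MemLp.integrable (by norm_num) hg
  have hb : ∀ {g : ℝ × ℝ → ℝ}, MemL2 Ω g → MemL2 Ω (mollify ρ δ Ω g) := fun hg =>
    (mollify_bound h.volume_ne_top (by linarith) hg hm).1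
  obtain ⟨φ, hφ, hφf, hφd⟩ := h.exists_smooth_approx hf
  have hmol : StrongL2 Ω (fun k => mollify ρ δ Ω (φ k)) (mollify ρ δ Ω f) := by
    refine StrongL2.of_tendsto (fun k => hb (hφf.1 k)) (hb hf.1) ?_
    have h1 := ((strongL2_iff.1 hφf).2.2).const_mul (2 ^ Module.finrank ℝ (ℝ × ℝ))
    rw [mul_zero] at h1
    refine tendsto_of_nonneg_le (fun n => integral_sq_nonneg _) (fun k => ?_) h1
    have h2 := mollify_bound' (ρ := ρ) h.volume_ne_top hδ2 ((hφf.1 k).sub hf.1) hm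
    simpa only [mollify_sub (hi (hφf.1 k)) (hi hf.1)] using h2
  refine le_of_tendsto_of_tendsto' (hφf.sub hmol).tendsto_sq
    ((((((hφd (1, 0)).tendsto_sq).add (hφd (0, 1)).tendsto_sq).const_mul 2).const_mul 4).const_mul
      ((δ * (M + r)) ^ 2)) fun k => ?_
  exact integral_sq_sub_mollify_le_of_contDiff h hr hM hδ hδ2 hρ (hφ k)

/-- The Rellich theorem: weak convergence in `W^{1,2}` implies strong convergence in `L²`. -/
theorem ConvW12.strongL2 (h : IsStarDomain Ω) {F : ℕ → ℝ × ℝ → ℝ} {G : ℝ × ℝ → ℝ}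
    (hF : ConvW12 WeakL2 Ω F G) : StrongL2 Ω F G := by
  have hfin : IsFiniteMeasure (volume.restrict Ω) := ⟨by simpa using h.volume_ne_top.lt_top⟩
  have hm := h.isOpen.measurableSet
  obtain ⟨hFm, hGm, hw, hd⟩ := hF
  obtain ⟨r, hr, hrΩ⟩ := h.exists_radius
  obtain ⟨M, hM⟩ := h.exists_bound
  have hz : WeakL2 Ω (fun n x => F n x - G x) (fun _ => 0) := hw.sub_self
  have hzW : ∀ n, MemW12 Ω (fun x => F n x - G x) := fun n => (hFm n).sub h.isOpen hGm
  have hdb : ∀ e : ℝ × ℝ, ∃ C, 0 ≤ C ∧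
      ∀ n, ∫ x in Ω, weakDeriv Ω e (fun x => F n x - G x) x ^ 2 ≤ C := fun e =>
    ((hd e).sub_self.congr (fun n => (weakDeriv_sub_ae h.isOpen (hFm n) hGm).symm)
      (ae_eq_refl _)).bounded
  obtain ⟨C0, hC0, hb0⟩ := hdb (1, 0)
  obtain ⟨C1, hC1, hb1⟩ := hdb (0, 1)
  obtain ⟨C, hC, hCb⟩ := hz.bounded
  refine StrongL2.of_tendsto hw.1 hw.2.1 ?_
  -- For a fixed kernel, mollification turns weak into strong convergence: at each x the mollified
  -- value pairs Fₙ − G with a fixed L² function, hence tends to 0, and it is bounded independently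
  -- of x and n.
  have hmol : ∀ (ρ : ContDiffBump (0 : ℝ × ℝ)) (δ : ℝ), Tendsto (fun n =>
      ∫ x in Ω, mollify ρ δ Ω (fun x => F n x - G x) x ^ 2) atTop (𝓝 0) := by
    intro ρ δ
    obtain ⟨K, hK⟩ := exists_bound_normed ρ
    have hlim := tendsto_integral_of_dominated_convergence (μ := volume.restrict Ω)
      (F := fun n x => mollify ρ δ Ω (fun x => F n x - G x) x ^ 2) (f := fun _ => 0)
      (fun _ => K * C)
      (fun n => ((contDiff_mollify hm (MemLp.integrable (by norm_num) (hz.1 n))).continuous.pow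
        2).aestronglyMeasurable) (integrable_const _)
      (fun n => Eventually.of_forall fun x => by
        rw [Real.norm_of_nonneg (sq_nonneg _)]
        refine (sq_setIntegral_normed_mul_le (hz.1 n) _).trans ?_
        calc ∫ z in Ω, ρ.normed volume ((1 - δ) • x - z) * (F n z - G z) ^ 2
            ≤ ∫ z in Ω, K * (F n z - G z) ^ 2 :=
              integral_mono (integrableOn_normed_mul (hz.1 n).integrable_sq _)
                ((hz.1 n).integrable_sq.const_mul K) fun z =>
                mul_le_mul_of_nonneg_right ((le_abs_self _).trans (hK _)) (sq_nonneg _)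
          _ ≤ K * C := by
              rw [integral_const_mul]
              exact mul_le_mul_of_nonneg_left (hCb n) ((norm_nonneg _).trans (hK 0)))
      (Eventually.of_forall fun x => by
        have hk : MemL2 Ω fun z => ρ.normed volume ((1 - δ) • x - z) :=
          h.memL2_of_continuous (ρ.continuous_normed.comp (continuous_const.sub continuous_id))
        have := (hz.2.2 _ hk).pow 2
        simpa [mollify, mul_comm] using this)
    simpa using hlim
  set B := 4 * (2 * (C0 + C1)) with hB
  have hB0 : 0 ≤ B := by positivity
  rw [Metric.tendsto_atTop]
  intro a ha
  have hdz : Tendsto (fun δ : ℝ => 2 * ((δ * (M + r)) ^ 2 * B)) (𝓝[>] 0) (𝓝 0) := by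
    have : Continuous fun δ : ℝ => 2 * ((δ * (M + r)) ^ 2 * B) := by fun_prop
    simpa using (this.tendsto 0).mono_left nhdsWithin_le_nhds
  -- δ is fixed before n: the mollification error is small uniformly in n because the weak
  -- derivatives are bounded in L².
  obtain ⟨δ, ⟨hδa, hδ2⟩, hδ⟩ := (((hdz.eventually (gt_mem_nhds (half_pos ha))).and
    ((eventually_le_nhds (by norm_num : (0 : ℝ) < 1 / 2)).filter_mono nhdsWithin_le_nhds)).and
    self_mem_nhdsWithin).exists
  have hδ0 : 0 < δ := hδ
  let ρ : ContDiffBump (0 : ℝ × ℝ) := bumpOfRadius (δ * r) (mul_pos hδ0 hr)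
  have hl := (hmol ρ δ).const_mul 2
  rw [mul_zero] at hl
  obtain ⟨N, hN⟩ := eventually_atTop.1 (hl.eventually (gt_mem_nhds (half_pos ha)))
  refine ⟨N, fun n hn => ?_⟩
  rw [Real.dist_eq, sub_zero, abs_of_nonneg (integral_sq_nonneg _)]
  have e1 := integral_add_sq_le
    ((hz.1 n).sub (mollify_bound (ρ := ρ) h.volume_ne_top (by linarith : δ < 1) (hz.1 n) hm).1)
    (mollify_bound (ρ := ρ) h.volume_ne_top (by linarith : δ < 1) (hz.1 n) hm).1
  simp only [sub_add_cancel] at e1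
  have e2 := integral_sq_sub_mollify_le h hrΩ hM hδ0 hδ2 (ρ := ρ) le_rfl (hzW n)
  have e3 : (δ * (M + r)) ^ 2 * (4 * (2 *
      ((∫ x in Ω, weakDeriv Ω (1, 0) (fun x => F n x - G x) x ^ 2) +
        ∫ x in Ω, weakDeriv Ω (0, 1) (fun x => F n x - G x) x ^ 2)))
      ≤ (δ * (M + r)) ^ 2 * B := by
    rw [hB]
    gcongr
    · exact hb0 n
    · exact hb1 n
  have := hN n hn
  linarith

end Plane

/-! ### Ladyzhenskaya's inequality and products of weakly convergent sequences -/

section Ladyzhenskaya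

theorem isStarDomain_rect {l h : ℝ} (hl : 0 < l) (hh : 0 < h) : IsStarDomain (rect l h) where
  convex := (convex_Ioo _ _).prod (convex_Ioo _ _)
  isOpen := isOpen_Ioo.prod isOpen_Ioo
  zero_mem := ⟨⟨by simp; linarith, by simp; linarith⟩, ⟨by simp; linarith, by simp; linarith⟩⟩
  bounded := (Metric.isBounded_Ioo _ _).prod (Metric.isBounded_Ioo _ _)

/-- Write g(x)² = g(s)² + ∫ 2 g g' between s and x, enlarge the last integral to the whole interval,
and average over s. -/
theorem sq_le_average_add {g g' : ℝ → ℝ} (hg : ∀ t, HasDerivAt g (g' t) t) (hg' : Continuous g')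
    {a b x : ℝ} (hx : x ∈ Ioo a b) :
    g x ^ 2 ≤ (b - a)⁻¹ * (∫ s in Ioo a b, g s ^ 2) + ∫ s in Ioo a b, 2 * |g s * g' s| := by
  have hab : a < b := hx.1.trans hx.2
  have hgc : Continuous g := continuous_iff_continuousAt.2 fun t => (hg t).continuousAt
  have hi : ∀ {k : ℝ → ℝ}, Continuous k → IntegrableOn k (Ioo a b) := fun hk =>
    (hk.integrableOn_Icc).mono_set Ioo_subset_Icc_self
  have hc2 : Continuous fun s => 2 * |g s * g' s| := by fun_prop
  have hg2 : Continuous fun s => g s ^ 2 := hgc.pow 2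
  have key : ∀ s ∈ Ioo a b, g x ^ 2 ≤ g s ^ 2 + ∫ s in Ioo a b, 2 * |g s * g' s| := by
    intro s hs
    have hftc := intervalIntegral.integral_eq_sub_of_hasDerivAt (a := s) (b := x)
      (f := fun t => g t ^ 2) (f' := fun t => 2 * (g t * g' t))
      (fun t _ => by simpa [mul_assoc] using (hg t).fun_pow 2)
      ((by fun_prop : Continuous fun t => 2 * (g t * g' t)).intervalIntegrable _ _)
    have h1 : g x ^ 2 - g s ^ 2 ≤ ∫ s in Ioo a b, 2 * |g s * g' s| := by
      rw [← hftc]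
      refine (Real.le_norm_self _).trans ((intervalIntegral.norm_integral_le_integral_norm_uIoc).trans ?_)
      have hsub : uIoc s x ⊆ Ioo a b := by
        intro t ht
        rw [mem_uIoc] at ht
        rcases ht with ht | ht
        · exact ⟨hs.1.trans ht.1, ht.2.trans_lt hx.2⟩
        · exact ⟨hx.1.trans ht.1, ht.2.trans_lt hs.2⟩
      have e : (fun t => ‖2 * (g t * g' t)‖) = fun s => 2 * |g s * g' s| := by
        funext t; rw [norm_mul, Real.norm_eq_abs, Real.norm_eq_abs]; norm_num
      rw [e]
      exact setIntegral_mono_set (hi hc2) (Eventually.of_forall fun t => by positivity)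
        hsub.eventuallyLE
    linarith
  have h2 : ∫ _ in Ioo a b, g x ^ 2
      ≤ ∫ s in Ioo a b, (g s ^ 2 + ∫ s in Ioo a b, 2 * |g s * g' s|) :=
    setIntegral_mono_on (hi continuous_const) (hi (hg2.add continuous_const))
      measurableSet_Ioo key
  rw [integral_add (hi hg2) (hi continuous_const), setIntegral_const, setIntegral_const,
    Real.volume_real_Ioo_of_le hab.le, smul_eq_mul, smul_eq_mul] at h2
  have hpos : 0 < b - a := sub_pos.2 hab
  rw [← mul_le_mul_iff_right₀ hpos]
  refine h2.trans (le_of_eq ?_)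
  field_simp

variable {l : ℝ}

/-- f² is bounded by a function of x₂ alone (integrating along x₁) and by a function of x₁ alone.
Hence f⁴ is bounded by their product, whose integral factorizes. -/
theorem integral_pow_four_le_of_contDiff (hl : 0 < l) {f : ℝ × ℝ → ℝ} (hf : ContDiff ℝ ∞ f) :
    ∫ x in rect l 1, f x ^ 4 ≤
      (l⁻¹ * (∫ x in rect l 1, f x ^ 2) + ∫ x in rect l 1, 2 * |f x * fderiv ℝ f x (1, 0)|) *
      ((∫ x in rect l 1, f x ^ 2) + ∫ x in rect l 1, 2 * |f x * fderiv ℝ f x (0, 1)|) := by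
  have hS := isStarDomain_rect hl one_pos
  have hd : ∀ e : ℝ × ℝ, Continuous fun x => fderiv ℝ f x e := fun e =>
    (hf.continuous_fderiv (by simp)).clm_apply continuous_const
  have hfc := hf.continuous
  have hfin : IsFiniteMeasure (volume.restrict (rect l 1)) :=
    ⟨by simpa using hS.volume_ne_top.lt_top⟩
  have hres : (volume.restrict (rect l 1) : Measure (ℝ × ℝ))
      = (volume.restrict (interval l)).prod (volume.restrict (interval 1)) := by
    rw [Measure.prod_restrict]; rfl
  have hi : ∀ {k : ℝ × ℝ → ℝ}, Continuous k → Integrable k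
      ((volume.restrict (interval l)).prod (volume.restrict (interval 1))) := by
    intro k hk
    rw [← hres]
    exact MemLp.integrable (by norm_num) (hS.memL2_of_continuous hk)
  have hc : ∀ e : ℝ × ℝ, Continuous fun x => 2 * |f x * fderiv ℝ f x e| := fun e =>
    continuous_const.mul ((hfc.mul (hd e)).abs)
  have hf2 : Continuous fun x => f x ^ 2 := hfc.pow 2
  let A : ℝ → ℝ := fun x₂ => l⁻¹ * (∫ s in interval l, f (s, x₂) ^ 2)
    + ∫ s in interval l, 2 * |f (s, x₂) * fderiv ℝ f (s, x₂) (1, 0)|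
  let B : ℝ → ℝ := fun x₁ => (∫ s in interval 1, f (x₁, s) ^ 2)
    + ∫ s in interval 1, 2 * |f (x₁, s) * fderiv ℝ f (x₁, s) (0, 1)|
  have hfd : Differentiable ℝ f := hf.differentiable (by simp)
  have hA : ∀ x ∈ rect l 1, f x ^ 2 ≤ A x.2 := by
    intro x hx
    have := sq_le_average_add (g := fun s => f (s, x.2))
      (g' := fun s => fderiv ℝ f (s, x.2) (1, 0))
      (fun t => (hfd (t, x.2)).hasFDerivAt.comp_hasDerivAt t
        ((hasDerivAt_id t).prodMk (hasDerivAt_const t x.2)))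
      ((hd (1, 0)).comp (by fun_prop)) hx.1
    have e : l / 2 - -l / 2 = l := by ring
    rw [e] at this
    exact this
  have hB : ∀ x ∈ rect l 1, f x ^ 2 ≤ B x.1 := by
    intro x hx
    have := sq_le_average_add (g := fun s => f (x.1, s))
      (g' := fun s => fderiv ℝ f (x.1, s) (0, 1))
      (fun t => (hfd (x.1, t)).hasFDerivAt.comp_hasDerivAt t
        ((hasDerivAt_const t x.1).prodMk (hasDerivAt_id t)))
      ((hd (0, 1)).comp (by fun_prop)) hx.2
    have e : (1 : ℝ) / 2 - -1 / 2 = 1 := by norm_num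
    rw [e, inv_one, one_mul] at this
    exact this
  have hAi : Integrable A (volume.restrict (interval 1)) :=
    ((hi hf2).integral_prod_right.const_mul _).add (hi (hc _)).integral_prod_right
  have hBi : Integrable B (volume.restrict (interval l)) :=
    (hi hf2).integral_prod_left.add (hi (hc _)).integral_prod_left
  have hAint : ∫ t in interval 1, A t = l⁻¹ * (∫ x in rect l 1, f x ^ 2)
      + ∫ x in rect l 1, 2 * |f x * fderiv ℝ f x (1, 0)| := by
    simp only [A]
    rw [integral_add ((hi hf2).integral_prod_right.const_mul _)
      (hi (hc _)).integral_prod_right, integral_const_mul, hres,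
      integral_prod_symm _ (hi hf2), integral_prod_symm _ (hi (hc _))]
  have hBint : ∫ t in interval l, B t = (∫ x in rect l 1, f x ^ 2)
      + ∫ x in rect l 1, 2 * |f x * fderiv ℝ f x (0, 1)| := by
    simp only [B]
    rw [integral_add (hi hf2).integral_prod_left
      (hi (hc _)).integral_prod_left, hres,
      integral_prod _ (hi hf2), integral_prod _ (hi (hc _))]
  rw [← hAint, ← hBint, mul_comm, ← integral_prod_mul, ← hres]
  refine setIntegral_mono_on (MemLp.integrable (by norm_num) (hS.memL2_of_continuous (hfc.pow 4)))
    ?_ hS.isOpen.measurableSet fun x hx => ?_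
  · rw [IntegrableOn, hres]
    exact hBi.mul_prod hAi
  · calc f x ^ 4 = f x ^ 2 * f x ^ 2 := by ring
      _ ≤ B x.1 * A x.2 := mul_le_mul (hB x hx) (hA x hx) (sq_nonneg _)
        ((sq_nonneg _).trans (hB x hx))

/-- The right-hand side of Ladyzhenskaya's inequality, with the squared `L²` norms of a function
and of its partial derivatives as arguments. -/
def ladyzhenskayaBound (l a b c : ℝ) : ℝ := (l⁻¹ * a + 2 * (√a * √b)) * (a + 2 * (√a * √c))

theorem integral_abs_mul_le {Ω : Set (ℝ × ℝ)} {f g : ℝ × ℝ → ℝ} (hf : MemL2 Ω f)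
    (hg : MemL2 Ω g) :
    ∫ x in Ω, 2 * |f x * g x| ≤ 2 * (√(∫ x in Ω, f x ^ 2) * √(∫ x in Ω, g x ^ 2)) := by
  rw [integral_const_mul]
  have hf' : MemL2 Ω fun x => |f x| := MemLp.abs hf
  have hg' : MemL2 Ω fun x => |g x| := MemLp.abs hg
  have h := (le_abs_self _).trans (abs_integral_mul_le hf' hg')
  simp only [sq_abs, ← abs_mul] at h
  linarith

theorem integral_pow_four_le_bound (hl : 0 < l) {f : ℝ × ℝ → ℝ} (hf : ContDiff ℝ ∞ f) :
    ∫ x in rect l 1, f x ^ 4 ≤ ladyzhenskayaBound l (∫ x in rect l 1, f x ^ 2)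
      (∫ x in rect l 1, fderiv ℝ f x (1, 0) ^ 2) (∫ x in rect l 1, fderiv ℝ f x (0, 1) ^ 2) := by
  have hS := isStarDomain_rect hl one_pos
  have hd : ∀ e : ℝ × ℝ, Continuous fun x => fderiv ℝ f x e := fun e =>
    (hf.continuous_fderiv (by simp)).clm_apply continuous_const
  have hm := hS.memL2_of_continuous hf.continuous
  refine (integral_pow_four_le_of_contDiff hl hf).trans ?_
  unfold ladyzhenskayaBound
  have h0 := integral_sq_nonneg (Ω := rect l 1) f
  refine mul_le_mul (add_le_add le_rfl (integral_abs_mul_le hm (hS.memL2_of_continuous (hd _))))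
    (add_le_add le_rfl (integral_abs_mul_le hm (hS.memL2_of_continuous (hd _)))) ?_ ?_
  · exact add_nonneg h0 (integral_nonneg fun x => by positivity)
  · positivity

/-- Ladyzhenskaya's inequality on a rectangle. -/
theorem MemW12.integral_pow_four_le (hl : 0 < l) {f : ℝ × ℝ → ℝ} (hf : MemW12 (rect l 1) f) :
    MemL2 (rect l 1) (fun x => f x ^ 2) ∧
    ∫ x in rect l 1, f x ^ 4 ≤ ladyzhenskayaBound l (∫ x in rect l 1, f x ^ 2)
      (∫ x in rect l 1, weakDeriv (rect l 1) (1, 0) f x ^ 2)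
      (∫ x in rect l 1, weakDeriv (rect l 1) (0, 1) f x ^ 2) := by
  have hS := isStarDomain_rect hl one_pos
  obtain ⟨φ, hφ, hφf, hφd⟩ := hS.exists_smooth_approx hf
  have hmeas := tendstoInMeasure_of_tendsto_eLpNorm (p := 2) (by norm_num)
    (fun k => (hφf.1 k).1) hφf.2.1.1 hφf.2.2
  obtain ⟨ns, hns, hae⟩ := hmeas.exists_seq_tendsto_ae
  set R := ladyzhenskayaBound l (∫ x in rect l 1, f x ^ 2)
      (∫ x in rect l 1, weakDeriv (rect l 1) (1, 0) f x ^ 2)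
      (∫ x in rect l 1, weakDeriv (rect l 1) (0, 1) f x ^ 2) with hR
  have hRlim : Tendsto (fun k => ladyzhenskayaBound l (∫ x in rect l 1, φ (ns k) x ^ 2)
      (∫ x in rect l 1, fderiv ℝ (φ (ns k)) x (1, 0) ^ 2)
      (∫ x in rect l 1, fderiv ℝ (φ (ns k)) x (0, 1) ^ 2)) atTop (𝓝 R) := by
    have ha := hφf.tendsto_sq.comp hns.tendsto_atTop
    have hb := (hφd (1, 0)).tendsto_sq.comp hns.tendsto_atTop
    have hc := (hφd (0, 1)).tendsto_sq.comp hns.tendsto_atTop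
    have hs : ∀ {a : ℕ → ℝ} {b : ℝ}, Tendsto a atTop (𝓝 b) →
        Tendsto (fun k => √(a k)) atTop (𝓝 √b) := fun h => (Real.continuous_sqrt.tendsto _).comp h
    exact ((ha.const_mul l⁻¹).add (((hs ha).mul (hs hb)).const_mul 2)).mul
      (ha.add (((hs ha).mul (hs hc)).const_mul 2))
  -- Fatou's lemma along an a.e. convergent subsequence of smooth approximations; this also yields
  -- the integrability of f⁴.
  have hfat : ∫⁻ x in rect l 1, ENNReal.ofReal (f x ^ 4) ≤ ENNReal.ofReal R := by
    calc ∫⁻ x in rect l 1, ENNReal.ofReal (f x ^ 4)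
        ≤ ∫⁻ x in rect l 1, liminf (fun k => ENNReal.ofReal (φ (ns k) x ^ 4)) atTop := by
          refine lintegral_mono_ae ?_
          filter_upwards [hae] with x hx
          refine le_of_eq (Tendsto.liminf_eq ?_).symm
          exact (ENNReal.continuous_ofReal.tendsto _).comp (hx.pow 4)
      _ ≤ liminf (fun k => ∫⁻ x in rect l 1, ENNReal.ofReal (φ (ns k) x ^ 4)) atTop :=
          lintegral_liminf_le fun k => ((hφ _).continuous.pow 4).measurable.ennreal_ofReal
      _ ≤ liminf (fun k => ENNReal.ofReal (ladyzhenskayaBound l (∫ x in rect l 1, φ (ns k) x ^ 2)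
            (∫ x in rect l 1, fderiv ℝ (φ (ns k)) x (1, 0) ^ 2)
            (∫ x in rect l 1, fderiv ℝ (φ (ns k)) x (0, 1) ^ 2))) atTop := by
          refine liminf_le_liminf (Eventually.of_forall fun k => ?_)
          have hi : IntegrableOn (fun x => φ (ns k) x ^ 4) (rect l 1) := by
            have := (hS.memL2_of_continuous ((hφ (ns k)).continuous.pow 2)).integrable_sq
            simpa [← pow_mul] using this
          show _ ≤ _
          rw [← ofReal_integral_eq_lintegral_ofReal hi
            (Eventually.of_forall fun x => by positivity)]
          exact ENNReal.ofReal_le_ofReal (integral_pow_four_le_bound hl (hφ _))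
      _ = ENNReal.ofReal R := ((ENNReal.continuous_ofReal.tendsto _).comp hRlim).liminf_eq
  have hR0 : 0 ≤ R := by
    refine ge_of_tendsto' hRlim fun k => ?_
    exact (integral_nonneg fun x => by positivity).trans (integral_pow_four_le_bound hl (hφ _))
  have hm4 : AEStronglyMeasurable (fun x => f x ^ 4) (volume.restrict (rect l 1)) := hf.1.1.pow 4
  have hi4 : IntegrableOn (fun x => f x ^ 4) (rect l 1) := by
    refine ⟨hm4, ?_⟩
    rw [hasFiniteIntegral_iff_ofReal (Eventually.of_forall fun x => by positivity)]
    exact hfat.trans_lt ENNReal.ofReal_lt_top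
  refine ⟨(memLp_two_iff_integrable_sq (hf.1.1.pow 2)).2 (hi4.congr
    (Eventually.of_forall fun x => by simp [← pow_mul])), ?_⟩
  rw [← ENNReal.ofReal_le_ofReal_iff hR0, ofReal_integral_eq_lintegral_ofReal hi4
    (Eventually.of_forall fun x => by positivity)]
  exact hfat

theorem memL2_mul {Ω : Set (ℝ × ℝ)} {f g : ℝ × ℝ → ℝ} (hf : MemL2 Ω f) (hg : MemL2 Ω g)
    (hf2 : MemL2 Ω (fun x => f x ^ 2)) (hg2 : MemL2 Ω (fun x => g x ^ 2)) :
    MemL2 Ω (fun x => f x * g x) ∧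
      ∫ x in Ω, (f x * g x) ^ 2 ≤ √(∫ x in Ω, f x ^ 4) * √(∫ x in Ω, g x ^ 4) := by
  constructor
  · refine (memLp_two_iff_integrable_sq (hf.1.mul hg.1)).2 ?_
    simpa [mul_pow, IntegrableOn] using hf2.integrable_mul hg2
  · have := (le_abs_self _).trans (abs_integral_mul_le hf2 hg2)
    simpa [mul_pow, ← pow_mul] using this

/-- In Ladyzhenskaya's bound for Fₙ − G, the L² norm of the function tends to 0 by Rellich while
those of the derivatives stay bounded. -/
theorem ConvW12.tendsto_pow_four (hl : 0 < l) {F : ℕ → ℝ × ℝ → ℝ} {G : ℝ × ℝ → ℝ}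
    (hF : ConvW12 WeakL2 (rect l 1) F G) :
    Tendsto (fun n => ∫ x in rect l 1, (F n x - G x) ^ 4) atTop (𝓝 0) := by
  have hS := isStarDomain_rect hl one_pos
  have hs := (strongL2_iff.1 (hF.strongL2 hS)).2.2
  obtain ⟨hFm, hGm, hw, hd⟩ := hF
  have hdb : ∀ e : ℝ × ℝ, ∃ C, 0 ≤ C ∧ ∀ n,
      ∫ x in rect l 1, weakDeriv (rect l 1) e (fun x => F n x - G x) x ^ 2 ≤ C := fun e =>
    ((hd e).sub_self.congr (fun n => (weakDeriv_sub_ae hS.isOpen (hFm n) hGm).symm)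
      (ae_eq_refl _)).bounded
  obtain ⟨C0, hC0, hb0⟩ := hdb (1, 0)
  obtain ⟨C1, hC1, hb1⟩ := hdb (0, 1)
  have hsq : Tendsto (fun n => √(∫ x in rect l 1, (F n x - G x) ^ 2)) atTop (𝓝 0) := by
    simpa [Function.comp_def] using (Real.continuous_sqrt.tendsto 0).comp hs
  have hlim : Tendsto (fun n => ladyzhenskayaBound l (∫ x in rect l 1, (F n x - G x) ^ 2) C0 C1)
      atTop (𝓝 0) := by
    have := ((hs.const_mul l⁻¹).add ((hsq.mul_const √C0).const_mul 2)).mul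
      (hs.add ((hsq.mul_const √C1).const_mul 2))
    simpa [ladyzhenskayaBound] using this
  refine tendsto_of_nonneg_le (fun n => integral_nonneg fun x => by positivity) (fun n => ?_) hlim
  refine (MemW12.integral_pow_four_le hl ((hFm n).sub hS.isOpen hGm)).2.trans ?_
  have h0 := integral_sq_nonneg (Ω := rect l 1) fun x => F n x - G x
  have := hb0 n
  have := hb1 n
  unfold ladyzhenskayaBound
  gcongr

/-- Products of sequences that converge weakly in `W^{1,2}` converge strongly in `L²`. -/
theorem ConvW12.strongL2_mul (hl : 0 < l) {F F' : ℕ → ℝ × ℝ → ℝ} {G G' : ℝ × ℝ → ℝ}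
    (hF : ConvW12 WeakL2 (rect l 1) F G) (hF' : ConvW12 WeakL2 (rect l 1) F' G') :
    StrongL2 (rect l 1) (fun n x => F n x * F' n x) (fun x => G x * G' x) := by
  have hS := isStarDomain_rect hl one_pos
  have h4 : ∀ {f : ℝ × ℝ → ℝ}, MemW12 (rect l 1) f → MemL2 (rect l 1) (fun x => f x ^ 2) :=
    fun hf => (MemW12.integral_pow_four_le hl hf).1
  have hm : ∀ {f g : ℝ × ℝ → ℝ}, MemW12 (rect l 1) f → MemW12 (rect l 1) g →
      MemL2 (rect l 1) (fun x => f x * g x) := fun hf hg => (memL2_mul hf.1 hg.1 (h4 hf) (h4 hg)).1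
  have hd : ∀ n, MemW12 (rect l 1) (fun x => F n x - G x) := fun n => (hF.1 n).sub hS.isOpen hF.2.1
  have hd' : ∀ n, MemW12 (rect l 1) (fun x => F' n x - G' x) := fun n =>
    (hF'.1 n).sub hS.isOpen hF'.2.1
  have hq : ∀ {a : ℕ → ℝ}, Tendsto a atTop (𝓝 0) → Tendsto (fun n => √(a n)) atTop (𝓝 0) := by
    intro a ha
    simpa [Function.comp_def] using (Real.continuous_sqrt.tendsto 0).comp ha
  have hz : ∀ {A B : ℕ → ℝ × ℝ → ℝ}, (∀ n, MemW12 (rect l 1) (A n)) →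
      (∀ n, MemW12 (rect l 1) (B n)) →
      Tendsto (fun n => √(∫ x in rect l 1, A n x ^ 4) * √(∫ x in rect l 1, B n x ^ 4)) atTop (𝓝 0) →
      StrongL2 (rect l 1) (fun n x => A n x * B n x) (fun _ => 0) := by
    intro A B hA hB hlim
    refine StrongL2.of_tendsto (fun n => hm (hA n) (hB n))
      (hS.memL2_of_continuous continuous_const) ?_
    simp only [sub_zero]
    exact tendsto_of_nonneg_le (fun n => integral_sq_nonneg _)
      (fun n => (memL2_mul (hA n).1 (hB n).1 (h4 (hA n)) (h4 (hB n))).2) hlim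
  have t := hq (hF.tendsto_pow_four hl)
  have t' := hq (hF'.tendsto_pow_four hl)
  have s1 := hz hd hd' (by simpa using t.mul t')
  have s2 := hz hd (fun _ => hF'.2.1) (by simpa using t.mul_const _)
  have s3 := hz (fun _ => hF.2.1) hd' (by simpa using t'.const_mul _)
  -- FF' = (F − G)(F' − G') + (F − G)G' + G(F' − G') + GG'; each of the first three terms has a
  -- factor that is null in L⁴.
  have := ((s1.add s2).add s3).add (StrongL2.const (hm hF.2.1 hF'.2.1))
  refine this.congr (fun n => Eventually.of_forall fun x => ?_)
    (Eventually.of_forall fun x => ?_)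
  · show (F n x - G x) * (F' n x - G' x) + (F n x - G x) * G' x + G x * (F' n x - G' x)
      + G x * G' x = F n x * F' n x
    ring
  · simp

end Ladyzhenskaya

/-! ### Korn's inequality in the quarter plane -/

section QuarterPlane

/-- The open quarter plane. -/
def quarter : Set (ℝ × ℝ) := Ioi 0 ×ˢ Ioi 0

/-- The partial derivative in the first variable. -/
def dx (f : ℝ × ℝ → ℝ) (x : ℝ × ℝ) : ℝ := fderiv ℝ f x (1, 0)

/-- The partial derivative in the second variable. -/
def dy (f : ℝ × ℝ → ℝ) (x : ℝ × ℝ) : ℝ := fderiv ℝ f x (0, 1)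

/-- Smooth functions of compact support in the plane. -/
def IsTest (f : ℝ × ℝ → ℝ) : Prop := ContDiff ℝ ∞ f ∧ HasCompactSupport f

/-- The combination `α f(x₁, x₂) + β f(3x₁, x₂)`. -/
def stretchX (α β : ℝ) (f : ℝ × ℝ → ℝ) (x : ℝ × ℝ) : ℝ := α * f x + β * f (3 * x.1, x.2)

/-- The combination `α f(x₁, x₂) + β f(x₁, 3x₂)`. -/
def stretchY (α β : ℝ) (f : ℝ × ℝ → ℝ) (x : ℝ × ℝ) : ℝ := α * f x + β * f (x.1, 3 * x.2)

variable {f g : ℝ × ℝ → ℝ}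

theorem contDiff_dx (hf : ContDiff ℝ ∞ f) : ContDiff ℝ ∞ (dx f) :=
  (hf.fderiv_right (m := ∞) (by simp)).clm_apply contDiff_const

theorem contDiff_dy (hf : ContDiff ℝ ∞ f) : ContDiff ℝ ∞ (dy f) :=
  (hf.fderiv_right (m := ∞) (by simp)).clm_apply contDiff_const

theorem IsTest.dx (hf : IsTest f) : IsTest (dx f) := ⟨contDiff_dx hf.1, hf.2.fderiv_apply ℝ _⟩

theorem IsTest.dy (hf : IsTest f) : IsTest (dy f) := ⟨contDiff_dy hf.1, hf.2.fderiv_apply ℝ _⟩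

theorem IsTest.add (hf : IsTest f) (hg : IsTest g) : IsTest (fun x => f x + g x) :=
  ⟨hf.1.add hg.1, hf.2.add hg.2⟩

theorem IsTest.const_mul (hf : IsTest f) (c : ℝ) : IsTest (fun x => c * f x) :=
  ⟨contDiff_const.mul hf.1, hf.2.mul_left⟩

theorem IsTest.mul (hf : IsTest f) (hg : IsTest g) : IsTest (fun x => f x * g x) :=
  ⟨hf.1.mul hg.1, hf.2.mul_right⟩

theorem IsTest.memL2 (hf : IsTest f) (Ω : Set (ℝ × ℝ)) : MemL2 Ω f :=
  (hf.1.continuous.memLp_of_hasCompactSupport hf.2).restrict Ω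

theorem IsTest.integrable (hf : IsTest f) : Integrable f :=
  hf.1.continuous.integrable_of_hasCompactSupport hf.2

theorem hasCompactSupport_comp_scale (hf : HasCompactSupport f) {a b : ℝ} (ha : a ≠ 0)
    (hb : b ≠ 0) : HasCompactSupport fun x : ℝ × ℝ => f (a * x.1, b * x.2) :=
  hf.comp_homeomorph ((Homeomorph.mulLeft₀ a ha).prodCongr (Homeomorph.mulLeft₀ b hb))

theorem IsTest.scaleX (hf : IsTest f) : IsTest fun x : ℝ × ℝ => f (3 * x.1, x.2) :=
  ⟨hf.1.comp ((contDiff_const.mul contDiff_fst).prodMk contDiff_snd), by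
      simpa using hasCompactSupport_comp_scale hf.2 (a := 3) (b := 1) (by norm_num) (by norm_num)⟩

theorem IsTest.stretchX (hf : IsTest f) (α β : ℝ) : IsTest (stretchX α β f) :=
  (hf.const_mul α).add (hf.scaleX.const_mul β)

theorem IsTest.scaleY (hf : IsTest f) : IsTest fun x : ℝ × ℝ => f (x.1, 3 * x.2) :=
  ⟨hf.1.comp (contDiff_fst.prodMk (contDiff_const.mul contDiff_snd)), by
      simpa using hasCompactSupport_comp_scale hf.2 (a := 1) (b := 3) (by norm_num) (by norm_num)⟩

theorem IsTest.stretchY (hf : IsTest f) (α β : ℝ) : IsTest (stretchY α β f) :=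
  (hf.const_mul α).add (hf.scaleY.const_mul β)

theorem hasDerivAt_fst (hf : ContDiff ℝ ∞ f) (s t : ℝ) :
    HasDerivAt (fun s => f (s, t)) (dx f (s, t)) s :=
  ((hf.differentiable (by simp)) (s, t)).hasFDerivAt.comp_hasDerivAt s
    ((hasDerivAt_id s).prodMk (hasDerivAt_const s t))

theorem hasDerivAt_snd (hf : ContDiff ℝ ∞ f) (s t : ℝ) :
    HasDerivAt (fun t => f (s, t)) (dy f (s, t)) t :=
  ((hf.differentiable (by simp)) (s, t)).hasFDerivAt.comp_hasDerivAt t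
    ((hasDerivAt_const t s).prodMk (hasDerivAt_id t))

theorem dx_eq_of_hasDerivAt (hf : ContDiff ℝ ∞ f) {x : ℝ × ℝ} {a : ℝ}
    (h : HasDerivAt (fun s => f (s, x.2)) a x.1) : dx f x = a :=
  (hasDerivAt_fst hf x.1 x.2).unique h

theorem dy_eq_of_hasDerivAt (hf : ContDiff ℝ ∞ f) {x : ℝ × ℝ} {a : ℝ}
    (h : HasDerivAt (fun s => f (x.1, s)) a x.2) : dy f x = a :=
  (hasDerivAt_snd hf x.1 x.2).unique h

theorem dx_stretchX (hf : IsTest f) (α β : ℝ) :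
    dx (stretchX α β f) = stretchX α (3 * β) (dx f) := by
  funext x
  refine dx_eq_of_hasDerivAt (hf.stretchX α β).1 ?_
  have h1 := (hasDerivAt_fst hf.1 x.1 x.2).const_mul α
  have h2 := (((hasDerivAt_fst hf.1 (3 * x.1) x.2).comp x.1
    ((hasDerivAt_id x.1).const_mul 3))).const_mul β
  refine (h1.add h2).congr_deriv ?_
  simp only [stretchX]
  ring

theorem dy_stretchX (hf : IsTest f) (α β : ℝ) :
    dy (stretchX α β f) = stretchX α β (dy f) := by
  funext x
  refine dy_eq_of_hasDerivAt (hf.stretchX α β).1 ?_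
  exact ((hasDerivAt_snd hf.1 x.1 x.2).const_mul α).add
    ((hasDerivAt_snd hf.1 (3 * x.1) x.2).const_mul β)

theorem dy_stretchY (hf : IsTest f) (α β : ℝ) :
    dy (stretchY α β f) = stretchY α (3 * β) (dy f) := by
  funext x
  refine dy_eq_of_hasDerivAt (hf.stretchY α β).1 ?_
  have h1 := (hasDerivAt_snd hf.1 x.1 x.2).const_mul α
  have h2 := (((hasDerivAt_snd hf.1 x.1 (3 * x.2)).comp x.2
    ((hasDerivAt_id x.2).const_mul 3))).const_mul β
  refine (h1.add h2).congr_deriv ?_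
  simp only [stretchY]
  ring

theorem dx_stretchY (hf : IsTest f) (α β : ℝ) :
    dx (stretchY α β f) = stretchY α β (dx f) := by
  funext x
  refine dx_eq_of_hasDerivAt (hf.stretchY α β).1 ?_
  exact ((hasDerivAt_fst hf.1 x.1 x.2).const_mul α).add
    ((hasDerivAt_fst hf.1 x.1 (3 * x.2)).const_mul β)

theorem volume_restrict_quarter : (volume.restrict quarter : Measure (ℝ × ℝ))
    = (volume.restrict (Ioi 0)).prod (volume.restrict (Ioi 0)) := by
  rw [Measure.prod_restrict]; rfl

theorem integrable_quarter (hf : Integrable f) :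
    Integrable f ((volume.restrict (Ioi (0 : ℝ))).prod (volume.restrict (Ioi (0 : ℝ)))) := by
  rw [← volume_restrict_quarter]
  exact hf.integrableOn

theorem integral_quarter (hf : Integrable f) :
    ∫ x in quarter, f x = ∫ s in Ioi (0 : ℝ), ∫ t in Ioi (0 : ℝ), f (s, t) := by
  rw [volume_restrict_quarter, integral_prod _ (integrable_quarter hf)]

theorem integral_quarter_symm (hf : Integrable f) :
    ∫ x in quarter, f x = ∫ t in Ioi (0 : ℝ), ∫ s in Ioi (0 : ℝ), f (s, t) := by
  rw [volume_restrict_quarter, integral_prod_symm _ (integrable_quarter hf)]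

theorem hasCompactSupport_slice_fst (hf : HasCompactSupport f) (t : ℝ) :
    HasCompactSupport fun s => f (s, t) :=
  hf.comp_isClosedEmbedding (g := fun s => (s, t))
    ((Isometry.of_dist_eq fun a b => by simp [Prod.dist_eq]).isClosedEmbedding)

theorem hasCompactSupport_slice_snd (hf : HasCompactSupport f) (s : ℝ) :
    HasCompactSupport fun t => f (s, t) :=
  hf.comp_isClosedEmbedding (g := fun t => (s, t))
    ((Isometry.of_dist_eq fun a b => by simp [Prod.dist_eq]).isClosedEmbedding)

theorem integral_quarter_dx (hf : IsTest f) :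
    ∫ x in quarter, dx f x = -∫ t in Ioi (0 : ℝ), f (0, t) := by
  rw [integral_quarter_symm hf.dx.integrable, ← integral_neg]
  refine integral_congr_ae (Eventually.of_forall fun t => ?_)
  have hc := hasCompactSupport_slice_fst hf.2 t
  have h := hc.integral_Ioi_deriv_eq (hf.1.comp (contDiff_id.prodMk contDiff_const) |>.of_le
    (by simp)) 0
  simpa [Function.comp_def, fun s => (hasDerivAt_fst hf.1 s t).deriv] using h

theorem integral_quarter_dy (hf : IsTest f) :
    ∫ x in quarter, dy f x = -∫ t in Ioi (0 : ℝ), f (t, 0) := by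
  rw [integral_quarter hf.dy.integrable, ← integral_neg]
  refine integral_congr_ae (Eventually.of_forall fun t => ?_)
  have hc := hasCompactSupport_slice_snd hf.2 t
  have h := hc.integral_Ioi_deriv_eq (hf.1.comp (contDiff_const.prodMk contDiff_id) |>.of_le
    (by simp)) 0
  simpa [Function.comp_def, fun s => (hasDerivAt_snd hf.1 t s).deriv] using h

theorem integral_quarter_sq_scaleX (hf : IsTest f) :
    ∫ x in quarter, f (3 * x.1, x.2) ^ 2 ≤ ∫ x in quarter, f x ^ 2 := by
  have hf' := hf.scaleX
  have h0 := integral_sq_nonneg (Ω := quarter) f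
  have : ∫ x in quarter, f (3 * x.1, x.2) ^ 2 = 3⁻¹ * ∫ x in quarter, f x ^ 2 := by
    rw [integral_quarter_symm (by simpa [sq] using (hf'.mul hf').integrable),
      integral_quarter_symm (by simpa [sq] using (hf.mul hf).integrable), ← integral_const_mul]
    refine integral_congr_ae (Eventually.of_forall fun t => ?_)
    have := integral_comp_mul_left_Ioi (fun s => f (s, t) ^ 2) 0 (b := 3) (by norm_num)
    simpa using this
  rw [this]
  linarith

theorem integral_quarter_sq_scaleY (hf : IsTest f) :
    ∫ x in quarter, f (x.1, 3 * x.2) ^ 2 ≤ ∫ x in quarter, f x ^ 2 := by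
  have hf' := hf.scaleY
  have h0 := integral_sq_nonneg (Ω := quarter) f
  have : ∫ x in quarter, f (x.1, 3 * x.2) ^ 2 = 3⁻¹ * ∫ x in quarter, f x ^ 2 := by
    rw [integral_quarter (by simpa [sq] using (hf'.mul hf').integrable),
      integral_quarter (by simpa [sq] using (hf.mul hf).integrable), ← integral_const_mul]
    refine integral_congr_ae (Eventually.of_forall fun t => ?_)
    have := integral_comp_mul_left_Ioi (fun s => f (t, s) ^ 2) 0 (b := 3) (by norm_num)
    simpa using this
  rw [this]
  linarith

theorem integral_sq_stretchX_le (hf : IsTest f) (α β : ℝ) :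
    ∫ x in quarter, stretchX α β f x ^ 2 ≤ (2 * α ^ 2 + 2 * β ^ 2) * ∫ x in quarter, f x ^ 2 := by
  have hf' := hf.scaleX
  have h := integral_add_sq_le ((hf.const_mul α).memL2 quarter) ((hf'.const_mul β).memL2 quarter)
  simp only [mul_pow, integral_const_mul] at h
  have := mul_le_mul_of_nonneg_left (integral_quarter_sq_scaleX hf) (sq_nonneg β)
  unfold stretchX
  linarith

theorem integral_sq_stretchY_le (hf : IsTest f) (α β : ℝ) :
    ∫ x in quarter, stretchY α β f x ^ 2 ≤ (2 * α ^ 2 + 2 * β ^ 2) * ∫ x in quarter, f x ^ 2 := by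
  have hf' := hf.scaleY
  have h := integral_add_sq_le ((hf.const_mul α).memL2 quarter) ((hf'.const_mul β).memL2 quarter)
  simp only [mul_pow, integral_const_mul] at h
  have := mul_le_mul_of_nonneg_left (integral_quarter_sq_scaleY hf) (sq_nonneg β)
  unfold stretchY
  linarith

theorem dx_dy_comm (hf : ContDiff ℝ ∞ f) (x : ℝ × ℝ) : dx (dy f) x = dy (dx f) x := by
  have hdiff : DifferentiableAt ℝ (fderiv ℝ f) x :=
    ((hf.fderiv_right (m := ∞) (by simp)).differentiable (by simp)) x
  have hs : IsSymmSndFDerivAt ℝ f x := (hf.contDiffAt).isSymmSndFDerivAt (by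
    rw [minSmoothness_of_isRCLikeNormedField]
    exact WithTop.coe_le_coe.2 (le_top (a := (2 : ℕ∞))))
  unfold dx dy
  rw [fderiv_clm_apply hdiff (differentiableAt_const _),
    fderiv_clm_apply hdiff (differentiableAt_const _)]
  simpa using hs.eq _ _

theorem dx_mul (hf : ContDiff ℝ ∞ f) (hg : ContDiff ℝ ∞ g) (x : ℝ × ℝ) :
    dx (fun x => f x * g x) x = dx f x * g x + f x * dx g x :=
  dx_eq_of_hasDerivAt (hf.mul hg) ((hasDerivAt_fst hf _ _).mul (hasDerivAt_fst hg _ _))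

theorem dy_mul (hf : ContDiff ℝ ∞ f) (hg : ContDiff ℝ ∞ g) (x : ℝ × ℝ) :
    dy (fun x => f x * g x) x = dy f x * g x + f x * dy g x :=
  dy_eq_of_hasDerivAt (hf.mul hg) ((hasDerivAt_snd hf _ _).mul (hasDerivAt_snd hg _ _))

/-- The null Lagrangian `∫ (∂₂a ∂₁b - ∂₁a ∂₂b)` over the quarter plane. -/
def nullLagrangian (a b : ℝ × ℝ → ℝ) : ℝ := ∫ x in quarter, (dy a x * dx b x - dx a x * dy b x)

/-- The null Lagrangian only depends on the boundary values of its arguments. -/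
theorem nullLagrangian_eq {a b : ℝ × ℝ → ℝ} (ha : IsTest a) (hb : IsTest b) :
    nullLagrangian a b = -(∫ t in Ioi (0 : ℝ), a (t, 0) * deriv (fun s => b (s, 0)) t)
      + ∫ t in Ioi (0 : ℝ), a (0, t) * deriv (fun s => b (0, s)) t := by
  have h1 := integral_quarter_dy (ha.mul hb.dx)
  have h2 := integral_quarter_dx (ha.mul hb.dy)
  have e : ∀ x, dy a x * dx b x - dx a x * dy b x
      = dy (fun x => a x * dx b x) x - dx (fun x => a x * dy b x) x := by
    intro x
    rw [dy_mul ha.1 hb.dx.1, dx_mul ha.1 hb.dy.1, dx_dy_comm hb.1]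
    ring
  unfold nullLagrangian
  simp only [e]
  rw [integral_sub (ha.mul hb.dx).dy.integrable.integrableOn
    (ha.mul hb.dy).dx.integrable.integrableOn, h1, h2]
  simp only [fun s => (hasDerivAt_fst hb.1 s 0).deriv, fun s => (hasDerivAt_snd hb.1 0 s).deriv]
  ring

/-- Young's inequality for dh and pq. With d = ∂₂a and h = ∂₂a + ∂₁b, the product ∂₂a ∂₁b equals d(h
− d), so the null Lagrangian controls −½∫d² up to strain terms. -/
theorem integral_energy_le {d h p q : ℝ × ℝ → ℝ} (hd : IsTest d) (hh : IsTest h) (hp : IsTest p)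
    (hq : IsTest q) :
    ∫ x in quarter, (d x * (h x - d x) - p x * q x) ≤ -(1 / 2) * (∫ x in quarter, d x ^ 2)
      + 1 / 2 * (∫ x in quarter, h x ^ 2) + 1 / 2 * (∫ x in quarter, p x ^ 2)
      + 1 / 2 * ∫ x in quarter, q x ^ 2 := by
  have id := (hd.memL2 quarter).integrable_sq
  have ih := (hh.memL2 quarter).integrable_sq
  have ip := (hp.memL2 quarter).integrable_sq
  have iq := (hq.memL2 quarter).integrable_sq
  have i2 : IntegrableOn (fun x => -(1 / 2) * d x ^ 2 + 1 / 2 * h x ^ 2) quarter :=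
    (id.const_mul _).add (ih.const_mul _)
  have i3 : IntegrableOn (fun x => -(1 / 2) * d x ^ 2 + 1 / 2 * h x ^ 2 + 1 / 2 * p x ^ 2)
      quarter := i2.add (ip.const_mul _)
  have e : -(1 / 2) * (∫ x in quarter, d x ^ 2)
      + 1 / 2 * (∫ x in quarter, h x ^ 2) + 1 / 2 * (∫ x in quarter, p x ^ 2)
      + 1 / 2 * ∫ x in quarter, q x ^ 2 = ∫ x in quarter, (-(1 / 2) * d x ^ 2 + 1 / 2 * h x ^ 2
        + 1 / 2 * p x ^ 2 + 1 / 2 * q x ^ 2) := by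
    rw [integral_add i3 (iq.const_mul _), integral_add i2 (ip.const_mul _),
      integral_add (id.const_mul _) (ih.const_mul _)]
    simp only [integral_const_mul]
  rw [e]
  refine integral_mono ?_ (i3.add (iq.const_mul _)) fun x => ?_
  · have hhd : IsTest fun x => h x - d x := by
      simpa [sub_eq_add_neg] using hh.add (hd.const_mul (-1))
    exact ((hd.mul hhd).integrable.sub (hp.mul hq).integrable).integrableOn
  · show d x * (h x - d x) - p x * q x
      ≤ -(1 / 2) * d x ^ 2 + 1 / 2 * h x ^ 2 + 1 / 2 * p x ^ 2 + 1 / 2 * q x ^ 2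
    nlinarith [sq_nonneg (d x - h x), sq_nonneg (p x + q x)]

/-- Korn's inequality in the quarter plane, by comparison with Nitsche's extensions
of the displacement to the other quadrants. -/
theorem korn_quarter {a b : ℝ × ℝ → ℝ} (ha : IsTest a) (hb : IsTest b) :
    ∫ x in quarter, dy a x ^ 2 ≤ 1881 * ((∫ x in quarter, (dy a x + dx b x) ^ 2)
      + (∫ x in quarter, dx a x ^ 2) + ∫ x in quarter, dy b x ^ 2) := by
  have hh : IsTest fun x => dy a x + dx b x := ha.dy.add hb.dx
  -- All stretches have α + β = 1. Hence `stretchX` changes nothing on x₁ = 0 and `stretchY` nothing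
  -- on x₂ = 0, and with these signs the boundary integrals cancel in pairs on each axis.
  have hbd : nullLagrangian a b - nullLagrangian (stretchX (-2) 3 a) (stretchX 2 (-1) b)
      - nullLagrangian (stretchY 2 (-1) a) (stretchY (-2) 3 b)
      + nullLagrangian (stretchX (-2) 3 (stretchY 2 (-1) a))
        (stretchX 2 (-1) (stretchY (-2) 3 b)) = 0 := by
    rw [nullLagrangian_eq ha hb, nullLagrangian_eq (ha.stretchX _ _) (hb.stretchX _ _),
      nullLagrangian_eq (ha.stretchY _ _) (hb.stretchY _ _),
      nullLagrangian_eq ((ha.stretchY _ _).stretchX _ _) ((hb.stretchY _ _).stretchX _ _)]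
    simp only [stretchX, stretchY, mul_zero]
    ring_nf
  have hn : ∀ {f : ℝ × ℝ → ℝ}, IsTest f → IsTest fun x => -f x := fun hf => by
    simpa using hf.const_mul (-1)
  have e1 := integral_energy_le ha.dy hh ha.dx hb.dy
  -- The coefficients (−2, 3) for a and (2, −1) for b are forced. Both pairs must sum to 1, and
  -- differentiating the second in x₁, which gives (2, −3), must give minus the first. The mixed
  -- derivatives ∂₂a and ∂₁b are then combined in the same way, up to sign, and only the strain h
  -- enters. In the x₂ direction the roles of a and b are exchanged.
  have e2 := integral_energy_le (ha.dy.stretchX (-2) 3) (hh.stretchX (-2) 3)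
    (hn (ha.dx.stretchX (-2) 9)) (hb.dy.stretchX 2 (-1))
  have e3 := integral_energy_le (ha.dy.stretchY (-2) 3) (hh.stretchY (-2) 3)
    (hn (ha.dx.stretchY 2 (-1))) (hb.dy.stretchY (-2) 9)
  have e4 := integral_energy_le ((ha.dy.stretchY (-2) 3).stretchX (-2) 3)
    ((hh.stretchY (-2) 3).stretchX (-2) 3) ((ha.dx.stretchY 2 (-1)).stretchX (-2) 9)
    ((hb.dy.stretchY (-2) 9).stretchX 2 (-1))
  have n1 : nullLagrangian a b = ∫ x in quarter,
      (dy a x * ((dy a x + dx b x) - dy a x) - dx a x * dy b x) := by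
    unfold nullLagrangian
    congr 1; funext x; ring
  have n2 : -nullLagrangian (stretchX (-2) 3 a) (stretchX 2 (-1) b) = ∫ x in quarter,
      (stretchX (-2) 3 (dy a) x * (stretchX (-2) 3 (fun x => dy a x + dx b x) x
        - stretchX (-2) 3 (dy a) x)
        - -stretchX (-2) 9 (dx a) x * stretchX 2 (-1) (dy b) x) := by
    unfold nullLagrangian
    rw [← integral_neg]
    congr 1; funext x
    rw [dx_stretchX ha, dx_stretchX hb, dy_stretchX ha, dy_stretchX hb]
    simp only [stretchX]
    ring
  have n3 : -nullLagrangian (stretchY 2 (-1) a) (stretchY (-2) 3 b) = ∫ x in quarter,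
      (stretchY (-2) 3 (dy a) x * (stretchY (-2) 3 (fun x => dy a x + dx b x) x
        - stretchY (-2) 3 (dy a) x)
        - -stretchY 2 (-1) (dx a) x * stretchY (-2) 9 (dy b) x) := by
    unfold nullLagrangian
    rw [← integral_neg]
    congr 1; funext x
    rw [dx_stretchY ha, dx_stretchY hb, dy_stretchY ha, dy_stretchY hb]
    simp only [stretchY]
    ring
  have n4 : nullLagrangian (stretchX (-2) 3 (stretchY 2 (-1) a))
        (stretchX 2 (-1) (stretchY (-2) 3 b)) = ∫ x in quarter,
      (stretchX (-2) 3 (stretchY (-2) 3 (dy a)) x *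
        (stretchX (-2) 3 (stretchY (-2) 3 (fun x => dy a x + dx b x)) x
        - stretchX (-2) 3 (stretchY (-2) 3 (dy a)) x)
        - stretchX (-2) 9 (stretchY 2 (-1) (dx a)) x
          * stretchX 2 (-1) (stretchY (-2) 9 (dy b)) x) := by
    unfold nullLagrangian
    congr 1; funext x
    rw [dx_stretchX (ha.stretchY _ _), dx_stretchX (hb.stretchY _ _), dy_stretchX (ha.stretchY _ _),
      dy_stretchX (hb.stretchY _ _), dx_stretchY ha, dx_stretchY hb, dy_stretchY ha, dy_stretchY hb]
    simp only [stretchX, stretchY]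
    ring
  rw [← n1] at e1
  rw [← n2] at e2
  rw [← n3] at e3
  rw [← n4] at e4
  simp only [neg_sq] at e2 e3
  have b1 := integral_sq_stretchX_le hh (-2) 3
  have b2 := integral_sq_stretchY_le hh (-2) 3
  have b3 := integral_sq_stretchX_le (hh.stretchY (-2) 3) (-2) 3
  have b4 := integral_sq_stretchX_le ha.dx (-2) 9
  have b5 := integral_sq_stretchY_le ha.dx 2 (-1)
  have b6 := integral_sq_stretchX_le (ha.dx.stretchY 2 (-1)) (-2) 9
  have b7 := integral_sq_stretchX_le hb.dy 2 (-1)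
  have b8 := integral_sq_stretchY_le hb.dy (-2) 9
  have b9 := integral_sq_stretchX_le (hb.dy.stretchY (-2) 9) 2 (-1)
  have p1 := integral_sq_nonneg (Ω := quarter) (stretchX (-2) 3 (dy a))
  have p2 := integral_sq_nonneg (Ω := quarter) (stretchY (-2) 3 (dy a))
  have p3 := integral_sq_nonneg (Ω := quarter) (stretchX (-2) 3 (stretchY (-2) 3 (dy a)))
  have p4 := integral_sq_nonneg (Ω := quarter) (fun x => dy a x + dx b x)
  -- The four energy bounds sum to 0 on the left. The constants are (1 + 26)² = 729 for h and (1 +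
  -- 170)(1 + 10) = 1881 for ∂₁a and for ∂₂b; the larger one is kept.
  linarith

end QuarterPlane

/-! ### Korn's second inequality on the rectangle -/

section KornRectangle

/-- The product of two one-dimensional bump functions. -/
def cornerCutoff (χ ψ : ContDiffBump (0 : ℝ)) (x : ℝ × ℝ) : ℝ := χ x.1 * ψ x.2

theorem isTest_cornerCutoff (χ ψ : ContDiffBump (0 : ℝ)) : IsTest (cornerCutoff χ ψ) := by
  refine ⟨(χ.contDiff.comp contDiff_fst).mul (ψ.contDiff.comp contDiff_snd), ?_⟩
  refine HasCompactSupport.intro (χ.hasCompactSupport.isCompact.prod ψ.hasCompactSupport.isCompact)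
    fun x hx => ?_
  by_contra hne
  refine hx ⟨subset_tsupport _ ?_, subset_tsupport _ ?_⟩
  · exact left_ne_zero_of_mul hne
  · exact right_ne_zero_of_mul hne

theorem integral_sq_le_of_sq_le {Ω : Set (ℝ × ℝ)} {f G : ℝ × ℝ → ℝ} (hG : IntegrableOn G Ω)
    (hm : MeasurableSet Ω) (h : ∀ x ∈ Ω, f x ^ 2 ≤ G x) :
    ∫ x in Ω, f x ^ 2 ≤ ∫ x in Ω, G x :=
  integral_mono_of_nonneg (Eventually.of_forall fun _ => sq_nonneg _) hG
    ((ae_restrict_mem hm).mono h)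

/-- The sum of the squared `L²` norms that control the displacement gradient in Korn's inequality. -/
def kornEnergy (Ω : Set (ℝ × ℝ)) (a b : ℝ × ℝ → ℝ) : ℝ :=
  ∫ x in Ω, ((dy a x + dx b x) ^ 2 + dx a x ^ 2 + dy b x ^ 2 + a x ^ 2 + b x ^ 2)

theorem continuous_kornIntegrand {a b : ℝ × ℝ → ℝ} (ha : ContDiff ℝ ∞ a) (hb : ContDiff ℝ ∞ b) :
    Continuous fun x => (dy a x + dx b x) ^ 2 + dx a x ^ 2 + dy b x ^ 2 + a x ^ 2 + b x ^ 2 :=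
  (((((((contDiff_dy ha).continuous.add (contDiff_dx hb).continuous).pow 2).add
    ((contDiff_dx ha).continuous.pow 2)).add ((contDiff_dy hb).continuous.pow 2)).add
    (ha.continuous.pow 2)).add (hb.continuous.pow 2))

theorem measurableSet_quarter : MeasurableSet quarter := measurableSet_Ioi.prod measurableSet_Ioi

/-- Localize `korn_quarter` with a cutoff that is 1 on the smaller rectangle and, within the quarter
plane, vanishes outside the larger one. Derivatives of the cutoff produce the zero-order terms of
`kornEnergy`. The ratio 2/3 exceeds 1/2, so four such corner pieces cover a rectangle. -/
theorem korn_corner {m n : ℝ} (hm : 0 < m) (hn : 0 < n) :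
    ∃ C, 0 ≤ C ∧ ∀ a b : ℝ × ℝ → ℝ, ContDiff ℝ ∞ a → ContDiff ℝ ∞ b →
      ∫ x in Ioo 0 (2 * m / 3) ×ˢ Ioo 0 (2 * n / 3), dy a x ^ 2
        ≤ C * kornEnergy (Ioo 0 m ×ˢ Ioo 0 n) a b := by
  let χ : ContDiffBump (0 : ℝ) := ⟨2 * m / 3, m, by positivity, by linarith⟩
  let ψ : ContDiffBump (0 : ℝ) := ⟨2 * n / 3, n, by positivity, by linarith⟩
  set c := cornerCutoff χ ψ with hc
  have hct : IsTest c := isTest_cornerCutoff χ ψ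
  obtain ⟨K₁, hK₁⟩ := hct.dx.1.continuous.bounded_above_of_compact_support hct.dx.2
  obtain ⟨K₂, hK₂⟩ := hct.dy.1.continuous.bounded_above_of_compact_support hct.dy.2
  set K := K₁ ^ 2 + K₂ ^ 2 with hK
  have hKx : ∀ x, dx c x ^ 2 ≤ K := fun x => by
    have h1 := sq_le_sq' (by linarith [neg_abs_le (dx c x), hK₁ x, Real.norm_eq_abs (dx c x)])
      ((le_abs_self _).trans (hK₁ x))
    have := sq_nonneg K₂
    linarith
  have hKy : ∀ x, dy c x ^ 2 ≤ K := fun x => by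
    have h1 := sq_le_sq' (by linarith [neg_abs_le (dy c x), hK₂ x, Real.norm_eq_abs (dy c x)])
      ((le_abs_self _).trans (hK₂ x))
    have := sq_nonneg K₁
    linarith
  have hK0 : 0 ≤ K := by positivity
  have hc1 : ∀ x, c x ^ 2 ≤ 1 := fun x => by
    have h1 := χ.le_one (x := x.1)
    have h2 := ψ.le_one (x := x.2)
    have h3 := χ.nonneg (x := x.1)
    have h4 := ψ.nonneg (x := x.2)
    have h5 : c x ≤ 1 := mul_le_one₀ h1 h4 h2
    have h6 : 0 ≤ c x := mul_nonneg h3 h4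
    nlinarith
  set R : Set (ℝ × ℝ) := Ioo 0 m ×ˢ Ioo 0 n with hR
  have hRm : MeasurableSet R := measurableSet_Ioo.prod measurableSet_Ioo
  have hRQ : R ⊆ quarter := fun x hx => ⟨hx.1.1, hx.2.1⟩
  have hc0 : ∀ x, 0 ≤ c x := fun x => mul_nonneg χ.nonneg ψ.nonneg
  have hcz : ∀ x ∈ quarter \ R, c x = 0 := by
    intro y hy
    by_contra hne
    have h1' : y.1 ∈ Function.support χ := left_ne_zero_of_mul hne
    have h2' : y.2 ∈ Function.support ψ := right_ne_zero_of_mul hne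
    rw [χ.support_eq, mem_ball_zero_iff] at h1'
    rw [ψ.support_eq, mem_ball_zero_iff] at h2'
    exact hy.2 ⟨⟨hy.1.1, (le_abs_self _).trans_lt h1'⟩, ⟨hy.1.2, (le_abs_self _).trans_lt h2'⟩⟩
  -- The cutoff is nonnegative, so its zeros are minima and its derivative vanishes there too,
  -- including on the far edges of R.
  have hfz : ∀ x ∈ quarter \ R, fderiv ℝ c x = 0 := fun x hx =>
    IsLocalMin.fderiv_eq_zero (Eventually.of_forall fun y => by rw [hcz x hx]; exact hc0 y)
  have hxz : ∀ x ∈ quarter \ R, dx c x = 0 := fun x hx => by simp [dx, hfz x hx]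
  have hyz : ∀ x ∈ quarter \ R, dy c x = 0 := fun x hx => by simp [dy, hfz x hx]
  -- 7 + 7K collects 3 + 3K from the shear strain and 2 + 2K from each diagonal strain of the
  -- cut-off displacement.
  refine ⟨1881 * (7 + 7 * K), by positivity, fun a b ha hb => ?_⟩
  have hca : IsTest fun x => c x * a x := ⟨hct.1.mul ha, hct.2.mul_right⟩
  have hcb : IsTest fun x => c x * b x := ⟨hct.1.mul hb, hct.2.mul_right⟩
  have hkorn := korn_quarter hca hcb
  have hG := continuous_kornIntegrand ha hb
  set G : ℝ × ℝ → ℝ := fun x =>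
    (dy a x + dx b x) ^ 2 + dx a x ^ 2 + dy b x ^ 2 + a x ^ 2 + b x ^ 2 with hGdef
  have hGi : IntegrableOn G R := by
    refine (hG.continuousOn.integrableOn_compact
      ((isCompact_Icc (a := (0 : ℝ)) (b := m)).prod (isCompact_Icc (a := (0 : ℝ)) (b := n)))).mono_set ?_
    exact prod_mono Ioo_subset_Icc_self Ioo_subset_Icc_self
  have hbound : ∀ (F : ℝ × ℝ → ℝ) (k : ℝ), (∀ x ∈ quarter \ R, F x = 0) →
      (∀ x, F x ^ 2 ≤ k * G x) → ∫ x in quarter, F x ^ 2 ≤ k * ∫ x in R, G x := by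
    intro F k hF hk
    have hFR : ∫ x in quarter, F x ^ 2 = ∫ x in R, F x ^ 2 :=
      setIntegral_eq_of_subset_of_forall_sdiff_eq_zero measurableSet_quarter hRQ
        (fun x hx => by rw [hF x hx]; norm_num)
    rw [hFR, ← integral_const_mul]
    exact integral_sq_le_of_sq_le (hGi.const_mul k) hRm fun x _ => hk x
  have b1 : ∫ x in quarter, (dy (fun x => c x * a x) x + dx (fun x => c x * b x) x) ^ 2
      ≤ (3 + 3 * K) * ∫ x in R, G x := by
    refine hbound _ _ (fun x hx => ?_) fun x => ?_
    · rw [dy_mul hct.1 ha, dx_mul hct.1 hb, hcz x hx, hxz x hx, hyz x hx]; ring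
    · rw [dy_mul hct.1 ha, dx_mul hct.1 hb]
      have e : (dy c x * a x + c x * dy a x + (dx c x * b x + c x * dx b x)) ^ 2
          ≤ 3 * (c x ^ 2 * (dy a x + dx b x) ^ 2) + 3 * (dy c x ^ 2 * a x ^ 2)
            + 3 * (dx c x ^ 2 * b x ^ 2) := by
        nlinarith [sq_nonneg (c x * (dy a x + dx b x) - dy c x * a x),
          sq_nonneg (c x * (dy a x + dx b x) - dx c x * b x),
          sq_nonneg (dy c x * a x - dx c x * b x)]
      have e1 := mul_le_mul_of_nonneg_right (hc1 x) (sq_nonneg (dy a x + dx b x))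
      have e2 := mul_le_mul_of_nonneg_right (hKy x) (sq_nonneg (a x))
      have e3 := mul_le_mul_of_nonneg_right (hKx x) (sq_nonneg (b x))
      have e4 : 0 ≤ K * ((dy a x + dx b x) ^ 2 + dx a x ^ 2 + dy b x ^ 2) := by positivity
      have e5 := sq_nonneg (dx a x)
      have e6 := sq_nonneg (dy b x)
      have e7 := sq_nonneg (a x)
      have e8 := sq_nonneg (b x)
      simp only [hGdef]
      linarith
  have b2 : ∫ x in quarter, dx (fun x => c x * a x) x ^ 2 ≤ (2 + 2 * K) * ∫ x in R, G x := by
    refine hbound _ _ (fun x hx => ?_) fun x => ?_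
    · rw [dx_mul hct.1 ha, hcz x hx, hxz x hx]; ring
    · rw [dx_mul hct.1 ha]
      have e : (dx c x * a x + c x * dx a x) ^ 2
          ≤ 2 * (c x ^ 2 * dx a x ^ 2) + 2 * (dx c x ^ 2 * a x ^ 2) := by
        nlinarith [sq_nonneg (c x * dx a x - dx c x * a x)]
      have e1 := mul_le_mul_of_nonneg_right (hc1 x) (sq_nonneg (dx a x))
      have e2 := mul_le_mul_of_nonneg_right (hKx x) (sq_nonneg (a x))
      have e4 : 0 ≤ K * ((dy a x + dx b x) ^ 2 + dx a x ^ 2 + dy b x ^ 2 + b x ^ 2) := by positivity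
      have e5 : 0 ≤ (dy a x + dx b x) ^ 2 + dy b x ^ 2 + a x ^ 2 + b x ^ 2 := by positivity
      simp only [hGdef]
      linarith
  have b3 : ∫ x in quarter, dy (fun x => c x * b x) x ^ 2 ≤ (2 + 2 * K) * ∫ x in R, G x := by
    refine hbound _ _ (fun x hx => ?_) fun x => ?_
    · rw [dy_mul hct.1 hb, hcz x hx, hyz x hx]; ring
    · rw [dy_mul hct.1 hb]
      have e : (dy c x * b x + c x * dy b x) ^ 2
          ≤ 2 * (c x ^ 2 * dy b x ^ 2) + 2 * (dy c x ^ 2 * b x ^ 2) := by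
        nlinarith [sq_nonneg (c x * dy b x - dy c x * b x)]
      have e1 := mul_le_mul_of_nonneg_right (hc1 x) (sq_nonneg (dy b x))
      have e2 := mul_le_mul_of_nonneg_right (hKy x) (sq_nonneg (b x))
      have e4 : 0 ≤ K * ((dy a x + dx b x) ^ 2 + dx a x ^ 2 + dy b x ^ 2 + a x ^ 2) := by positivity
      have e5 : 0 ≤ (dy a x + dx b x) ^ 2 + dx a x ^ 2 + a x ^ 2 + b x ^ 2 := by positivity
      simp only [hGdef]
      linarith
  have hsub : Ioo 0 (2 * m / 3) ×ˢ Ioo 0 (2 * n / 3) ⊆ quarter := fun x hx => ⟨hx.1.1, hx.2.1⟩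
  have hG0 : 0 ≤ ∫ x in R, G x := integral_nonneg fun x => by simp only [hGdef]; positivity
  have b0 : ∫ x in Ioo 0 (2 * m / 3) ×ˢ Ioo 0 (2 * n / 3), dy a x ^ 2
      ≤ ∫ x in quarter, dy (fun x => c x * a x) x ^ 2 := by
    have hset : MeasurableSet (Ioo (0 : ℝ) (2 * m / 3) ×ˢ Ioo (0 : ℝ) (2 * n / 3)) :=
      measurableSet_Ioo.prod measurableSet_Ioo
    calc ∫ x in Ioo 0 (2 * m / 3) ×ˢ Ioo 0 (2 * n / 3), dy a x ^ 2
        = ∫ x in Ioo 0 (2 * m / 3) ×ˢ Ioo 0 (2 * n / 3), dy (fun x => c x * a x) x ^ 2 := by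
          refine setIntegral_congr_fun hset fun x hx => ?_
          have hev : (fun x => c x * a x) =ᶠ[𝓝 x] a := by
            filter_upwards [(isOpen_Ioo.prod isOpen_Ioo).mem_nhds hx] with y hy
            have h1 : χ y.1 = 1 := χ.one_of_mem_closedBall (by
              rw [mem_closedBall_zero_iff, Real.norm_of_nonneg hy.1.1.le]; exact hy.1.2.le)
            have h2 : ψ y.2 = 1 := ψ.one_of_mem_closedBall (by
              rw [mem_closedBall_zero_iff, Real.norm_of_nonneg hy.2.1.le]; exact hy.2.2.le)
            simp [hc, cornerCutoff, h1, h2]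
          simp only [dy, hev.fderiv_eq]
      _ ≤ _ := setIntegral_mono_set (hca.dy.memL2 quarter).integrable_sq
          (Eventually.of_forall fun x => sq_nonneg _) hsub.eventuallyLE
  refine b0.trans (hkorn.trans ?_)
  rw [mul_assoc]
  refine mul_le_mul_of_nonneg_left ?_ (by norm_num)
  have hKG : 0 ≤ K * ∫ x in R, G x := mul_nonneg hK0 hG0
  have : kornEnergy R a b = ∫ x in R, G x := rfl
  rw [this]
  linarith

/-- The reflection, for signs `σ, τ`, that maps a corner of a rectangle to the origin. -/
def cornerMap (σ τ m n : ℝ) (x : ℝ × ℝ) : ℝ × ℝ := (σ * (x.1 - m), τ * (x.2 - n))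

theorem measurePreserving_sign_mul {σ : ℝ} (hσ : σ = 1 ∨ σ = -1) (m : ℝ) :
    MeasurePreserving fun t : ℝ => σ * (t - m) := by
  rcases hσ with rfl | rfl
  · simpa using measurePreserving_sub_right (volume : Measure ℝ) m
  · simpa [Function.comp_def] using (Measure.measurePreserving_neg (volume : Measure ℝ)).comp
      (measurePreserving_sub_right (volume : Measure ℝ) m)

theorem measurePreserving_cornerMap {σ τ : ℝ} (hσ : σ = 1 ∨ σ = -1) (hτ : τ = 1 ∨ τ = -1)
    (m n : ℝ) : MeasurePreserving (cornerMap σ τ m n) :=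
  (measurePreserving_sign_mul hσ m).prod (measurePreserving_sign_mul hτ n)

theorem setIntegral_cornerMap {σ τ : ℝ} (hσ : σ = 1 ∨ σ = -1) (hτ : τ = 1 ∨ τ = -1)
    (m n : ℝ) {F : ℝ × ℝ → ℝ} (hF : Continuous F) {A : Set (ℝ × ℝ)} (hA : MeasurableSet A) :
    ∫ x in A, F x = ∫ x in cornerMap σ τ m n ⁻¹' A, F (cornerMap σ τ m n x) := by
  have h := measurePreserving_cornerMap hσ hτ m n
  conv_lhs => rw [← h.map_eq]
  exact setIntegral_map hA hF.aestronglyMeasurable h.measurable.aemeasurable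

theorem contDiff_cornerMap (σ τ m n : ℝ) : ContDiff ℝ ∞ (cornerMap σ τ m n) := by
  unfold cornerMap
  fun_prop

theorem dx_comp_cornerMap {f : ℝ × ℝ → ℝ} (hf : ContDiff ℝ ∞ f) (k σ τ m n : ℝ) (x : ℝ × ℝ) :
    dx (fun x => k * f (cornerMap σ τ m n x)) x = k * (σ * dx f (cornerMap σ τ m n x)) := by
  refine dx_eq_of_hasDerivAt (contDiff_const.mul (hf.comp (contDiff_cornerMap σ τ m n))) ?_
  have h := ((hasDerivAt_fst hf (σ * (x.1 - m)) (τ * (x.2 - n))).comp x.1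
    (((hasDerivAt_id x.1).sub_const m).const_mul σ)).const_mul k
  refine h.congr_deriv ?_
  simp only [cornerMap]
  ring

theorem dy_comp_cornerMap {f : ℝ × ℝ → ℝ} (hf : ContDiff ℝ ∞ f) (k σ τ m n : ℝ) (x : ℝ × ℝ) :
    dy (fun x => k * f (cornerMap σ τ m n x)) x = k * (τ * dy f (cornerMap σ τ m n x)) := by
  refine dy_eq_of_hasDerivAt (contDiff_const.mul (hf.comp (contDiff_cornerMap σ τ m n))) ?_
  have h := ((hasDerivAt_snd hf (σ * (x.1 - m)) (τ * (x.2 - n))).comp x.2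
    (((hasDerivAt_id x.2).sub_const n).const_mul τ)).const_mul k
  refine h.congr_deriv ?_
  simp only [cornerMap]
  ring

theorem sign_mul_sub_mem_interval {σ : ℝ} (hσ : σ = 1 ∨ σ = -1) (l t : ℝ) :
    σ * (t - l / 2) ∈ interval l ↔ t ∈ Ioo 0 l := by
  rcases hσ with rfl | rfl <;> simp only [interval, mem_Ioo] <;> constructor <;>
    rintro ⟨h1, h2⟩ <;> constructor <;> linarith

theorem cornerMap_preimage_rect {σ τ : ℝ} (hσ : σ = 1 ∨ σ = -1) (hτ : τ = 1 ∨ τ = -1) (l : ℝ) :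
    cornerMap σ τ (l / 2) (1 / 2) ⁻¹' rect l 1 = Ioo 0 l ×ˢ Ioo 0 1 := by
  ext x
  exact and_congr (sign_mul_sub_mem_interval hσ l x.1) (sign_mul_sub_mem_interval hτ 1 x.2)

/-- The part of the rectangle that lies next to one of its corners. -/
def cornerRect (l σ τ : ℝ) : Set (ℝ × ℝ) :=
  {x | σ * x.1 + l / 2 ∈ Ioo 0 (2 * l / 3)} ∩ {x | τ * x.2 + 1 / 2 ∈ Ioo 0 (2 * (1 : ℝ) / 3)}

theorem measurableSet_cornerRect (l σ τ : ℝ) : MeasurableSet (cornerRect l σ τ) :=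
  (measurableSet_Ioo.preimage (by fun_prop)).inter (measurableSet_Ioo.preimage (by fun_prop))

/-- Move the corner to the origin by a reflection and multiply the components of the displacement by
the matching signs: diagonal strains are then preserved, and the shear strain only changes by the
factor στ, invisible in the squares. -/
theorem korn_cornerRect {l : ℝ} (hl : 0 < l) :
    ∃ C, 0 ≤ C ∧ ∀ σ τ : ℝ, (σ = 1 ∨ σ = -1) → (τ = 1 ∨ τ = -1) →
      ∀ a b : ℝ × ℝ → ℝ, ContDiff ℝ ∞ a → ContDiff ℝ ∞ b →
      ∫ x in cornerRect l σ τ, dy a x ^ 2 ≤ C * kornEnergy (rect l 1) a b := by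
  obtain ⟨C, hC, h⟩ := korn_corner hl one_pos
  refine ⟨C, hC, fun σ τ hσ hτ a b ha hb => ?_⟩
  have hσ2 : σ ^ 2 = 1 := by rcases hσ with rfl | rfl <;> norm_num
  have hτ2 : τ ^ 2 = 1 := by rcases hτ with rfl | rfl <;> norm_num
  have h1 := h (fun x => σ * a (cornerMap σ τ (l / 2) (1 / 2) x))
    (fun x => τ * b (cornerMap σ τ (l / 2) (1 / 2) x))
    (contDiff_const.mul (ha.comp (contDiff_cornerMap _ _ _ _)))
    (contDiff_const.mul (hb.comp (contDiff_cornerMap _ _ _ _)))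
  have hdy2 : Continuous fun x => dy a x ^ 2 := (contDiff_dy ha).continuous.pow 2
  rw [setIntegral_cornerMap hσ hτ (l / 2) (1 / 2) hdy2
    (measurableSet_cornerRect l σ τ), kornEnergy, setIntegral_cornerMap hσ hτ (l / 2) (1 / 2)
    (continuous_kornIntegrand ha hb) (isStarDomain_rect hl one_pos).isOpen.measurableSet,
    cornerMap_preimage_rect hσ hτ]
  have hpre : cornerMap σ τ (l / 2) (1 / 2) ⁻¹' cornerRect l σ τ
      = Ioo 0 (2 * l / 3) ×ˢ Ioo 0 (2 * 1 / 3) := by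
    ext x
    have e1 : σ * (σ * (x.1 - l / 2)) + l / 2 = x.1 := by linear_combination (x.1 - l / 2) * hσ2
    have e2 : τ * (τ * (x.2 - 1 / 2)) + 1 / 2 = x.2 := by linear_combination (x.2 - 1 / 2) * hτ2
    simp only [cornerRect, cornerMap, mem_preimage, mem_inter_iff, mem_ofPred_eq, e1, e2, mem_prod]
  rw [hpre]
  unfold kornEnergy at h1
  simp only [dx_comp_cornerMap ha, dx_comp_cornerMap hb, dy_comp_cornerMap ha,
    dy_comp_cornerMap hb] at h1
  refine le_trans (le_of_eq ?_) (h1.trans (le_of_eq ?_))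
  · congr 1; funext x
    simp only [mul_pow, hσ2, hτ2, one_mul]
  · congr 2; funext x
    have e3 : σ * (τ * dy a (cornerMap σ τ (l / 2) (1 / 2) x))
        + τ * (σ * dx b (cornerMap σ τ (l / 2) (1 / 2) x))
        = σ * τ * (dy a (cornerMap σ τ (l / 2) (1 / 2) x)
          + dx b (cornerMap σ τ (l / 2) (1 / 2) x)) := by ring
    rw [e3]
    simp only [mul_pow, hσ2, hτ2, one_mul]

theorem integral_union_le {A B : Set (ℝ × ℝ)} {F : ℝ × ℝ → ℝ} (hF : ∀ x, 0 ≤ F x)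
    (hA : IntegrableOn F A) (hB : IntegrableOn F B) :
    ∫ x in A ∪ B, F x ≤ (∫ x in A, F x) + ∫ x in B, F x := by
  rw [← integral_add_measure hA hB]
  exact integral_mono_measure (Measure.restrict_union_le A B)
    (Eventually.of_forall hF) (Integrable.add_measure hA hB)

/-- The four corner pieces cover the rectangle, since in each coordinate the intervals overlap in
the middle third. Sum the four corner estimates. -/
theorem korn_rect_of_contDiff {l : ℝ} (hl : 0 < l) :
    ∃ C, 0 ≤ C ∧ ∀ a b : ℝ × ℝ → ℝ, ContDiff ℝ ∞ a → ContDiff ℝ ∞ b →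
      ∫ x in rect l 1, dy a x ^ 2 ≤ C * kornEnergy (rect l 1) a b := by
  obtain ⟨C, hC, h⟩ := korn_cornerRect hl
  refine ⟨4 * C, by positivity, fun a b ha hb => ?_⟩
  have hcont : Continuous fun x => dy a x ^ 2 := (contDiff_dy ha).continuous.pow 2
  have hint : ∀ A : Set (ℝ × ℝ), IntegrableOn (fun x => dy a x ^ 2) (A ∩ rect l 1) := fun A =>
    IntegrableOn.mono_set ((isStarDomain_rect hl one_pos).memL2_of_continuous
      (contDiff_dy ha).continuous).integrable_sq inter_subset_right
  have hle : ∀ σ τ : ℝ, (σ = 1 ∨ σ = -1) → (τ = 1 ∨ τ = -1) →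
      ∫ x in cornerRect l σ τ ∩ rect l 1, dy a x ^ 2 ≤ C * kornEnergy (rect l 1) a b := by
    intro σ τ hσ hτ
    refine le_trans (setIntegral_mono_set ?_ (Eventually.of_forall fun x => sq_nonneg _)
      inter_subset_left.eventuallyLE) (h σ τ hσ hτ a b ha hb)
    refine (hcont.continuousOn.integrableOn_compact
      ((isCompact_Icc (a := -l) (b := l)).prod (isCompact_Icc (a := (-1 : ℝ)) (b := 1)))).mono_set ?_
    rintro x ⟨hx1, hx2⟩
    simp only [mem_ofPred_eq, mem_Ioo] at hx1 hx2
    rcases hσ with rfl | rfl <;> rcases hτ with rfl | rfl <;>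
      exact ⟨⟨by linarith, by linarith⟩, ⟨by linarith, by linarith⟩⟩
  have hcover : rect l 1 = ((cornerRect l 1 1 ∩ rect l 1) ∪ (cornerRect l 1 (-1) ∩ rect l 1)) ∪
      ((cornerRect l (-1) 1 ∩ rect l 1) ∪ (cornerRect l (-1) (-1) ∩ rect l 1)) := by
    refine subset_antisymm (fun x hx => ?_) (by
      simp only [union_subset_iff, inter_subset_right, and_self])
    have hx1 := hx.1
    have hx2 := hx.2
    simp only [interval, mem_Ioo] at hx1 hx2
    have h1 : x.1 < l / 6 ∨ -(l / 6) < x.1 := by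
      by_contra hcon
      push Not at hcon
      linarith [hcon.1, hcon.2]
    have h2 : x.2 < 1 / 6 ∨ -(1 / 6) < x.2 := by
      by_contra hcon
      push Not at hcon
      linarith [hcon.1, hcon.2]
    simp only [mem_union, mem_inter_iff, hx, and_true, cornerRect, mem_ofPred_eq, mem_Ioo]
    rcases h1 with h1 | h1 <;> rcases h2 with h2 | h2
    · exact Or.inl (Or.inl ⟨⟨by linarith, by linarith⟩, ⟨by linarith, by linarith⟩⟩)
    · exact Or.inl (Or.inr ⟨⟨by linarith, by linarith⟩, ⟨by linarith, by linarith⟩⟩)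
    · exact Or.inr (Or.inl ⟨⟨by linarith, by linarith⟩, ⟨by linarith, by linarith⟩⟩)
    · exact Or.inr (Or.inr ⟨⟨by linarith, by linarith⟩, ⟨by linarith, by linarith⟩⟩)
  rw [show (∫ x in rect l 1, dy a x ^ 2) = ∫ x in ((cornerRect l 1 1 ∩ rect l 1) ∪
      (cornerRect l 1 (-1) ∩ rect l 1)) ∪
      ((cornerRect l (-1) 1 ∩ rect l 1) ∪ (cornerRect l (-1) (-1) ∩ rect l 1)), dy a x ^ 2 by
    rw [← hcover]]
  have hn : ∀ x, 0 ≤ dy a x ^ 2 := fun x => sq_nonneg _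
  have u0 := integral_union_le hn ((hint (cornerRect l 1 1)).union (hint (cornerRect l 1 (-1))))
    ((hint (cornerRect l (-1) 1)).union (hint (cornerRect l (-1) (-1))))
  have u1 := integral_union_le hn (hint (cornerRect l 1 1)) (hint (cornerRect l 1 (-1)))
  have u2 := integral_union_le hn (hint (cornerRect l (-1) 1)) (hint (cornerRect l (-1) (-1)))
  have v1 := hle 1 1 (Or.inl rfl) (Or.inl rfl)
  have v2 := hle 1 (-1) (Or.inl rfl) (Or.inr rfl)
  have v3 := hle (-1) 1 (Or.inr rfl) (Or.inl rfl)
  have v4 := hle (-1) (-1) (Or.inr rfl) (Or.inr rfl)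
  linarith

/-- Korn's second inequality on a rectangle. -/
theorem korn_rect {l : ℝ} (hl : 0 < l) :
    ∃ C, 0 ≤ C ∧ ∀ a b : ℝ × ℝ → ℝ, MemW12 (rect l 1) a → MemW12 (rect l 1) b →
      ∫ x in rect l 1, pd (rect l 1) 1 a x ^ 2 ≤ C *
        ((∫ x in rect l 1, (pd (rect l 1) 1 a x + pd (rect l 1) 0 b x) ^ 2)
          + (∫ x in rect l 1, pd (rect l 1) 0 a x ^ 2) + (∫ x in rect l 1, pd (rect l 1) 1 b x ^ 2)
          + (∫ x in rect l 1, a x ^ 2) + ∫ x in rect l 1, b x ^ 2) := by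
  obtain ⟨C, hC, h⟩ := korn_rect_of_contDiff hl
  have hS := isStarDomain_rect hl one_pos
  refine ⟨C, hC, fun a b ha hb => ?_⟩
  obtain ⟨φ, hφ, hφa, hφd⟩ := hS.exists_smooth_approx ha
  obtain ⟨ψ, hψ, hψb, hψd⟩ := hS.exists_smooth_approx hb
  refine le_of_tendsto_of_tendsto' (hφd (0, 1)).tendsto_sq
    (((((((hφd (0, 1)).add (hψd (1, 0))).tendsto_sq.add (hφd (1, 0)).tendsto_sq).add
      (hψd (0, 1)).tendsto_sq).add hφa.tendsto_sq).add hψb.tendsto_sq).const_mul C) fun k => ?_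
  refine (h (φ k) (ψ k) (hφ k) (hψ k)).trans (le_of_eq ?_)
  have hm : ∀ {f : ℝ × ℝ → ℝ}, ContDiff ℝ ∞ f → IntegrableOn (fun x => f x ^ 2) (rect l 1) :=
    fun hf => (hS.memL2_of_continuous hf.continuous).integrable_sq
  have i1 : IntegrableOn (fun x => (dy (φ k) x + dx (ψ k) x) ^ 2) (rect l 1) :=
    hm ((contDiff_dy (hφ k)).add (contDiff_dx (hψ k)))
  have i2 : IntegrableOn (fun x => (dy (φ k) x + dx (ψ k) x) ^ 2 + dx (φ k) x ^ 2) (rect l 1) :=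
    i1.add (hm (contDiff_dx (hφ k)))
  have i3 : IntegrableOn (fun x => (dy (φ k) x + dx (ψ k) x) ^ 2 + dx (φ k) x ^ 2
      + dy (ψ k) x ^ 2) (rect l 1) := i2.add (hm (contDiff_dy (hψ k)))
  have i4 : IntegrableOn (fun x => (dy (φ k) x + dx (ψ k) x) ^ 2 + dx (φ k) x ^ 2
      + dy (ψ k) x ^ 2 + φ k x ^ 2) (rect l 1) := i3.add (hm (hφ k))
  unfold kornEnergy
  rw [integral_add i4 (hm (hψ k)), integral_add i3 (hm (hφ k)),
    integral_add i2 (hm (contDiff_dy (hψ k))), integral_add i1 (hm (contDiff_dx (hφ k)))]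
  rfl

end KornRectangle

/-! ### Change of variables to the fixed domain -/

section Scaling

/-- The anisotropic scaling `x ↦ (x₁, ε x₂)`. -/
def scaleEquiv (ε : ℝ) (hε : 0 < ε) : (ℝ × ℝ) ≃L[ℝ] (ℝ × ℝ) :=
  ContinuousLinearEquiv.equivOfInverse
    ((ContinuousLinearMap.fst ℝ ℝ ℝ).prod (ε • ContinuousLinearMap.snd ℝ ℝ ℝ))
    ((ContinuousLinearMap.fst ℝ ℝ ℝ).prod (ε⁻¹ • ContinuousLinearMap.snd ℝ ℝ ℝ))
    (fun x => by ext <;> simp [hε.ne']) (fun x => by ext <;> simp [hε.ne'])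

variable {l ε : ℝ} (hε : 0 < ε)

theorem scaleEquiv_apply (x : ℝ × ℝ) : scaleEquiv ε hε x = (x.1, ε * x.2) := rfl

theorem scaleEquiv_preimage_rect : scaleEquiv ε hε ⁻¹' rect l ε = rect l 1 := by
  ext x
  refine and_congr Iff.rfl ?_
  simp only [interval, mem_Ioo, scaleEquiv_apply]
  have e1 : -ε / 2 < ε * x.2 ↔ -1 / 2 < x.2 := by
    rw [show -ε / 2 = ε * (-1 / 2) by ring, mul_lt_mul_iff_right₀ hε]
  have e2 : ε * x.2 < ε / 2 ↔ x.2 < 1 / 2 := by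
    rw [show ε / 2 = ε * (1 / 2) by ring, mul_lt_mul_iff_right₀ hε]
  rw [e1, e2]

theorem map_scaleEquiv_volume :
    Measure.map (scaleEquiv ε hε) volume = ENNReal.ofReal ε⁻¹ • (volume : Measure (ℝ × ℝ)) := by
  have h : (scaleEquiv ε hε : ℝ × ℝ → ℝ × ℝ) = Prod.map id (ε * ·) := rfl
  rw [h, Measure.volume_eq_prod, ← Measure.map_prod_map volume volume measurable_id
    (measurable_const_mul ε), Measure.map_id, Real.map_volume_mul_left hε.ne',
    Measure.prod_smul_right, abs_of_pos (inv_pos.2 hε)]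

theorem measurableEmbedding_scaleEquiv : MeasurableEmbedding (scaleEquiv ε hε) :=
  (scaleEquiv ε hε).toHomeomorph.measurableEmbedding

theorem map_scaleEquiv_restrict :
    Measure.map (scaleEquiv ε hε) (volume.restrict (rect l 1))
      = ENNReal.ofReal ε⁻¹ • volume.restrict (rect l ε) := by
  rw [← scaleEquiv_preimage_rect hε, ← (measurableEmbedding_scaleEquiv hε).restrict_map,
    map_scaleEquiv_volume, Measure.restrict_smul]

theorem integral_scale (F : ℝ × ℝ → ℝ) :
    ∫ x in rect l 1, F (scaleEquiv ε hε x) = 1 / ε * ∫ x in rect l ε, F x := by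
  rw [← (measurableEmbedding_scaleEquiv hε).integral_map, map_scaleEquiv_restrict,
    integral_smul_measure, ENNReal.toReal_ofReal (inv_pos.2 hε).le, smul_eq_mul, one_div]

theorem MemL2.scale {f : ℝ × ℝ → ℝ} (h : MemL2 (rect l ε) f) :
    MemL2 (rect l 1) (fun x => f (scaleEquiv ε hε x)) := by
  refine ((measurableEmbedding_scaleEquiv hε).memLp_map_measure_iff (g := f)).1 ?_
  rw [map_scaleEquiv_restrict]
  exact MemLp.smul_measure h ENNReal.ofReal_ne_top

/-- Test functions are transported by φ ↦ φ ∘ A⁻¹; the derivative in direction e on S corresponds to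
direction Ae on the thin rectangle, and the Jacobian is the same on both sides. -/
theorem HasWeakDeriv.scale (hl : 0 < l) {e : ℝ × ℝ} {f g : ℝ × ℝ → ℝ} (hf : MemL2 (rect l ε) f)
    (hg : MemL2 (rect l ε) g) (h : HasWeakDeriv (rect l ε) (scaleEquiv ε hε e) f g) :
    HasWeakDeriv (rect l 1) e (fun x => f (scaleEquiv ε hε x))
      (fun x => g (scaleEquiv ε hε x)) := by
  have hv := (isStarDomain_rect hl one_pos).volume_ne_top
  refine ⟨(hf.scale hε).locallyIntegrableOn hv, (hg.scale hε).locallyIntegrableOn hv,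
    fun φ hφ hc ht => ?_⟩
  set A := scaleEquiv ε hε with hA
  have hφA : ContDiff ℝ ∞ fun x => φ (A.symm x) := hφ.comp A.symm.contDiff
  have hcA : HasCompactSupport fun x => φ (A.symm x) := hc.comp_homeomorph A.symm.toHomeomorph
  have htA : tsupport (fun x => φ (A.symm x)) ⊆ rect l ε := by
    have h1 : tsupport (fun x => φ (A.symm x)) ⊆ A.symm ⁻¹' tsupport φ :=
      tsupport_comp_subset_preimage φ A.symm.continuous
    intro x hx
    have h2 := ht (h1 hx)
    rw [← scaleEquiv_preimage_rect hε] at h2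
    simpa [hA] using h2
  have h0 := h.2.2 _ hφA hcA htA
  have hd : ∀ x, fderiv ℝ (fun x => φ (A.symm x)) (A x) (A e) = fderiv ℝ φ x e := by
    intro x
    have h1 : HasFDerivAt φ (fderiv ℝ φ x) (A.symm (A x)) := by
      rw [A.symm_apply_apply]
      exact ((hφ.differentiable (by simp)) x).hasFDerivAt
    have h2 := h1.comp (A x) A.symm.hasFDerivAt
    have h3 := DFunLike.congr_fun h2.fderiv (A e)
    simpa [Function.comp_def] using h3
  have e1 := integral_scale (l := l) hε fun x => f x * fderiv ℝ (fun x => φ (A.symm x)) x (A e)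
  have e2 := integral_scale (l := l) hε fun x => g x * φ (A.symm x)
  simp only [← hA, hd, A.symm_apply_apply] at e1 e2
  rw [e1, e2, h0]
  ring

/-- The unit coordinate vectors of the plane. -/
abbrev dir (i : Fin 2) : ℝ × ℝ := ![((1 : ℝ), (0 : ℝ)), (0, 1)] i

/-- The factors by which the scaling acts on partial derivatives. -/
def scaleFactor (ε : ℝ) (i : Fin 2) : ℝ := ![1, ε] i

theorem scaleEquiv_dir (i : Fin 2) : scaleEquiv ε hε (dir i) = scaleFactor ε i • dir i := by
  fin_cases i <;> simp [dir, scaleFactor, scaleEquiv_apply]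

theorem hasWeakDeriv_scale (hl : 0 < l) {f : ℝ × ℝ → ℝ} (hf : MemW12 (rect l ε) f) (i : Fin 2) :
    HasWeakDeriv (rect l 1) (dir i) (fun x => f (scaleEquiv ε hε x))
      (fun x => scaleFactor ε i * pd (rect l ε) i f (scaleEquiv ε hε x)) := by
  have hΩ := (isStarDomain_rect hl hε).isOpen
  have h := (hf.hasWeakDeriv (dir i)).smul_dir (scaleFactor ε i)
  rw [← scaleEquiv_dir hε] at h
  exact HasWeakDeriv.scale hε hl hf.1 ((hf.memL2_weakDeriv hΩ (dir i)).const_mul _) h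

theorem pd_scale (hl : 0 < l) {f : ℝ × ℝ → ℝ} (hf : MemW12 (rect l ε) f) (i : Fin 2) (c : ℝ) :
    pd (rect l 1) i (fun x => c * f (scaleEquiv ε hε x)) =ᵐ[volume.restrict (rect l 1)]
      fun x => c * (scaleFactor ε i * pd (rect l ε) i f (scaleEquiv ε hε x)) :=
  (((hasWeakDeriv_scale hε hl hf i).const_mul c).ae_eq_weakDeriv
    (isStarDomain_rect hl one_pos).isOpen).symm

/-- Needed for second derivatives: the inner `weakDeriv` is known only almost everywhere, and
`weakDeriv` of two a.e. equal functions may be different representatives. -/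
theorem weakDeriv_congr_ae {Ω : Set (ℝ × ℝ)} (hΩ : IsStarDomain Ω) {f f' : ℝ × ℝ → ℝ}
    (h : f =ᵐ[volume.restrict Ω] f') (hf : MemW12 Ω f) (e : ℝ × ℝ) :
    weakDeriv Ω e f =ᵐ[volume.restrict Ω] weakDeriv Ω e f' := by
  have h1 := (hf.hasWeakDeriv e).congr h (ae_eq_refl _)
    ((hf.1.congr h).locallyIntegrableOn hΩ.volume_ne_top) (hf.hasWeakDeriv e).2.1
  exact h1.ae_eq_weakDeriv hΩ.isOpen

theorem pd_scaledV (hl : 0 < l) {v : ℝ × ℝ → ℝ} (hv : MemW12 (rect l ε) v) (i : Fin 2) :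
    pd (rect l 1) i (scaledV ε v) =ᵐ[volume.restrict (rect l 1)]
      fun x => scaleFactor ε i * pd (rect l ε) i v (scaleEquiv ε hε x) := by
  have h := pd_scale hε hl hv i 1
  simp only [one_mul] at h
  exact h

theorem pd_pd_scale (hl : 0 < l) {v : ℝ × ℝ → ℝ} (hv : MemW22 (rect l ε) v)
    (hw : MemW22 (rect l 1) (scaledV ε v)) (i j : Fin 2) :
    pd (rect l 1) i (pd (rect l 1) j (scaledV ε v)) =ᵐ[volume.restrict (rect l 1)]
      fun x => scaleFactor ε j * (scaleFactor ε i *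
        pd (rect l ε) i (pd (rect l ε) j v) (scaleEquiv ε hε x)) := by
  have hS := isStarDomain_rect hl one_pos
  exact (weakDeriv_congr_ae hS (pd_scaledV hε hl hv.1 j) (hw.2 (dir j)) (dir i)).trans
    (pd_scale hε hl (hv.2 (dir j)) i (scaleFactor ε j))

theorem strain_scale (hl : 0 < l) {u : Fin 2 → ℝ × ℝ → ℝ} (hu : ∀ i, MemW12 (rect l ε) (u i)) :
    ∀ᵐ x ∂volume.restrict (rect l 1), strain (rect l ε) u (scaleEquiv ε hε x)
      = scaledStrain l ε (scaledU ε u) x := by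
  have h0 := fun i => pd_scale hε hl (hu 0) i 1
  have h1 := fun i => pd_scale hε hl (hu 1) i ε
  have hy0 : scaledU ε u 0 = fun x => 1 * u 0 (scaleEquiv ε hε x) := by
    funext x; simp [scaledU, scaleEquiv_apply]
  have hy1 : scaledU ε u 1 = fun x => ε * u 1 (scaleEquiv ε hε x) := by
    funext x; simp [scaledU, scaleEquiv_apply]
  filter_upwards [h0 0, h0 1, h1 0, h1 1] with x a0 a1 b0 b1
  ext i j
  simp only [scaledStrain, hy0, hy1, a0, a1, b0, b1]
  fin_cases i <;> fin_cases j <;> simp [strain, scaleFactor] <;> field_simp <;> ring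

theorem scaledGrad_scale (hl : 0 < l) {v : ℝ × ℝ → ℝ} (hv : MemW12 (rect l ε) v) :
    ∀ᵐ x ∂volume.restrict (rect l 1), ∀ i,
      pd (rect l ε) i v (scaleEquiv ε hε x) = scaledGrad l ε (scaledV ε v) i x := by
  filter_upwards [pd_scaledV hε hl hv 0, pd_scaledV hε hl hv 1] with x a0 a1 i
  fin_cases i <;> simp [scaledGrad, a0, a1, scaleFactor, hε.ne']

theorem scaledHessian_scale (hl : 0 < l) {v : ℝ × ℝ → ℝ} (hv : MemW22 (rect l ε) v)
    (hw : MemW22 (rect l 1) (scaledV ε v)) :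
    ∀ᵐ x ∂volume.restrict (rect l 1),
      hessian (rect l ε) v (scaleEquiv ε hε x) = scaledHessian l ε (scaledV ε v) x := by
  have h := pd_pd_scale hε hl hv hw
  filter_upwards [h 0 0, h 0 1, h 1 0, h 1 1] with x a0 a1 a2 a3
  ext i j
  fin_cases i <;> fin_cases j <;>
    simp [scaledHessian, hessian, a0, a1, a2, a3, scaleFactor] <;> field_simp

/-- The Kármán strain `E^ε y + ½ ∇_ε w ⊗ ∇_ε w` on the rescaled domain. -/
def karmanStrain (l ε : ℝ) (u : Fin 2 → ℝ × ℝ → ℝ) (v : ℝ × ℝ → ℝ) (x : ℝ × ℝ) :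
    Matrix (Fin 2) (Fin 2) ℝ :=
  scaledStrain l ε (scaledU ε u) x + (1 / 2 : ℝ) • Matrix.of fun i j =>
    scaledGrad l ε (scaledV ε v) i x * scaledGrad l ε (scaledV ε v) j x

/-- The prefactor 1/ε is the Jacobian of the scaling. In the last force term the factor ε of the
scaled second component is compensated by 1/ε on the force, which is the combination assumed to
converge. -/
theorem energy2D_eq (hε : 0 < ε) (hl : 0 < l) (Q : QuadraticForm ℝ (Matrix (Fin 2) (Fin 2) ℝ))
    (f : ℝ × ℝ → ℝ) (g u : Fin 2 → ℝ × ℝ → ℝ) {v : ℝ × ℝ → ℝ}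
    (hu : ∀ i, MemW12 (rect l ε) (u i)) (hv : MemW22 (rect l ε) v)
    (hw : MemW22 (rect l 1) (scaledV ε v)) :
    energy2D Q l ε f g u v
      = 1 / 2 * (∫ x in rect l 1, Q (karmanStrain l ε u v x))
        + 1 / 24 * (∫ x in rect l 1, Q (scaledHessian l ε (scaledV ε v) x))
        - ∫ x in rect l 1, (f (x.1, ε * x.2) * scaledV ε v x
          + g 0 (x.1, ε * x.2) * scaledU ε u 0 x
          + 1 / ε * g 1 (x.1, ε * x.2) * scaledU ε u 1 x) := by
  unfold energy2D
  simp only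
  rw [← integral_scale hε, ← integral_scale hε, ← integral_scale hε, ← integral_const_mul,
    ← integral_const_mul]
  congr 1
  · congr 1
    · refine integral_congr_ae ?_
      filter_upwards [strain_scale hε hl hu, scaledGrad_scale hε hl hv.1] with x h1 h2
      rw [h1, karmanStrain]
      congr 3
      congr 1
      ext i j
      simp [gradTensor, h2]
    · refine integral_congr_ae ?_
      filter_upwards [scaledHessian_scale hε hl hv hw] with x h1
      rw [h1]
  · congr 1; funext x
    simp only [Fin.sum_univ_two, scaleEquiv_apply, scaledV, scaledU, Matrix.cons_val_zero,
      Matrix.cons_val_one]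
    field_simp
    ring

end Scaling

/-! ### The quadratic form and its reductions -/

section QuadraticForms

variable {Q : QuadraticForm ℝ (Matrix (Fin 2) (Fin 2) ℝ)}

/-- Writes the bilinear form in matrix entries, so that integrability and weak convergence reduce to
products of scalar functions. -/
theorem polar_eq_sum (Q : QuadraticForm ℝ (Matrix (Fin 2) (Fin 2) ℝ))
    (A B : Matrix (Fin 2) (Fin 2) ℝ) :
    QuadraticMap.polar Q A B = ∑ k, ∑ m, ∑ i, ∑ j, QuadraticMap.polar Q (Matrix.single k m 1)
      (Matrix.single i j 1) * (A k m * B i j) := by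
  have hA : A = ∑ k, ∑ m, A k m • Matrix.single k m (1 : ℝ) := by
    conv_lhs => rw [Matrix.matrix_eq_sum_single A]
    simp
  have hB : B = ∑ k, ∑ m, B k m • Matrix.single k m (1 : ℝ) := by
    conv_lhs => rw [Matrix.matrix_eq_sum_single B]
    simp
  rw [← QuadraticMap.polarBilin_apply_apply]
  conv_lhs => rw [hA, hB]
  simp only [map_sum, map_smul, LinearMap.sum_apply, LinearMap.smul_apply]
  simp only [smul_eq_mul, QuadraticMap.polarBilin_apply_apply, Fin.sum_univ_two]
  ring

theorem two_mul_quadraticForm (Q : QuadraticForm ℝ (Matrix (Fin 2) (Fin 2) ℝ))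
    (A : Matrix (Fin 2) (Fin 2) ℝ) : 2 * Q A = QuadraticMap.polar Q A A := by
  rw [QuadraticMap.polar_self]
  simp

theorem nonneg_of_isSymm (hQ : ∀ A : Matrix (Fin 2) (Fin 2) ℝ, A.IsSymm → A ≠ 0 → 0 < Q A)
    {A : Matrix (Fin 2) (Fin 2) ℝ} (hA : A.IsSymm) : 0 ≤ Q A := by
  by_cases h : A = 0
  · simp [h]
  · exact (hQ A hA h).le

theorem isSymm_of (a b c : ℝ) : (!![a, b; b, c] : Matrix (Fin 2) (Fin 2) ℝ).IsSymm := by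
  ext i j
  fin_cases i <;> fin_cases j <;> rfl

theorem isSymm_iff_eq {A : Matrix (Fin 2) (Fin 2) ℝ} :
    A.IsSymm ↔ A = !![A 0 0, A 0 1; A 0 1, A 1 1] := by
  constructor
  · intro h
    have h1 := h.apply 0 1
    ext i j
    fin_cases i <;> fin_cases j <;> simp [h1]
  · intro h
    rw [h]
    exact isSymm_of _ _ _

/-- Symmetric matrices are parametrized by ℝ³; κ is the minimum of Q on the unit sphere there,
extended by homogeneity. -/
theorem exists_coercive (hQ : ∀ A : Matrix (Fin 2) (Fin 2) ℝ, A.IsSymm → A ≠ 0 → 0 < Q A) :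
    ∃ κ > 0, ∀ A : Matrix (Fin 2) (Fin 2) ℝ, A.IsSymm → ∀ i j, κ * A i j ^ 2 ≤ Q A := by
  let M : ℝ × ℝ × ℝ → Matrix (Fin 2) (Fin 2) ℝ := fun p => !![p.1, p.2.1; p.2.1, p.2.2]
  have hc : Continuous fun p => Q (M p) := by
    have h : ∀ p, Q (M p) = 1 / 2 * ∑ k, ∑ m, ∑ i, ∑ j, QuadraticMap.polar Q
        (Matrix.single k m 1) (Matrix.single i j 1) * (M p k m * M p i j) := fun p => by
      rw [← polar_eq_sum, ← two_mul_quadraticForm]; ring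
    simp only [h, Fin.sum_univ_two, M]
    simp only [Matrix.of_apply, Matrix.cons_val_zero, Matrix.cons_val_one, Matrix.cons_val',
      Matrix.cons_val_fin_one]
    fun_prop
  have hpos : ∀ p, p ≠ 0 → 0 < Q (M p) := by
    intro p hp
    refine hQ _ (isSymm_of _ _ _) fun h0 => hp ?_
    have a := congrFun (congrFun h0 0) 0
    have b := congrFun (congrFun h0 0) 1
    have c := congrFun (congrFun h0 1) 1
    simp only [M, Matrix.of_apply, Matrix.cons_val_zero, Matrix.cons_val_one, Matrix.cons_val',
      Matrix.cons_val_fin_one, Matrix.zero_apply] at a b c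
    ext <;> simp [a, b, c]
  obtain ⟨p₀, hp₀, hmin⟩ := (isCompact_sphere (0 : ℝ × ℝ × ℝ) 1).exists_isMinOn
    (NormedSpace.sphere_nonempty.2 zero_le_one) hc.continuousOn
  have hκ : 0 < Q (M p₀) := hpos p₀ fun h => by simp [h] at hp₀
  refine ⟨Q (M p₀), hκ, fun A hA i j => ?_⟩
  set p : ℝ × ℝ × ℝ := (A 0 0, A 0 1, A 1 1) with hp
  have hAM : A = M p := isSymm_iff_eq.1 hA
  have hle : |A i j| ≤ ‖p‖ := by
    have h1 : |A 0 0| ≤ ‖p‖ := norm_fst_le p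
    have h2 : |A 0 1| ≤ ‖p‖ := (norm_fst_le p.2).trans (norm_snd_le p)
    have h3 : |A 1 1| ≤ ‖p‖ := (norm_snd_le p.2).trans (norm_snd_le p)
    have h4 : |A 1 0| ≤ ‖p‖ := by rwa [hA.apply 0 1]
    fin_cases i <;> fin_cases j <;> assumption
  have hkey : Q (M p₀) * ‖p‖ ^ 2 ≤ Q A := by
    by_cases h0 : p = 0
    · rw [hAM, h0]
      have : M 0 = 0 := by ext i j; fin_cases i <;> fin_cases j <;> simp [M]
      simp [this]
    · have hn : 0 < ‖p‖ := norm_pos_iff.2 h0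
      have hs : ‖p‖⁻¹ • p ∈ Metric.sphere (0 : ℝ × ℝ × ℝ) 1 := by
        simp [norm_smul, hn.ne']
      have h1 : Q (M p₀) ≤ Q (M (‖p‖⁻¹ • p)) := hmin hs
      have h2 : M (‖p‖⁻¹ • p) = ‖p‖⁻¹ • M p := by
        ext i j; fin_cases i <;> fin_cases j <;> simp [M]
      rw [h2, QuadraticMap.map_smul, ← hAM, smul_eq_mul] at h1
      calc Q (M p₀) * ‖p‖ ^ 2 ≤ ‖p‖⁻¹ * ‖p‖⁻¹ * Q A * ‖p‖ ^ 2 := by gcongr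
        _ = Q A := by field_simp
  refine le_trans ?_ hkey
  have : A i j ^ 2 ≤ ‖p‖ ^ 2 := by
    rw [← sq_abs]; gcongr
  gcongr

/-- The infimum in `reducedQ₁` is a lower bound only if the range is bounded below, which positivity
on symmetric matrices ensures. That it is attained is never needed. -/
theorem bddBelow_reducedQ₁
    (hQ : ∀ A : Matrix (Fin 2) (Fin 2) ℝ, A.IsSymm → A ≠ 0 → 0 < Q A)
    (a b : ℝ) : BddBelow (Set.range fun c => Q !![a, b; b, c]) :=
  ⟨0, by rintro _ ⟨c, rfl⟩; exact nonneg_of_isSymm hQ (isSymm_of _ _ _)⟩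

theorem reducedQ₁_le
    (hQ : ∀ A : Matrix (Fin 2) (Fin 2) ℝ, A.IsSymm → A ≠ 0 → 0 < Q A)
    (a b c : ℝ) : reducedQ₁ Q a b ≤ Q !![a, b; b, c] :=
  ciInf_le (bddBelow_reducedQ₁ hQ a b) c

theorem reducedQ₁_nonneg
    (hQ : ∀ A : Matrix (Fin 2) (Fin 2) ℝ, A.IsSymm → A ≠ 0 → 0 < Q A)
    (a b : ℝ) : 0 ≤ reducedQ₁ Q a b :=
  Real.iInf_nonneg fun _ => nonneg_of_isSymm hQ (isSymm_of _ _ _)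

theorem reducedQ₀_nonneg
    (hQ : ∀ A : Matrix (Fin 2) (Fin 2) ℝ, A.IsSymm → A ≠ 0 → 0 < Q A)
    (a : ℝ) : 0 ≤ reducedQ₀ Q a :=
  Real.iInf_nonneg fun _ => reducedQ₁_nonneg hQ _ _

theorem reducedQ₀_le
    (hQ : ∀ A : Matrix (Fin 2) (Fin 2) ℝ, A.IsSymm → A ≠ 0 → 0 < Q A)
    (a b c : ℝ) : reducedQ₀ Q a ≤ Q !![a, b; b, c] :=
  (ciInf_le ⟨0, by rintro _ ⟨c, rfl⟩; exact reducedQ₁_nonneg hQ _ _⟩ b).trans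
    (reducedQ₁_le hQ a b c)

end QuadraticForms

/-! ### Quadratic energies along weakly convergent sequences -/

section QuadraticEnergy

variable {Ω : Set (ℝ × ℝ)}

theorem integrableOn_polar (Q : QuadraticForm ℝ (Matrix (Fin 2) (Fin 2) ℝ))
    {A B : ℝ × ℝ → Matrix (Fin 2) (Fin 2) ℝ} (hA : ∀ i j, MemL2 Ω fun x => A x i j)
    (hB : ∀ i j, MemL2 Ω fun x => B x i j) :
    IntegrableOn (fun x => QuadraticMap.polar Q (A x) (B x)) Ω := by
  simp only [fun x => polar_eq_sum Q (A x) (B x)]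
  refine integrable_finsetSum _ fun k _ => integrable_finsetSum _ fun m _ =>
    integrable_finsetSum _ fun i _ => integrable_finsetSum _ fun j _ => ?_
  exact ((hA k m).integrable_mul (hB i j)).const_mul _

theorem integral_polar (Q : QuadraticForm ℝ (Matrix (Fin 2) (Fin 2) ℝ))
    {A B : ℝ × ℝ → Matrix (Fin 2) (Fin 2) ℝ} (hA : ∀ i j, MemL2 Ω fun x => A x i j)
    (hB : ∀ i j, MemL2 Ω fun x => B x i j) :
    ∫ x in Ω, QuadraticMap.polar Q (A x) (B x) = ∑ k, ∑ m, ∑ i, ∑ j,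
      QuadraticMap.polar Q (Matrix.single k m 1) (Matrix.single i j 1) *
        ∫ x in Ω, A x k m * B x i j := by
  have h : ∀ k m i j, IntegrableOn (fun x => QuadraticMap.polar Q (Matrix.single k m 1)
      (Matrix.single i j 1) * (A x k m * B x i j)) Ω := fun k m i j =>
    ((hA k m).integrable_mul (hB i j)).const_mul _
  simp only [fun x => polar_eq_sum Q (A x) (B x)]
  rw [integral_finsetSum _ fun k _ => integrable_finsetSum _ fun m _ =>
    integrable_finsetSum _ fun i _ => integrable_finsetSum _ fun j _ => h k m i j]
  refine Finset.sum_congr rfl fun k _ => ?_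
  rw [integral_finsetSum _ fun m _ =>
    integrable_finsetSum _ fun i _ => integrable_finsetSum _ fun j _ => h k m i j]
  refine Finset.sum_congr rfl fun m _ => ?_
  rw [integral_finsetSum _ fun i _ => integrable_finsetSum _ fun j _ => h k m i j]
  refine Finset.sum_congr rfl fun i _ => ?_
  rw [integral_finsetSum _ fun j _ => h k m i j]
  simp only [integral_const_mul]

theorem integrableOn_quadraticForm (Q : QuadraticForm ℝ (Matrix (Fin 2) (Fin 2) ℝ))
    {A : ℝ × ℝ → Matrix (Fin 2) (Fin 2) ℝ} (hA : ∀ i j, MemL2 Ω fun x => A x i j) :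
    IntegrableOn (fun x => Q (A x)) Ω := by
  have h : ∀ x, Q (A x) = 1 / 2 * QuadraticMap.polar Q (A x) (A x) := fun x => by
    rw [← two_mul_quadraticForm]; ring
  simp only [h]
  exact (integrableOn_polar Q hA hA).const_mul _

/-- Expansion of a quadratic energy along a weakly convergent sequence. -/
theorem tendsto_integral_quadraticForm_sub (Q : QuadraticForm ℝ (Matrix (Fin 2) (Fin 2) ℝ))
    {A : ℕ → ℝ × ℝ → Matrix (Fin 2) (Fin 2) ℝ} {A₀ : ℝ × ℝ → Matrix (Fin 2) (Fin 2) ℝ}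
    (h : ∀ i j, WeakL2 Ω (fun n x => A n x i j) (fun x => A₀ x i j)) :
    Tendsto (fun n => (∫ x in Ω, Q (A n x)) - ∫ x in Ω, Q (A n x - A₀ x)) atTop
      (𝓝 (∫ x in Ω, Q (A₀ x))) := by
  have hA : ∀ n i j, MemL2 Ω fun x => A n x i j := fun n i j => (h i j).1 n
  have hA₀ : ∀ i j, MemL2 Ω fun x => A₀ x i j := fun i j => (h i j).2.1
  have hD : ∀ n i j, MemL2 Ω fun x => (A n x - A₀ x) i j := fun n i j => (hA n i j).sub (hA₀ i j)
  -- Q(A) − Q(A − A₀) = Q(A₀) + polar(A − A₀, A₀), and the polar term is linear in the weakly null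
  -- sequence.
  have e : ∀ n, (∫ x in Ω, Q (A n x)) - ∫ x in Ω, Q (A n x - A₀ x)
      = (∫ x in Ω, Q (A₀ x)) + ∫ x in Ω, QuadraticMap.polar Q (A n x - A₀ x) (A₀ x) := by
    intro n
    rw [← integral_sub (integrableOn_quadraticForm Q (hA n)) (integrableOn_quadraticForm Q (hD n)),
      ← integral_add (integrableOn_quadraticForm Q hA₀) (integrableOn_polar Q (hD n) hA₀)]
    refine integral_congr_ae (ae_of_all _ fun x => ?_)
    have := QuadraticMap.map_add Q (A n x - A₀ x) (A₀ x)
    rw [sub_add_cancel] at this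
    simp only [this]
    ring
  simp only [e]
  have hz : Tendsto (fun n => ∫ x in Ω, QuadraticMap.polar Q (A n x - A₀ x) (A₀ x)) atTop
      (𝓝 0) := by
    simp only [fun n => integral_polar Q (hD n) hA₀]
    have : (0 : ℝ) = ∑ k, ∑ m, ∑ i, ∑ j,
        QuadraticMap.polar Q (Matrix.single k m 1) (Matrix.single i j 1) * (0 : ℝ) := by simp
    rw [this]
    refine tendsto_finsetSum _ fun k _ => tendsto_finsetSum _ fun m _ =>
      tendsto_finsetSum _ fun i _ => tendsto_finsetSum _ fun j _ => ?_
    refine Tendsto.const_mul _ ?_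
    have := (h k m).sub_self.2.2 _ (hA₀ i j)
    simpa using this
  simpa using hz.const_add (∫ x in Ω, Q (A₀ x))

/-- Coercivity bounds each squared entry by κ⁻¹Q. Q need not be positive off the symmetric matrices,
so symmetry of the difference is required. -/
theorem strongL2_of_tendsto_integral_quadraticForm
    {Q : QuadraticForm ℝ (Matrix (Fin 2) (Fin 2) ℝ)}
    (hQ : ∀ A : Matrix (Fin 2) (Fin 2) ℝ, A.IsSymm → A ≠ 0 → 0 < Q A)
    {A : ℕ → ℝ × ℝ → Matrix (Fin 2) (Fin 2) ℝ} {A₀ : ℝ × ℝ → Matrix (Fin 2) (Fin 2) ℝ}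
    (hA : ∀ n i j, MemL2 Ω fun x => A n x i j) (hA₀ : ∀ i j, MemL2 Ω fun x => A₀ x i j)
    (hs : ∀ n, ∀ᵐ x ∂volume.restrict Ω, (A n x - A₀ x).IsSymm)
    (h : Tendsto (fun n => ∫ x in Ω, Q (A n x - A₀ x)) atTop (𝓝 0)) (i j : Fin 2) :
    StrongL2 Ω (fun n x => A n x i j) (fun x => A₀ x i j) := by
  obtain ⟨κ, hκ, hc⟩ := exists_coercive hQ
  refine StrongL2.of_tendsto (fun n => hA n i j) (hA₀ i j) ?_
  refine tendsto_of_nonneg_le (b := fun n => κ⁻¹ * ∫ x in Ω, Q (A n x - A₀ x))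
    (fun n => integral_sq_nonneg _) (fun n => ?_) (by simpa using h.const_mul κ⁻¹)
  rw [← integral_const_mul]
  refine integral_mono_ae ((hA n i j).sub (hA₀ i j)).integrable_sq
    ((integrableOn_quadraticForm Q fun i j => (hA n i j).sub (hA₀ i j)).const_mul _) ?_
  filter_upwards [hs n] with x hx
  have := hc _ hx i j
  rw [Matrix.sub_apply] at this
  rw [inv_mul_eq_div, le_div_iff₀ hκ, mul_comm]
  exact this

end QuadraticEnergy

/-! ### From weak to strong Sobolev convergence -/

section Upgrade

variable {Ω : Set (ℝ × ℝ)}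

theorem MemW12.weakDeriv_ae_eq_pd (hΩ : IsOpen Ω) {f : ℝ × ℝ → ℝ} (hf : MemW12 Ω f) (e : ℝ × ℝ) :
    (fun x => e.1 * pd Ω 0 f x + e.2 * pd Ω 1 f x) =ᵐ[volume.restrict Ω] weakDeriv Ω e f := by
  have h := ((hf.hasWeakDeriv (dir 0)).smul_dir e.1).add_dir
    ((hf.hasWeakDeriv (dir 1)).smul_dir e.2)
  have he : e.1 • dir 0 + e.2 • dir 1 = e := by ext <;> simp [dir]
  rw [he] at h
  exact h.ae_eq_weakDeriv hΩ

/-- The functions converge strongly by Rellich, and every directional derivative is a combination of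
the two partial ones. The strong limits need not be identified beforehand, since they must coincide
with the weak ones. -/
theorem ConvW12.upgrade (hΩ : IsStarDomain Ω) {F : ℕ → ℝ × ℝ → ℝ} {G : ℝ × ℝ → ℝ}
    (h : ConvW12 WeakL2 Ω F G) (hs : ∀ i, ∃ G', StrongL2 Ω (fun n => pd Ω i (F n)) G') :
    ConvW12 StrongL2 Ω F G := by
  refine ⟨h.1, h.2.1, h.strongL2 hΩ, fun e => ?_⟩
  obtain ⟨G₀, h0⟩ := hs 0
  obtain ⟨G₁, h1⟩ := hs 1
  exact (h.2.2.2 e).strong_of ((h0.const_mul tendsto_const_nhds).add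
    (h1.const_mul tendsto_const_nhds)) fun n => (h.1 n).weakDeriv_ae_eq_pd hΩ.isOpen e

/-- First derivatives converge weakly in W^{1,2}, hence strongly in L² by Rellich; only second
partial derivatives need a hypothesis. -/
theorem ConvW22.upgrade (hΩ : IsStarDomain Ω) {F : ℕ → ℝ × ℝ → ℝ} {G : ℝ × ℝ → ℝ}
    (h : ConvW22 WeakL2 Ω F G)
    (hs : ∀ i j, ∃ G', StrongL2 Ω (fun n => pd Ω i (pd Ω j (F n))) G') :
    ConvW22 StrongL2 Ω F G := by
  refine ⟨h.1.upgrade hΩ fun i => ⟨_, (h.2 (dir i)).strongL2 hΩ⟩, fun e =>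
    (h.2 e).upgrade hΩ fun i => ?_⟩
  obtain ⟨G₀, h0⟩ := hs i 0
  obtain ⟨G₁, h1⟩ := hs i 1
  have hadd := (h0.const_mul (tendsto_const_nhds (x := e.1))).add
    (h1.const_mul (tendsto_const_nhds (x := e.2)))
  refine ⟨_, hadd.congr (fun n => ?_) (ae_eq_refl _)⟩
  have hd : ∀ j, HasWeakDeriv Ω (dir i) (pd Ω j (F n)) (pd Ω i (pd Ω j (F n))) := fun j =>
    ((h.2 (dir j)).1 n).hasWeakDeriv _
  have hc := (((hd 0).const_mul e.1).add ((hd 1).const_mul e.2)).ae_eq_weakDeriv hΩ.isOpen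
  have hmem := (h.2 e).1 n
  have heq := (h.1.1 n).weakDeriv_ae_eq_pd hΩ.isOpen e
  exact hc.trans (weakDeriv_congr_ae hΩ heq.symm hmem (dir i)).symm

end Upgrade

/-! ### Passing to the limit in strains, forces and derivatives -/

section Limits

variable {l : ℝ}

theorem integral_rect_fst (h : ℝ → ℝ) :
    ∫ x in rect l 1, h x.1 = ∫ t in interval l, h t := by
  have := setIntegral_prod_mul (μ := (volume : Measure ℝ)) (ν := (volume : Measure ℝ)) h
    (fun _ => (1 : ℝ)) (interval l) (interval 1)
  rw [← Measure.volume_eq_prod] at this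
  have h1 : volume.real (interval 1) = 1 := by
    simp only [interval, Measure.real, Real.volume_Ioo]
    norm_num
  simpa [rect, h1] using this

/-- Convergence of the energy to its lower bound forces strong convergence. -/
theorem strongL2_of_energy {Ω : Set (ℝ × ℝ)} {Q : QuadraticForm ℝ (Matrix (Fin 2) (Fin 2) ℝ)}
    (hQ : ∀ A : Matrix (Fin 2) (Fin 2) ℝ, A.IsSymm → A ≠ 0 → 0 < Q A)
    {A H : ℕ → ℝ × ℝ → Matrix (Fin 2) (Fin 2) ℝ} {A₀ H₀ : ℝ × ℝ → Matrix (Fin 2) (Fin 2) ℝ}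
    (hA : ∀ i j, WeakL2 Ω (fun n x => A n x i j) (fun x => A₀ x i j))
    (hH : ∀ i j, WeakL2 Ω (fun n x => H n x i j) (fun x => H₀ x i j))
    (hAs : ∀ n, ∀ᵐ x ∂volume.restrict Ω, (A n x - A₀ x).IsSymm)
    (hHs : ∀ n, ∀ᵐ x ∂volume.restrict Ω, (H n x - H₀ x).IsSymm) {a b c : ℝ} (ha : 0 < a)
    (hb : 0 < b)
    (hE : Tendsto (fun n => a * (∫ x in Ω, Q (A n x)) + b * ∫ x in Ω, Q (H n x)) atTop (𝓝 c))
    (hc : c ≤ a * (∫ x in Ω, Q (A₀ x)) + b * ∫ x in Ω, Q (H₀ x)) :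
    (∀ i j, StrongL2 Ω (fun n x => A n x i j) (fun x => A₀ x i j)) ∧
      ∀ i j, StrongL2 Ω (fun n x => H n x i j) (fun x => H₀ x i j) := by
  have hA0 : ∀ n, 0 ≤ ∫ x in Ω, Q (A n x - A₀ x) := fun n => by
    refine integral_nonneg_of_ae ?_
    filter_upwards [hAs n] with x hx using nonneg_of_isSymm hQ hx
  have hH0 : ∀ n, 0 ≤ ∫ x in Ω, Q (H n x - H₀ x) := fun n => by
    refine integral_nonneg_of_ae ?_
    filter_upwards [hHs n] with x hx using nonneg_of_isSymm hQ hx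
  have h1 := tendsto_integral_quadraticForm_sub Q hA
  have h2 := tendsto_integral_quadraticForm_sub Q hH
  have hsum : Tendsto (fun n => a * (∫ x in Ω, Q (A n x - A₀ x))
      + b * ∫ x in Ω, Q (H n x - H₀ x)) atTop
      (𝓝 (c - (a * (∫ x in Ω, Q (A₀ x)) + b * ∫ x in Ω, Q (H₀ x)))) := by
    refine (hE.sub ((h1.const_mul a).add (h2.const_mul b))).congr fun n => ?_
    ring
  -- The limit is nonnegative by positivity of Q and nonpositive by `hc`, so it is 0. Since both
  -- summands are nonnegative, each tends to 0 separately.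
  have hnn := ge_of_tendsto' hsum fun n => add_nonneg (mul_nonneg ha.le (hA0 n))
    (mul_nonneg hb.le (hH0 n))
  rw [show c - (a * (∫ x in Ω, Q (A₀ x)) + b * ∫ x in Ω, Q (H₀ x)) = 0 by linarith] at hsum
  have hAz : Tendsto (fun n => ∫ x in Ω, Q (A n x - A₀ x)) atTop (𝓝 0) := by
    refine tendsto_of_nonneg_le hA0 (fun n => ?_) (by simpa using hsum.const_mul a⁻¹)
    rw [inv_mul_eq_div, le_div_iff₀ ha]
    nlinarith [mul_nonneg hb.le (hH0 n)]
  have hHz : Tendsto (fun n => ∫ x in Ω, Q (H n x - H₀ x)) atTop (𝓝 0) := by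
    refine tendsto_of_nonneg_le hH0 (fun n => ?_) (by simpa using hsum.const_mul b⁻¹)
    rw [inv_mul_eq_div, le_div_iff₀ hb]
    nlinarith [mul_nonneg ha.le (hA0 n)]
  exact ⟨strongL2_of_tendsto_integral_quadraticForm hQ (fun n i j => (hA i j).1 n)
      (fun i j => (hA i j).2.1) hAs hAz,
    strongL2_of_tendsto_integral_quadraticForm hQ (fun n i j => (hH i j).1 n)
      (fun i j => (hH i j).2.1) hHs hHz⟩

theorem scaledStrain_isSymm (ε : ℝ) (y : Fin 2 → ℝ × ℝ → ℝ) (x : ℝ × ℝ) :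
    (scaledStrain l ε y x).IsSymm := by
  have h : scaledStrain l ε y x = !![pd (rect l 1) 0 (y 0) x,
      1 / (2 * ε) * (pd (rect l 1) 0 (y 1) x + pd (rect l 1) 1 (y 0) x);
      1 / (2 * ε) * (pd (rect l 1) 0 (y 1) x + pd (rect l 1) 1 (y 0) x),
      1 / ε ^ 2 * pd (rect l 1) 1 (y 1) x] := by
    simp only [scaledStrain, add_comm (pd (rect l 1) 1 (y 0) x)]
  rw [h]
  exact isSymm_of _ _ _

theorem isSymm_vecMul (p : Fin 2 → ℝ) : (Matrix.of fun i j => p i * p j).IsSymm := by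
  ext i j
  simp [mul_comm]

theorem karmanStrain_isSymm (ε : ℝ) (u : Fin 2 → ℝ × ℝ → ℝ) (v : ℝ × ℝ → ℝ) (x : ℝ × ℝ) :
    (karmanStrain l ε u v x).IsSymm :=
  (scaledStrain_isSymm _ _ _).add ((isSymm_vecMul fun _ => _).smul _)

/-- The mixed weak derivatives commute, but only almost everywhere, since each is a chosen
representative. -/
theorem scaledHessian_isSymm (hl : 0 < l) (ε : ℝ) {w : ℝ × ℝ → ℝ} (hw : MemW22 (rect l 1) w) :
    ∀ᵐ x ∂volume.restrict (rect l 1), (scaledHessian l ε w x).IsSymm := by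
  have h := HasWeakDeriv.comm (isStarDomain_rect hl one_pos).isOpen (hw.1.hasWeakDeriv (dir 0))
    (hw.1.hasWeakDeriv (dir 1)) ((hw.2 (dir 0)).hasWeakDeriv (dir 1))
    ((hw.2 (dir 1)).hasWeakDeriv (dir 0))
  filter_upwards [h] with x hx
  have h' : scaledHessian l ε w x = !![hessian (rect l 1) w x 0 0,
      1 / ε * hessian (rect l 1) w x 0 1; 1 / ε * hessian (rect l 1) w x 0 1,
      1 / ε ^ 2 * hessian (rect l 1) w x 1 1] := by
    have : hessian (rect l 1) w x 1 0 = hessian (rect l 1) w x 0 1 := hx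
    simp only [scaledHessian, this]
  rw [h']
  exact isSymm_of _ _ _

/-- The only nonlinear passage to the limit: the products of scaled gradient components converge
strongly, as these components converge weakly in W^{1,2}. -/
theorem weakL2_karmanStrain (hl : 0 < l) {ε : ℕ → ℝ} {u : ℕ → Fin 2 → ℝ × ℝ → ℝ}
    {v : ℕ → ℝ × ℝ → ℝ} {E : ℝ × ℝ → Matrix (Fin 2) (Fin 2) ℝ} {p : Fin 2 → ℝ × ℝ → ℝ}
    (hE : ∀ i j, WeakL2 (rect l 1)
      (fun n x => scaledStrain l (ε n) (scaledU (ε n) (u n)) x i j) (fun x => E x i j))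
    (hp : ∀ i, ConvW12 WeakL2 (rect l 1)
      (fun n => scaledGrad l (ε n) (scaledV (ε n) (v n)) i) (p i)) (i j : Fin 2) :
    WeakL2 (rect l 1) (fun n x => karmanStrain l (ε n) (u n) (v n) x i j)
      (fun x => (E x + (1 / 2 : ℝ) • Matrix.of fun i j => p i x * p j x) i j) :=
  (hE i j).add (((hp i).strongL2_mul hl (hp j)).weak.const_mul (1 / 2))

/-- Each term pairs a weakly convergent force with a strongly convergent displacement. -/
theorem tendsto_integral_forces {ε : ℕ → ℝ} {f : ℕ → ℝ × ℝ → ℝ}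
    {g : ℕ → Fin 2 → ℝ × ℝ → ℝ} {f₁ : ℝ → ℝ} {g₁ : Fin 2 → ℝ → ℝ}
    (hf : WeakL2 (rect l 1) (fun n x => f n (x.1, ε n * x.2)) (fun x => f₁ x.1))
    (hg₀ : WeakL2 (rect l 1) (fun n x => g n 0 (x.1, ε n * x.2)) (fun x => g₁ 0 x.1))
    (hg₁ : WeakL2 (rect l 1) (fun n x => 1 / ε n * g n 1 (x.1, ε n * x.2))
      (fun x => g₁ 1 x.1)) {W : ℕ → ℝ × ℝ → ℝ} {Y : ℕ → Fin 2 → ℝ × ℝ → ℝ} {w : ℝ → ℝ}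
    {y : Fin 2 → ℝ × ℝ → ℝ} (hW : StrongL2 (rect l 1) W (fun x => w x.1))
    (hY : ∀ i, StrongL2 (rect l 1) (fun n => Y n i) (y i)) :
    Tendsto (fun n => ∫ x in rect l 1, (f n (x.1, ε n * x.2) * W n x
      + g n 0 (x.1, ε n * x.2) * Y n 0 x + 1 / ε n * g n 1 (x.1, ε n * x.2) * Y n 1 x)) atTop
      (𝓝 (∫ x in rect l 1, (f₁ x.1 * w x.1 + ∑ i, g₁ i x.1 * y i x))) := by
  have h := ((hf.tendsto_integral_mul hW).add (hg₀.tendsto_integral_mul (hY 0))).add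
    (hg₁.tendsto_integral_mul (hY 1))
  have e : ∫ x in rect l 1, (f₁ x.1 * w x.1 + ∑ i, g₁ i x.1 * y i x)
      = (∫ x in rect l 1, f₁ x.1 * w x.1) + (∫ x in rect l 1, g₁ 0 x.1 * y 0 x)
        + ∫ x in rect l 1, g₁ 1 x.1 * y 1 x := by
    have i1 := hf.2.1.integrable_mul hW.2.1
    have i2 := hg₀.2.1.integrable_mul (hY 0).2.1
    have i3 := hg₁.2.1.integrable_mul (hY 1).2.1
    have i12 : IntegrableOn (fun x => f₁ x.1 * w x.1 + g₁ 0 x.1 * y 0 x) (rect l 1) := i1.add i2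
    rw [← integral_add i1 i2, ← integral_add i12 i3]
    simp only [Fin.sum_univ_two, add_assoc]
  rw [e]
  refine h.congr fun n => ?_
  have i1 := (hf.1 n).integrable_mul (hW.1 n)
  have i2 := (hg₀.1 n).integrable_mul ((hY 0).1 n)
  have i3 := (hg₁.1 n).integrable_mul ((hY 1).1 n)
  have i12 : IntegrableOn (fun x => f n (x.1, ε n * x.2) * W n x
      + g n 0 (x.1, ε n * x.2) * Y n 0 x) (rect l 1) := i1.add i2
  rw [integral_add i12 i3, integral_add i1 i2]

/-- Strong convergence of all first derivatives of the scaled displacements, by Korn's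
inequality. -/
theorem strongL2_pd_scaledU (hl : 0 < l) {ε : ℕ → ℝ} (hεpos : ∀ n, 0 < ε n)
    (hε : Tendsto ε atTop (𝓝 0)) {Y : ℕ → Fin 2 → ℝ × ℝ → ℝ} {y : Fin 2 → ℝ × ℝ → ℝ}
    (hY : ∀ i, ConvW12 WeakL2 (rect l 1) (fun n => Y n i) (y i))
    {E : ℝ × ℝ → Matrix (Fin 2) (Fin 2) ℝ}
    (hE : ∀ i j, StrongL2 (rect l 1) (fun n x => scaledStrain l (ε n) (Y n) x i j)
      (fun x => E x i j)) (i j : Fin 2) :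
    ∃ G, StrongL2 (rect l 1) (fun n => pd (rect l 1) i (Y n j)) G := by
  have hS := isStarDomain_rect hl one_pos
  have hΩ := hS.isOpen
  have h00 : StrongL2 (rect l 1) (fun n => pd (rect l 1) 0 (Y n 0)) (pd (rect l 1) 0 (y 0)) :=
    ((hY 0).2.2.2 (dir 0)).strong_of (hE 0 0) fun n => ae_eq_refl _
  -- Multiplying the scaled strain entries by ε², and by 2ε for the shear below, undoes the scaling;
  -- strong convergence persists since these factors converge.
  have h11 : StrongL2 (rect l 1) (fun n => pd (rect l 1) 1 (Y n 1)) (pd (rect l 1) 1 (y 1)) := by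
    refine ((hY 1).2.2.2 (dir 1)).strong_of ((hE 1 1).const_mul (c := fun n => ε n ^ 2)
      (by simpa using hε.pow 2)) fun n => ae_of_all _ fun x => ?_
    have := (hεpos n).ne'
    simp [scaledStrain, pd]
    field_simp
  have hsum : StrongL2 (rect l 1)
      (fun n x => pd (rect l 1) 1 (Y n 0) x + pd (rect l 1) 0 (Y n 1) x)
      (fun x => pd (rect l 1) 1 (y 0) x + pd (rect l 1) 0 (y 1) x) := by
    refine (((hY 0).2.2.2 (dir 1)).add ((hY 1).2.2.2 (dir 0))).strong_of
      ((hE 1 0).const_mul (c := fun n => 2 * ε n) (by simpa using hε.const_mul 2)) fun n =>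
      ae_of_all _ fun x => ?_
    have := (hεpos n).ne'
    simp [scaledStrain, pd]
    field_simp
  -- The strains determine only the sum of the mixed derivatives. Korn's inequality for yₙ − y
  -- bounds ∂₂ of the first component by strain differences and L² differences, all tending to 0.
  have h10 : StrongL2 (rect l 1) (fun n => pd (rect l 1) 1 (Y n 0)) (pd (rect l 1) 1 (y 0)) := by
    obtain ⟨C, hC, hK⟩ := korn_rect hl
    have z0 := (strongL2_iff.1 ((hY 0).strongL2 hS)).2.2
    have z1 := (strongL2_iff.1 ((hY 1).strongL2 hS)).2.2
    have a0 := (strongL2_iff.1 h00).2.2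
    have a1 := (strongL2_iff.1 h11).2.2
    have a2 := (strongL2_iff.1 hsum).2.2
    refine StrongL2.of_tendsto ((hY 0).2.2.2 (dir 1)).1 ((hY 0).2.2.2 (dir 1)).2.1 ?_
    have hlim := ((((a2.add a0).add a1).add z0).add z1).const_mul C
    simp only [add_zero, mul_zero] at hlim
    refine tendsto_of_nonneg_le (fun n => integral_sq_nonneg _) (fun n => ?_) hlim
    have hk := hK _ _ (((hY 0).1 n).sub hΩ (hY 0).2.1) (((hY 1).1 n).sub hΩ (hY 1).2.1)
    have d := fun i j => weakDeriv_sub_ae hΩ (e := dir i) ((hY j).1 n) (hY j).2.1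
    have c : ∀ i j, ∫ x in rect l 1, pd (rect l 1) i (fun x => Y n j x - y j x) x ^ 2
        = ∫ x in rect l 1, (pd (rect l 1) i (Y n j) x - pd (rect l 1) i (y j) x) ^ 2 :=
      fun i j => integral_congr_ae (by filter_upwards [d i j] with x hx; simp only [pd, hx])
    have cs : ∫ x in rect l 1, (pd (rect l 1) 1 (fun x => Y n 0 x - y 0 x) x
          + pd (rect l 1) 0 (fun x => Y n 1 x - y 1 x) x) ^ 2
        = ∫ x in rect l 1, (pd (rect l 1) 1 (Y n 0) x + pd (rect l 1) 0 (Y n 1) x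
          - (pd (rect l 1) 1 (y 0) x + pd (rect l 1) 0 (y 1) x)) ^ 2 :=
      integral_congr_ae (by
        filter_upwards [d 1 0, d 0 1] with x hx hx'
        simp only [pd, hx, hx']
        ring)
    rw [c, c, c, cs] at hk
    exact hk
  have h01 : StrongL2 (rect l 1) (fun n => pd (rect l 1) 0 (Y n 1)) (pd (rect l 1) 0 (y 1)) := by
    have := hsum.sub h10
    simpa only [add_sub_cancel_left] using this
  fin_cases i <;> fin_cases j
  exacts [⟨_, h00⟩, ⟨_, h01⟩, ⟨_, h10⟩, ⟨_, h11⟩]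

/-- The unscaled second derivative is the scaled one times one factor 1 or ε per index, which
converges to `scaleFactor 0 i * scaleFactor 0 j`. -/
theorem strongL2_pd_pd {ε : ℕ → ℝ} (hεpos : ∀ n, 0 < ε n)
    (hε : Tendsto ε atTop (𝓝 0)) {W : ℕ → ℝ × ℝ → ℝ} {H : ℝ × ℝ → Matrix (Fin 2) (Fin 2) ℝ}
    (hH : ∀ i j, StrongL2 (rect l 1) (fun n x => scaledHessian l (ε n) (W n) x i j)
      (fun x => H x i j)) (i j : Fin 2) :
    ∃ G, StrongL2 (rect l 1) (fun n => pd (rect l 1) i (pd (rect l 1) j (W n))) G := by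
  have hc : Tendsto (fun n => scaleFactor (ε n) i * scaleFactor (ε n) j) atTop
      (𝓝 (scaleFactor 0 i * scaleFactor 0 j)) := by
    fin_cases i <;> fin_cases j <;> simp [scaleFactor, hε]
    simpa using hε.mul hε
  refine ⟨_, ((hH i j).const_mul hc).congr (fun n => ae_of_all _ fun x => ?_) (ae_eq_refl _)⟩
  have := (hεpos n).ne'
  fin_cases i <;> fin_cases j <;> simp [scaleFactor, scaledHessian, hessian] <;> field_simp

/-- The scaled gradient already contains the factor of the index j, so only that of the outer
derivative remains. -/
theorem strongL2_pd_scaledGrad (hl : 0 < l) {ε : ℕ → ℝ} (hεpos : ∀ n, 0 < ε n)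
    (hε : Tendsto ε atTop (𝓝 0)) {W : ℕ → ℝ × ℝ → ℝ} {H : ℝ × ℝ → Matrix (Fin 2) (Fin 2) ℝ}
    (hW : ∀ n, MemW22 (rect l 1) (W n))
    (hH : ∀ i j, StrongL2 (rect l 1) (fun n x => scaledHessian l (ε n) (W n) x i j)
      (fun x => H x i j)) (i j : Fin 2) :
    ∃ G, StrongL2 (rect l 1) (fun n => pd (rect l 1) i (scaledGrad l (ε n) (W n) j)) G := by
  have hc : Tendsto (fun n => scaleFactor (ε n) i) atTop (𝓝 (scaleFactor 0 i)) := by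
    fin_cases i <;> simp [scaleFactor, hε]
  have hS := isStarDomain_rect hl one_pos
  refine ⟨_, ((hH i j).const_mul hc).congr (fun n => ?_) (ae_eq_refl _)⟩
  have hd := ((hW n).2 (dir j)).hasWeakDeriv (dir i)
  have h := (hd.const_mul (![1, 1 / ε n] j)).ae_eq_weakDeriv hS.isOpen
  have hg : scaledGrad l (ε n) (W n) j = fun x => ![1, 1 / ε n] j * pd (rect l 1) j (W n) x := by
    fin_cases j <;> simp [scaledGrad]
  rw [hg]
  refine Filter.EventuallyEq.trans (ae_of_all _ fun x => ?_) h
  have := (hεpos n).ne'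
  fin_cases i <;> fin_cases j <;> simp [scaleFactor, scaledHessian, hessian, pd] <;> field_simp

end Limits

end Ribbon

end

/-! ### Convergence of energies implies strong convergence -/

theorem lemma5p8
    -- length of the ribbon
    (l : ℝ) (hl : 0 < l)
    -- elastic quadratic form
    (Q : QuadraticForm ℝ (Matrix (Fin 2) (Fin 2) ℝ))
    (hQsymm : ∀ A : Matrix (Fin 2) (Fin 2) ℝ, Q A = Q ((1 / 2 : ℝ) • (A + A.transpose)))
    (hQpos : ∀ A : Matrix (Fin 2) (Fin 2) ℝ, A.IsSymm → A ≠ 0 → 0 < Q A)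
    -- boundary data
    (uhat₁ uhat₂ vhat : ℝ → ℝ)
    (huhat₁ : MemW12 (interval l) uhat₁)
    (huhat₂ : MemW22 (interval l) uhat₂)
    (hvhat : MemW22 (interval l) vhat)
    -- null sequence of widths
    (ε : ℕ → ℝ) (hεpos : ∀ n, 0 < ε n) (hε : Tendsto ε atTop (𝓝 0))
    -- forces
    (f : ℕ → ℝ × ℝ → ℝ) (g : ℕ → Fin 2 → ℝ × ℝ → ℝ)
    (hf : ∀ n, MemL2 (rect l (ε n)) (f n))
    (hg : ∀ n i, MemL2 (rect l (ε n)) (g n i))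
    (f₁ : ℝ → ℝ) (g₁ : Fin 2 → ℝ → ℝ)
    (hf₁ : MemL2 (interval l) f₁) (hg₁ : ∀ i, MemL2 (interval l) (g₁ i))
    (hfconv : WeakL2 (rect l 1) (fun n x => f n (x.1, ε n * x.2)) (fun x => f₁ x.1))
    (hgconv₁ : WeakL2 (rect l 1) (fun n x => g n 0 (x.1, ε n * x.2)) (fun x => g₁ 0 x.1))
    (hgconv₂ : WeakL2 (rect l 1) (fun n x => 1 / ε n * g n 1 (x.1, ε n * x.2))
      (fun x => g₁ 1 x.1))
    -- displacements and limiting variables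
    (u : ℕ → Fin 2 → ℝ × ℝ → ℝ) (v : ℕ → ℝ × ℝ → ℝ)
    (huv : ∀ n, Admissible2D l (ε n) uhat₁ uhat₂ vhat (u n) (v n))
    (y : Fin 2 → ℝ × ℝ → ℝ) (w θ : ℝ → ℝ)
    (hlim : Admissible1D l uhat₁ uhat₂ vhat y w θ)
    -- weak convergence and convergence of the energies
    (hσ : ConvPiSigma l ε u v y w θ)
    (hφ : Tendsto (fun n => energy2D Q l (ε n) (f n) (g n) (u n) (v n)) atTop
      (𝓝 (energy1D Q l f₁ g₁ y w θ))) :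
    ConvPiRho l ε u v y w θ := by
  have hS := isStarDomain_rect hl one_pos
  obtain ⟨hw, hp0, hp1, ⟨γ, hγ, hH⟩, hy, E, hE2, hEs, hE00, hE⟩ := hσ
  let p : Fin 2 → ℝ × ℝ → ℝ := ![fun x => D l w x.1, fun x => θ x.1]
  have hp : ∀ i, ConvW12 WeakL2 (rect l 1)
      (fun n => scaledGrad l (ε n) (scaledV (ε n) (v n)) i) (p i) := by
    intro i
    fin_cases i
    exacts [hp0, hp1]
  let A₀ : ℝ × ℝ → Matrix (Fin 2) (Fin 2) ℝ := fun x =>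
    E x + (1 / 2 : ℝ) • Matrix.of fun i j => p i x * p j x
  let H₀ : ℝ × ℝ → Matrix (Fin 2) (Fin 2) ℝ := fun x =>
    !![D l (D l w) x.1, D l θ x.1; D l θ x.1, γ x]
  have hA₀s : ∀ x, (A₀ x).IsSymm := fun x => (hEs x).add ((isSymm_vecMul fun _ => _).smul _)
  have hWn : ∀ n, MemW22 (rect l 1) (scaledV (ε n) (v n)) := fun n =>
    ⟨hw.1.1 n, fun e => (hw.2 e).1 n⟩
  have hA := weakL2_karmanStrain hl hE hp
  have hforce := tendsto_integral_forces hfconv hgconv₁ hgconv₂ (hw.1.strongL2 hS)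
    fun i => (hy i).strongL2 hS
  -- Adding back the force terms isolates the elastic energies; their limit is the elastic part of
  -- φ₀.
  have hEn := hφ.add hforce
  -- Since E₁₁ = ∂₁y₁, the (1,1) entry of A₀ is the argument of Q⁰ in φ₀; the other entries are
  -- arbitrary competitors in the infimum. Only the upper bound Q(A₀) has to be integrable.
  have hmemb : 1 / 2 * (∫ x in rect l 1,
        reducedQ₀ Q (pd (rect l 1) 0 (y 0) x + (D l w x.1) ^ 2 / 2))
      ≤ 1 / 2 * ∫ x in rect l 1, Q (A₀ x) := by
    refine mul_le_mul_of_nonneg_left ?_ (by norm_num)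
    refine integral_mono_of_nonneg (ae_of_all _ fun x => reducedQ₀_nonneg hQpos _)
      (integrableOn_quadraticForm Q fun i j => (hA i j).2.1) ?_
    filter_upwards [hE00] with x hx
    have h00 : A₀ x 0 0 = pd (rect l 1) 0 (y 0) x + (D l w x.1) ^ 2 / 2 := by
      rw [← hx]
      simp only [A₀, p, Matrix.add_apply, Matrix.smul_apply, Matrix.of_apply, smul_eq_mul,
        Matrix.cons_val_zero]
      ring
    rw [← h00, isSymm_iff_eq.1 (hA₀s x)]
    exact reducedQ₀_le hQpos _ _ _
  have hbend : 1 / 24 * (∫ t in interval l, reducedQ₁ Q (D l (D l w) t) (D l θ t))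
      ≤ 1 / 24 * ∫ x in rect l 1, Q (H₀ x) := by
    refine mul_le_mul_of_nonneg_left ?_ (by norm_num)
    -- The bending integrand does not depend on x₂ and the cross-section has length 1, so the
    -- integral over I becomes one over S.
    rw [← integral_rect_fst (l := l)]
    exact integral_mono_of_nonneg (ae_of_all _ fun x => reducedQ₁_nonneg hQpos _ _)
      (integrableOn_quadraticForm Q fun i j => (hH i j).2.1)
      (ae_of_all _ fun x => reducedQ₁_le hQpos _ _ _)
  have hstrong := strongL2_of_energy hQpos hA hH
    (fun n => ae_of_all _ fun x => (karmanStrain_isSymm _ _ _ _).sub (hA₀s x))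
    (fun n => by
      filter_upwards [scaledHessian_isSymm hl (ε n) (hWn n)] with x hx
      exact hx.sub (isSymm_of _ _ _))
    (show (0 : ℝ) < 1 / 2 by norm_num) (show (0 : ℝ) < 1 / 24 by norm_num)
    (hEn.congr fun n => by
      rw [energy2D_eq (hεpos n) hl Q (f n) (g n) (u n) (huv n).1 (huv n).2.1 (hWn n)]
      ring)
    (by
      rw [energy1D, sub_add_cancel]
      exact add_le_add hmemb hbend)
  obtain ⟨hAst, hHst⟩ := hstrong
  have hEst : ∀ i j, StrongL2 (rect l 1)
      (fun n x => scaledStrain l (ε n) (scaledU (ε n) (u n)) x i j) (fun x => E x i j) := by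
    intro i j
    -- The products of scaled gradients converge strongly, so subtracting them from the strongly
    -- convergent total strain leaves the linear strain.
    have h := (hAst i j).sub (((hp i).strongL2_mul hl (hp j)).const_mul
      (tendsto_const_nhds (x := (1 / 2 : ℝ))))
    refine h.congr (fun n => ae_of_all _ fun x => ?_) (ae_of_all _ fun x => ?_)
    · simp [karmanStrain]
    · simp
  refine ⟨hw.upgrade hS (strongL2_pd_pd hεpos hε hHst), ?_, ?_, ⟨γ, hγ, hHst⟩, fun i => ?_,
    E, hE2, hEs, hE00, hEst⟩
  · exact hp0.upgrade hS fun i => strongL2_pd_scaledGrad hl hεpos hε hWn hHst i 0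
  · exact hp1.upgrade hS fun i => strongL2_pd_scaledGrad hl hεpos hε hWn hHst i 1
  · exact (hy i).upgrade hS fun j => strongL2_pd_scaledU hl hεpos hε hy hEst j i
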